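/- **Proposition 3 (The Taylor and Chapman-Enskog expansions give identical results).** *Scheme.* Let $v_j\in\mathbb{R}^d$ ($0\le j<q$) be discrete velocities, $M$ an invertible $q\times q$ real matrix, and split the moments $m=Mf$ of a particle distribution $f\in\mathbb{R}^q$ as $m=(W,Y)$ with $W\in\mathbb{R}^p$ (conserved) and $Y\in\mathbb{R}^{r}$, $p+r=q$ (nonconserved). Let $\Phi:U\to\mathbb{R}^r$ be $C^\infty$ on an open set $U\subset\mathbb{R}^p$ (possibly $U=\mathbb{R}^p$) and let $S$ be an invertible $r\times r$ matrix, with $\Sigma=S^{-1}-\tfrac12 I$. Relaxation maps $m=(W,Y)$ to $m^*=(W,Y^*)$, $Y^*=Y+S(\Phi(W)-Y)$, and $f^*=M^{-1}m^*$; one time step of the scheme is $f_j(x,t+\Delta t)=f_j^*(x-v_j\Delta t,t)$ for $x$ in the lattice $\mathcal{L}_{\Delta t}=\lambda\Delta t\,\mathcal{L}_1$ and $t\in\Delta t\,\mathbb{N}$. Here $\mathcal{L}_1$ is a fixed full-rank lattice of $\mathbb{R}^d$ and $v_j\in\lambda\mathcal{L}_1$; the numerical velocity $\lambda>0$ and $M,S,\Phi,v_j$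 do not depend on $\Delta t$ (acoustic scaling, fixed relaxation parameters). *Operators.* Let $\Lambda=M\,\mathrm{diag}\big(\sum_\alpha v_j^\alpha\partial_\alpha\big)M^{-1}$, with blocks $\Lambda^n=\begin{pmatrix}A_n&B_n\\C_n&D_n\end{pmatrix}$ (no index when $n=1$), and for operators $F,G$ of $W$ let $(\mathrm{d}F.G)(W)=\frac{d}{ds}F(W+sG(W))\big|_{s=0}$. Define $$\Gamma_1=AW+B\Phi(W),\qquad \Psi_1=\mathrm{d}\Phi.\Gamma_1-(CW+D\Phi(W)),\qquad \Gamma_2=B\Sigma\Psi_1,$$ $$\Psi_2=\Sigma\,\mathrm{d}\Psi_1.\Gamma_1+\mathrm{d}\Phi.\Gamma_2-D\Sigma\Psi_1,\qquad \Gamma_3=B\Sigma\Psi_2-\tfrac16B\,\mathrm{d}\Psi_1.\Gamma_1+\tfrac1{12}B_2\Psi_1,$$ $$\Psi_3=\Sigma\,\mathrm{d}\Psi_1.\Gamma_2+\mathrm{d}\Phi.\Gamma_3-D\Sigma\Psi_2+\Sigma\,\mathrm{d}\Psi_2.\Gamma_1+\tfrac16D\,\mathrm{d}\Psi_1.\Gamma_1-\tfrac1{12}D_2\Psi_1-\tfrac1{12}\mathrm{d}(\mathrm{d}\Psi_1.\Gamma_1).\Gamma_1,$$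 $$\Gamma_4=B\Sigma\Psi_3+\tfrac14B_2\Psi_2+\tfrac16BD_2\Sigma\Psi_1-\tfrac16AB\Psi_2-\tfrac16B\,\mathrm{d}(\mathrm{d}\Phi.\Gamma_1).\Gamma_2-\tfrac16B\,\mathrm{d}(\mathrm{d}\Phi.\Gamma_2).\Gamma_1-\tfrac16B\Sigma\,\mathrm{d}(\mathrm{d}\Psi_1.\Gamma_1).\Gamma_1.$$ *Formal expansions.* All identities between operators are understood at every $x$ and every $W$ that is $C^\infty$ near $x$ with $W(x)\in U$. Operators $\Gamma'_1,\dots,\Gamma'_4$, $\Psi'_1,\Psi'_2,\Psi'_3$ are *Chapman-Enskog operators* for the reference time $\tau_0>0$ if, with $\varepsilon=\Delta t/\tau_0$, $\partial_t=\partial_{t_1}+\varepsilon\partial_{t_2}+\varepsilon^2\partial_{t_3}+\varepsilon^3\partial_{t_4}+\cdots$, where $\partial_{t_j}W=-\tau_0^{j-1}\Gamma'_j(W)$ and $\partial_{t_j}F(W)=\mathrm{d}F(W).\partial_{t_j}W$ (derivations that need not commute), and $Y=\Phi(W)+S^{-1}\sum_{j\le3}\varepsilon^j\tau_0^j\Psi'_j(W)+\cdots$,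 the formal expansions in $\varepsilon$ of the two sides of $\exp(\varepsilon\tau_0\partial_t)\,m=\exp(-\varepsilon\tau_0\Lambda)\,m^*$ agree up to order $4$ included in the conserved components and up to order $3$ included in the nonconserved ones. They are *Taylor operators* if the same identification holds in powers of $\Delta t$, to the same orders, for $\exp(\Delta t\,\partial_t)\,m=\exp(-\Delta t\,\Lambda)\,m^*$ with $\partial_tW=-(\Gamma'_1+\Delta t\Gamma'_2+\Delta t^2\Gamma'_3+\Delta t^3\Gamma'_4+\cdots)$ and $Y=\Phi(W)+S^{-1}(\Delta t\Psi'_1+\Delta t^2\Psi'_2+\Delta t^3\Psi'_3+\cdots)$. *Statement.* 1. Operators are Taylor operators if and only if they are the operators $\Gamma_1,\dots,\Gamma_4,\Psi_1,\Psi_2,\Psi_3$ given by the formulas above. 2. For every $\tau_0>0$, operators are Chapman-Enskog operators if and only if they are given by these same formulas. 3. Hence Chapman-Enskog operators (for any $\tau_0>0$) and Taylor operators coincide: $\Gamma_1,\dots,\Gamma_4$ and $\Psi_1,\Psi_2,\Psi_3$ are the same in both methods, and the equivalent partial differential equations agree up to fourth order. 4. Let $T,\delta>0$ and let $f(x,t,\Delta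 t)\in\mathbb{R}^q$ be $C^\infty$ on $\mathbb{R}^d\times(0,T)\times[0,\delta)$, with conserved moments in $U$, and such that for each $\Delta t\in(0,\delta)$ its restriction to the vertices of $\mathcal{L}_{\Delta t}$ and the times $n\Delta t$ satisfies the scheme (whenever $0<n\Delta t$ and $(n+1)\Delta t<T$). Then, as $\Delta t\to0^+$ and uniformly on compact subsets of $\mathbb{R}^d\times(0,T)$, its moments $W,Y$ satisfy $$\partial_tW+\Gamma_1(W)+\Delta t\,\Gamma_2(W)+\Delta t^2\,\Gamma_3(W)+\Delta t^3\,\Gamma_4(W)=O(\Delta t^4),$$ $$Y=\Phi(W)+S^{-1}\big(\Delta t\,\Psi_1(W)+\Delta t^2\,\Psi_2(W)+\Delta t^3\,\Psi_3(W)\big)+O(\Delta t^4).$$ -/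

import Mathlib

open Set Filter Asymptotics
open scoped ContDiff Topology Matrix

namespace LatticeBoltzmann

noncomputable section

/-- The physical space `ℝ^d`. -/
abbrev Space (d : ℕ) : Type := EuclideanSpace ℝ (Fin d)

/-- The `q = p + r` indices of the moments (and an enumeration of the `q` velocities):
`p` conserved moments, then `r` nonconserved moments. -/
abbrev Idx (p r : ℕ) : Type := Fin p ⊕ Fin r

/-- Vector fields on `ℝ^d` with components indexed by `n`. -/
abbrev VField (d : ℕ) (n : Type) : Type := Space d → n → ℝ

/-- (Nonlinear) operators acting on the field `W` of conserved moments. -/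
abbrev Operator (d p : ℕ) (n : Type) : Type := VField d (Fin p) → VField d n

/-- The data of a lattice Boltzmann scheme with multiple relaxation times under acoustic scaling. -/
structure Scheme (d p r : ℕ) where
  /-- The discrete velocities (not necessarily distinct). -/
  v : Idx p r → Space d
  /-- The invertible matrix from particle distributions to moments. -/
  M : Matrix (Idx p r) (Idx p r) ℝ
  isUnit_M : IsUnit M
  /-- The invertible relaxation matrix. -/
  S : Matrix (Fin r) (Fin r) ℝ
  isUnit_S : IsUnit S
  /-- The open set of admissible conserved moments (possibly the whole of `ℝ^p`). -/
  U : Set (Fin p → ℝ)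
  isOpen_U : IsOpen U
  /-- The equilibrium function. -/
  Φ : (Fin p → ℝ) → (Fin r → ℝ)
  contDiffOn_Φ : ContDiffOn ℝ ∞ Φ U
  /-- The numerical velocity `λ = Δx / Δt`, which does not depend on `Δt`. -/
  lam : ℝ
  lam_pos : 0 < lam
  /-- Generators of the unit lattice. -/
  basis : Module.Basis (Fin d) ℝ (Space d)
  /-- A particle that starts at a vertex arrives at a vertex after one time step. -/
  v_mem : ∀ j, ∃ e ∈ Submodule.span ℤ (range basis), v j = lam • e

namespace Scheme

variable {d p r : ℕ} (𝓢 : Scheme d p r)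

/-! ### The scheme -/

/-- The lattice of mesh size `Δx = λ Δt`. -/
def lattice (Δt : ℝ) : Set (Space d) :=
  {x | ∃ e ∈ Submodule.span ℤ (range 𝓢.basis), x = (𝓢.lam * Δt) • e}

/-- The conserved moments `W` of a particle distribution. -/
def conserved (g : Idx p r → ℝ) : Fin p → ℝ := fun i => (𝓢.M *ᵥ g) (Sum.inl i)

/-- The nonconserved moments `Y` of a particle distribution. -/
def nonconserved (g : Idx p r → ℝ) : Fin r → ℝ := fun i => (𝓢.M *ᵥ g) (Sum.inr i)

/-- The relaxation step `f ↦ f*`: `W* = W`, `Y* = Y + S (Φ(W) - Y)`, `f* = M⁻¹ m*`. -/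
def relax (g : Idx p r → ℝ) : Idx p r → ℝ :=
  𝓢.M⁻¹ *ᵥ Sum.elim (𝓢.conserved g)
    (𝓢.nonconserved g + 𝓢.S *ᵥ (𝓢.Φ (𝓢.conserved g) - 𝓢.nonconserved g))

/-- `f x t Δt` is a family, regular up to `Δt = 0`, of functions of `x ∈ ℝ^d` and `t ∈ (0, T)`
whose restriction to the lattice of mesh size `λ Δt` and to the times `n Δt` is, for each time
step `0 < Δt < δ`, a solution of the scheme. -/
structure IsRegularSolution (T δ : ℝ) (f : Space d → ℝ → ℝ → Idx p r → ℝ) : Prop where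
  contDiffOn : ContDiffOn ℝ ∞ (fun z : Space d × ℝ × ℝ => f z.1 z.2.1 z.2.2)
    (univ ×ˢ Ioo 0 T ×ˢ Ico 0 δ)
  conserved_mem : ∀ x : Space d, ∀ t ∈ Ioo 0 T, ∀ Δt ∈ Ico 0 δ, 𝓢.conserved (f x t Δt) ∈ 𝓢.U
  step : ∀ Δt ∈ Ioo 0 δ, ∀ x ∈ 𝓢.lattice Δt, ∀ n : ℕ, 0 < n * Δt → (n + 1) * Δt < T → ∀ j,
    f x ((n + 1) * Δt) Δt j = 𝓢.relax (f (x - Δt • 𝓢.v j) (n * Δt) Δt) j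

/-! ### Operators -/

/-- The momentum-velocity operator `Λ = M diag(∑_α v_j^α ∂_α) M⁻¹`. -/
def advection (u : VField d (Idx p r)) : VField d (Idx p r) := fun x k =>
  ∑ l, ∑ j, 𝓢.M k j * 𝓢.M⁻¹ j l * fderiv ℝ (fun y => u y l) x (𝓢.v j)

/-- The block `A_n` (conserved to conserved) of `Λ ^ n`. -/
def blockA (n : ℕ) (u : VField d (Fin p)) : VField d (Fin p) := fun x i =>
  𝓢.advection^[n] (fun y => Sum.elim (u y) 0) x (Sum.inl i)

/-- The block `B_n` (nonconserved to conserved) of `Λ ^ n`. -/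
def blockB (n : ℕ) (u : VField d (Fin r)) : VField d (Fin p) := fun x i =>
  𝓢.advection^[n] (fun y => Sum.elim 0 (u y)) x (Sum.inl i)

/-- The block `C_n` (conserved to nonconserved) of `Λ ^ n`. -/
def blockC (n : ℕ) (u : VField d (Fin p)) : VField d (Fin r) := fun x i =>
  𝓢.advection^[n] (fun y => Sum.elim (u y) 0) x (Sum.inr i)

/-- The block `D_n` (nonconserved to nonconserved) of `Λ ^ n`. -/
def blockD (n : ℕ) (u : VField d (Fin r)) : VField d (Fin r) := fun x i =>
  𝓢.advection^[n] (fun y => Sum.elim 0 (u y)) x (Sum.inr i)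

/-- Pointwise action of the matrix `S`. -/
def actS (u : VField d (Fin r)) : VField d (Fin r) := fun x => 𝓢.S *ᵥ u x

/-- Pointwise action of the matrix `S⁻¹`. -/
def actSinv (u : VField d (Fin r)) : VField d (Fin r) := fun x => 𝓢.S⁻¹ *ᵥ u x

/-- Pointwise action of the Hénon matrix `Σ = S⁻¹ - I / 2`. -/
def henon (u : VField d (Fin r)) : VField d (Fin r) := fun x =>
  (𝓢.S⁻¹ - (1 / 2 : ℝ) • (1 : Matrix (Fin r) (Fin r) ℝ)) *ᵥ u x

/-- The operator `W ↦ Φ(W)`. -/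
def equil : Operator d p (Fin r) := fun W x => 𝓢.Φ (W x)

end Scheme

/-- The differential `dF . G` of an operator `F` in the direction of an operator `G`:
`(dF . G)(W)` is the derivative at `s = 0` of `F(W + s G(W))`. -/
def dirDeriv {d p : ℕ} {n : Type} (F : Operator d p n) (G : Operator d p (Fin p)) :
    Operator d p n :=
  fun W x k => deriv (fun s : ℝ => F (W + s • G W) x k) 0

namespace Scheme

variable {d p r : ℕ} (𝓢 : Scheme d p r)

/-! ### The explicit operators -/

/-- `Γ₁ = A W + B Φ(W)`. -/
def Gamma1 : Operator d p (Fin p) := fun W => 𝓢.blockA 1 W + 𝓢.blockB 1 (𝓢.equil W)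

/-- `Ψ₁ = dΦ . Γ₁ - (C W + D Φ(W))`. -/
def Psi1 : Operator d p (Fin r) := fun W =>
  dirDeriv 𝓢.equil 𝓢.Gamma1 W - (𝓢.blockC 1 W + 𝓢.blockD 1 (𝓢.equil W))

/-- `Γ₂ = B Σ Ψ₁`. -/
def Gamma2 : Operator d p (Fin p) := fun W => 𝓢.blockB 1 (𝓢.henon (𝓢.Psi1 W))

/-- `Ψ₂ = Σ dΨ₁ . Γ₁ + dΦ . Γ₂ - D Σ Ψ₁`. -/
def Psi2 : Operator d p (Fin r) := fun W =>
  𝓢.henon (dirDeriv 𝓢.Psi1 𝓢.Gamma1 W) + dirDeriv 𝓢.equil 𝓢.Gamma2 W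
    - 𝓢.blockD 1 (𝓢.henon (𝓢.Psi1 W))

/-- `Γ₃ = B Σ Ψ₂ - (1/6) B dΨ₁ . Γ₁ + (1/12) B₂ Ψ₁`. -/
def Gamma3 : Operator d p (Fin p) := fun W =>
  𝓢.blockB 1 (𝓢.henon (𝓢.Psi2 W))
    - (1 / 6 : ℝ) • 𝓢.blockB 1 (dirDeriv 𝓢.Psi1 𝓢.Gamma1 W)
    + (1 / 12 : ℝ) • 𝓢.blockB 2 (𝓢.Psi1 W)

/-- `Ψ₃ = Σ dΨ₁ . Γ₂ + dΦ . Γ₃ - D Σ Ψ₂ + Σ dΨ₂ . Γ₁ + (1/6) D dΨ₁ . Γ₁ - (1/12) D₂ Ψ₁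
- (1/12) d(dΨ₁ . Γ₁) . Γ₁`. -/
def Psi3 : Operator d p (Fin r) := fun W =>
  𝓢.henon (dirDeriv 𝓢.Psi1 𝓢.Gamma2 W) + dirDeriv 𝓢.equil 𝓢.Gamma3 W
    - 𝓢.blockD 1 (𝓢.henon (𝓢.Psi2 W))
    + 𝓢.henon (dirDeriv 𝓢.Psi2 𝓢.Gamma1 W)
    + (1 / 6 : ℝ) • 𝓢.blockD 1 (dirDeriv 𝓢.Psi1 𝓢.Gamma1 W)
    - (1 / 12 : ℝ) • 𝓢.blockD 2 (𝓢.Psi1 W)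
    - (1 / 12 : ℝ) • dirDeriv (dirDeriv 𝓢.Psi1 𝓢.Gamma1) 𝓢.Gamma1 W

/-- `Γ₄ = B Σ Ψ₃ + (1/4) B₂ Ψ₂ + (1/6) B D₂ Σ Ψ₁ - (1/6) A B Ψ₂ - (1/6) B d(dΦ . Γ₁) . Γ₂
- (1/6) B d(dΦ . Γ₂) . Γ₁ - (1/6) B Σ d(dΨ₁ . Γ₁) . Γ₁`. -/
def Gamma4 : Operator d p (Fin p) := fun W =>
  𝓢.blockB 1 (𝓢.henon (𝓢.Psi3 W))
    + (1 / 4 : ℝ) • 𝓢.blockB 2 (𝓢.Psi2 W)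
    + (1 / 6 : ℝ) • 𝓢.blockB 1 (𝓢.blockD 2 (𝓢.henon (𝓢.Psi1 W)))
    - (1 / 6 : ℝ) • 𝓢.blockA 1 (𝓢.blockB 1 (𝓢.Psi2 W))
    - (1 / 6 : ℝ) • 𝓢.blockB 1 (dirDeriv (dirDeriv 𝓢.equil 𝓢.Gamma1) 𝓢.Gamma2 W)
    - (1 / 6 : ℝ) • 𝓢.blockB 1 (dirDeriv (dirDeriv 𝓢.equil 𝓢.Gamma2) 𝓢.Gamma1 W)
    - (1 / 6 : ℝ) • 𝓢.blockB 1 (𝓢.henon (dirDeriv (dirDeriv 𝓢.Psi1 𝓢.Gamma1) 𝓢.Gamma1 W))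

/-- `W` is smooth near `x` and its value at `x` is admissible. -/
def AdmissibleAt (W : VField d (Fin p)) (x : Space d) : Prop :=
  W x ∈ 𝓢.U ∧ ∀ᶠ y in 𝓝 x, ContDiffAt ℝ ∞ W y

/-- `Γ 1, …, Γ 4` and `Ψ 1, …, Ψ 3` are given by the explicit formulas (the other terms of the
sequences are irrelevant). -/
def IsExplicit (Γ : ℕ → Operator d p (Fin p)) (Ψ : ℕ → Operator d p (Fin r)) : Prop :=
  ∀ (W : VField d (Fin p)) (x : Space d), 𝓢.AdmissibleAt W x →
    Γ 1 W x = 𝓢.Gamma1 W x ∧ Ψ 1 W x = 𝓢.Psi1 W x ∧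
    Γ 2 W x = 𝓢.Gamma2 W x ∧ Ψ 2 W x = 𝓢.Psi2 W x ∧
    Γ 3 W x = 𝓢.Gamma3 W x ∧ Ψ 3 W x = 𝓢.Psi3 W x ∧
    Γ 4 W x = 𝓢.Gamma4 W x

end Scheme

/-! ### Formal expansions

A sequence `F : ℕ → Operator d p n` stands for the formal power series `∑ εⁿ F n` of functions of
`W` and of its space derivatives. -/

/-- The action of `∂_t = ∂_{t₁} + ε ∂_{t₂} + ε² ∂_{t₃} + ⋯` on a formal power series, when
`∂_{t_{j+1}} W = V j`; by the chain rule `∂_{t_{j+1}}` maps `F` to `dF . V j`.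
These derivations need not commute. -/
def timeDeriv {d p : ℕ} {n : Type} (V : ℕ → Operator d p (Fin p)) (F : ℕ → Operator d p n) :
    ℕ → Operator d p n :=
  fun k => ∑ i ∈ Finset.range (k + 1), dirDeriv (F i) (V (k - i))

namespace Scheme

variable {d p r : ℕ} (𝓢 : Scheme d p r)

/-- The coefficients of `W`. -/
def serW (d p : ℕ) : ℕ → Operator d p (Fin p)
  | 0 => fun W => W
  | _ + 1 => 0

/-- The coefficients of `Φ(W)`. -/
def serEquil : ℕ → Operator d p (Fin r)
  | 0 => 𝓢.equil
  | _ + 1 => 0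

/-- The coefficients of `Y = Φ(W) + S⁻¹ (ε P₁ + ε² P₂ + ⋯)`. -/
def serY (P : ℕ → Operator d p (Fin r)) : ℕ → Operator d p (Fin r)
  | 0 => 𝓢.equil
  | k + 1 => fun W => 𝓢.actSinv (P (k + 1) W)

/-- The coefficients of `Y* = Y + S (Φ(W) - Y)`. -/
def serYstar (P : ℕ → Operator d p (Fin r)) (k : ℕ) : Operator d p (Fin r) := fun W =>
  𝓢.serY P k W + 𝓢.actS (𝓢.serEquil k W - 𝓢.serY P k W)

/-- The coefficients of `m = (W, Y)`. -/
def serM (P : ℕ → Operator d p (Fin r)) (k : ℕ) : Operator d p (Idx p r) := fun W x =>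
  Sum.elim (serW d p k W x) (𝓢.serY P k W x)

/-- The coefficients of `m* = (W, Y*)`. -/
def serMstar (P : ℕ → Operator d p (Fin r)) (k : ℕ) : Operator d p (Idx p r) := fun W x =>
  Sum.elim (serW d p k W x) (𝓢.serYstar P k W x)

/-- The coefficient of `εⁿ` in `exp(ε τ ∂_t) m - exp(-ε τ Λ) m*`, that is, in
`m(t + ε τ) - exp(-ε τ Λ) m*(t)`, when `∂_t W = V₀ + ε V₁ + ⋯` and
`Y = Φ(W) + S⁻¹ (ε P₁ + ε² P₂ + ⋯)`. -/
def residual (τ : ℝ) (V : ℕ → Operator d p (Fin p)) (P : ℕ → Operator d p (Fin r)) (n : ℕ) :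
    Operator d p (Idx p r) := fun W =>
  (∑ k ∈ Finset.range (n + 1),
    (τ ^ k / (k.factorial : ℝ)) • (timeDeriv V)^[k] (𝓢.serM P) (n - k) W)
  - ∑ k ∈ Finset.range (n + 1),
    ((-τ) ^ k / (k.factorial : ℝ)) • 𝓢.advection^[k] (𝓢.serMstar P (n - k) W)

/-- The expansions of `∂_t W` and of `Y` are consistent with the scheme
`m(t + ε τ) = exp(-ε τ Λ) m*(t)`: the terms up to order four in `ε` agree in the conserved
components, and the terms up to order three in the nonconserved ones. -/
def IsConsistent (τ : ℝ) (V : ℕ → Operator d p (Fin p)) (P : ℕ → Operator d p (Fin r)) : Prop :=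
  ∀ (W : VField d (Fin p)) (x : Space d), 𝓢.AdmissibleAt W x →
    (∀ n ≤ 4, ∀ i, 𝓢.residual τ V P n W x (Sum.inl i) = 0) ∧
    (∀ n ≤ 3, ∀ i, 𝓢.residual τ V P n W x (Sum.inr i) = 0)

/-- `Γ 1, …, Γ 4` and `Ψ 1, …, Ψ 3` are operators of the Chapman-Enskog expansion with the
reference time `τ₀` and the small parameter `ε = Δt / τ₀`:
`∂_{t_j} W + τ₀ ^ (j - 1) Γ_j(W) = 0` and `Y = Φ(W) + S⁻¹ ∑ ε ^ j τ₀ ^ j Ψ_j(W)`. -/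
def IsChapmanEnskog (τ₀ : ℝ) (Γ : ℕ → Operator d p (Fin p)) (Ψ : ℕ → Operator d p (Fin r)) :
    Prop :=
  𝓢.IsConsistent τ₀ (fun j W => -(τ₀ ^ j • Γ (j + 1) W)) (fun j W => τ₀ ^ j • Ψ j W)

/-- `Γ 1, …, Γ 4` and `Ψ 1, …, Ψ 3` are operators of the Taylor expansion, in which `Δt` itself is
the small parameter: `∂_t W + Γ₁ + Δt Γ₂ + Δt² Γ₃ + Δt³ Γ₄ = O(Δt⁴)` and
`Y = Φ(W) + S⁻¹ (Δt Ψ₁ + Δt² Ψ₂ + Δt³ Ψ₃) + O(Δt⁴)`. -/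
def IsTaylor (Γ : ℕ → Operator d p (Fin p)) (Ψ : ℕ → Operator d p (Fin r)) : Prop :=
  𝓢.IsConsistent 1 (fun j W => -Γ (j + 1) W) Ψ

end Scheme

end

end LatticeBoltzmann

set_option linter.unusedVariables false

/-! The formal statements are algebra. The blocks A, B, C, D of Λ and the matrix Σ are linear with
constant coefficients, hence commute with every derivation F ↦ dF.G. Operators that are local and
smooth in parameters (`Reg`), taken modulo their values on inadmissible fields, form a vector space
`RegOp`. There each coefficient of exp(Δt ∂_t) m - exp(-Δt Λ) m* is a combination of words in linear
maps and derivations. Since S⁻¹ = Σ + I/2, the corrections to Y and Y* are ΣΨ + Ψ/2 and ΣΨ - Ψ/2;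
substituting the explicit formulas makes all required coefficients cancel
(`seriesResidual_eq_zero`), with no commutation between the derivations.

Uniqueness is triangularity. At order m + 1 the conserved component of the residual is V m plus
terms in earlier unknowns, and the nonconserved one is P (m + 1) plus terms in V 0, …, V m and
earlier P (`isConsistent_iff`). The Chapman-Enskog residual is the Taylor residual with the n-th
coefficient multiplied by τ₀ⁿ (`residual_pow_smul`), so both methods pose the same problem.

The asymptotic statement needs care because the scheme holds only at grid points, while its
expansion involves derivatives. Put Δt = η²: regularity up to Δt = 0 becomes smoothness on a full
neighbourhood of η = 0. "Order m" means divisible by (η²)^m with smooth quotient (`IsO`), a notion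
stable under differentiation in t and x. The grid accumulates at every point with η = 0, so by
repeated use of Hadamard's lemma a smooth function that vanishes on it is divisible by every power
of η (`Scheme.isO_of_grid`). Thus the scheme holds to every order, and Taylor's formula turns it
into a small `defect` of the exponential equation.

Comparison with the formal residual gives a bootstrap (`Scheme.approx_four`). If ∂_t W and Y match
their series to order m, so do all their derivatives, by the chain rule. The nonconserved equation
then improves Y by one order, because S is invertible, and the conserved equation, divided by Δt,
improves ∂_t W. Four rounds suffice, and compactness makes the bounds uniform. -/

namespace LatticeBoltzmann

/-! ### Germs of smooth functions -/

section Smooth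

variable {E F G : Type*} [NormedAddCommGroup E] [NormedSpace ℝ E] [NormedAddCommGroup F]
  [NormedSpace ℝ F] [NormedAddCommGroup G] [NormedSpace ℝ G]

/-- `f` is smooth near `z`. -/
def SmoothAt (f : E → F) (z : E) : Prop := ∀ᶠ z' in 𝓝 z, ContDiffAt ℝ ∞ f z'

namespace SmoothAt

theorem contDiffAt {f : E → F} {z : E} (h : SmoothAt f z) : ContDiffAt ℝ ∞ f z := h.self_of_nhds

theorem differentiableAt {f : E → F} {z : E} (h : SmoothAt f z) : DifferentiableAt ℝ f z :=
  h.contDiffAt.differentiableAt (by simp)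

theorem continuousAt {f : E → F} {z : E} (h : SmoothAt f z) : ContinuousAt f z :=
  h.contDiffAt.continuousAt

theorem eventually {f : E → F} {z : E} (h : SmoothAt f z) : ∀ᶠ z' in 𝓝 z, SmoothAt f z' :=
  eventually_eventually_nhds.2 h

theorem congr {f g : E → F} {z : E} (h : SmoothAt f z) (hg : g =ᶠ[𝓝 z] f) : SmoothAt g z := by
  filter_upwards [h, hg.eventuallyEq_nhds] with z' h1 h2 using h1.congr_of_eventuallyEq h2

theorem of_contDiff {f : E → F} (h : ContDiff ℝ ∞ f) (z : E) : SmoothAt f z :=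
  Eventually.of_forall fun _ => h.contDiffAt

theorem comp {g : F → G} {f : E → F} (z : E) (hg : SmoothAt g (f z)) (hf : SmoothAt f z) :
    SmoothAt (fun z => g (f z)) z := by
  filter_upwards [hf, hf.continuousAt.eventually hg] with z' h1 h2 using h2.comp z' h1

theorem comp_of_eq {g : F → G} {f : E → F} (z : E) {y : F} (hg : SmoothAt g y)
    (hf : SmoothAt f z) (h : f z = y) : SmoothAt (fun z => g (f z)) z := by
  subst h; exact hg.comp z hf

theorem add {f g : E → F} {z : E} (hf : SmoothAt f z) (hg : SmoothAt g z) :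
    SmoothAt (fun z => f z + g z) z := by
  filter_upwards [hf, hg] with z' h1 h2 using h1.add h2

theorem sub {f g : E → F} {z : E} (hf : SmoothAt f z) (hg : SmoothAt g z) :
    SmoothAt (fun z => f z - g z) z := by
  filter_upwards [hf, hg] with z' h1 h2 using h1.sub h2

theorem mul {f g : E → ℝ} {z : E} (hf : SmoothAt f z) (hg : SmoothAt g z) :
    SmoothAt (fun z => f z * g z) z := by
  filter_upwards [hf, hg] with z' h1 h2 using h1.mul h2

theorem const_mul {f : E → ℝ} {z : E} (c : ℝ) (hf : SmoothAt f z) :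
    SmoothAt (fun z => c * f z) z :=
  (of_contDiff contDiff_const z).mul hf

theorem sum {ι : Type*} {s : Finset ι} {f : ι → E → F} {z : E} (hf : ∀ i ∈ s, SmoothAt (f i) z) :
    SmoothAt (fun z => ∑ i ∈ s, f i z) z := by
  have : ∀ᶠ z' in 𝓝 z, ∀ i ∈ s, ContDiffAt ℝ ∞ (f i) z' := (Finset.eventually_all s).2 hf
  filter_upwards [this] with z' h1 using ContDiffAt.sum h1

theorem pi {ι : Type*} [Fintype ι] {f : E → ι → ℝ} {z : E}
    (hf : ∀ i, SmoothAt (fun z => f z i) z) : SmoothAt f z := by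
  filter_upwards [eventually_all.2 hf] with z' h1 using contDiffAt_pi.2 h1

theorem apply {ι : Type*} [Fintype ι] {f : E → ι → ℝ} {z : E} (hf : SmoothAt f z) (i : ι) :
    SmoothAt (fun z => f z i) z := by
  filter_upwards [hf] with z' h1 using contDiffAt_pi.1 h1 i

theorem fderiv_apply {f : E → F} {z : E} (hf : SmoothAt f z) (v : E) :
    SmoothAt (fun z => fderiv ℝ f z v) z := by
  filter_upwards [hf] with z' h1
  exact (h1.fderiv_right (m := ∞) (by simp)).clm_apply contDiffAt_const

/-- Near `(e, x)`, partial derivatives in the second variable are total derivatives. -/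
theorem fderiv_snd {f : E × F → G} {z : E × F} (hf : SmoothAt f z) (v : F) :
    (fun z : E × F => fderiv ℝ (fun y => f (z.1, y)) z.2 v) =ᶠ[𝓝 z]
      fun z => fderiv ℝ f z (0, v) := by
  filter_upwards [hf] with z' h1
  have h2 : HasFDerivAt f (fderiv ℝ f z') (z'.1, z'.2) :=
    (h1.differentiableAt (by simp)).hasFDerivAt
  have h3 := h2.comp z'.2 (hasFDerivAt_prodMk_right z'.1 z'.2)
  have h4 := h3.fderiv
  simp only [Function.comp_def] at h4
  rw [h4]; simp

/-- A derivative along a line is a directional derivative. -/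
theorem hasDerivAt_comp {f : E → F} {c : ℝ → E} {c' : E} {t : ℝ} (hf : SmoothAt f (c t))
    (hc : HasDerivAt c c' t) : HasDerivAt (fun s => f (c s)) (fderiv ℝ f (c t) c') t :=
  hf.differentiableAt.hasFDerivAt.comp_hasDerivAt t hc

theorem fderiv_comm {f : E → F} {z : E} (hf : SmoothAt f z) (u v : E) :
    fderiv ℝ (fun z => fderiv ℝ f z u) z v = fderiv ℝ (fun z => fderiv ℝ f z v) z u := by
  have hd : DifferentiableAt ℝ (fderiv ℝ f) z :=
    (hf.contDiffAt.fderiv_right (m := 1) (by norm_cast)).differentiableAt (by simp)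
  have key : ∀ u v : E, fderiv ℝ (fun z => fderiv ℝ f z u) z v = fderiv ℝ (fderiv ℝ f) z v u := by
    intro u v
    have := hd.hasFDerivAt.clm_apply (hasFDerivAt_const u z)
    rw [this.fderiv]; simp
  rw [key, key]
  exact (hf.contDiffAt.isSymmSndFDerivAt (by
    rw [minSmoothness_of_isRCLikeNormedField]; exact WithTop.coe_le_coe.2 le_top)) v u

/-- A germ of a smooth function is the germ of a globally smooth function. -/
theorem exists_contDiff [FiniteDimensional ℝ E] {f : E → ℝ} {z : E} (hf : SmoothAt f z) :
    ∃ g : E → ℝ, ContDiff ℝ ∞ g ∧ g =ᶠ[𝓝 z] f := by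
  obtain ⟨r, hr, hball⟩ := Metric.eventually_nhds_iff_ball.1 hf
  let χ : ContDiffBump z := ⟨r / 4, r / 2, by positivity, by linarith⟩
  refine ⟨fun x => χ x * f x, ?_, ?_⟩
  · rw [contDiff_iff_contDiffAt]
    intro x
    by_cases hx : x ∈ Metric.ball z r
    · exact χ.contDiff.contDiffAt.mul (hball x hx)
    · have : (fun x => χ x * f x) =ᶠ[𝓝 x] fun _ => 0 := by
        have hx' : x ∈ (Metric.closedBall z (r / 2))ᶜ := by
          simp only [Metric.mem_ball, not_lt, mem_compl_iff, Metric.mem_closedBall, not_le] at hx ⊢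
          linarith
        filter_upwards [Metric.isClosed_closedBall.isOpen_compl.mem_nhds hx'] with y hy
        simp only [mem_compl_iff, Metric.mem_closedBall, not_le] at hy
        rw [χ.zero_of_le_dist hy.le, zero_mul]
      exact contDiffAt_const.congr_of_eventuallyEq this
  · filter_upwards [χ.eventuallyEq_one] with x hx
    simp only [hx, Pi.one_apply, one_mul]

end SmoothAt

/-! ### Hadamard's lemma and Taylor's formula with smooth remainder -/

open MeasureTheory in
-- The integral is the value at 0 of a convolution, in s, of the truncated power s ^ m on (0, 1]
-- with a smooth kernel depending on the parameter z. The bump function makes the kernel compactly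
-- supported and equals 1 where the power lives, so smoothness of convolutions with parameters
-- applies.
theorem contDiff_integral_pow_mul {K : E × ℝ → ℝ} [FiniteDimensional ℝ E]
    (hK : ContDiff ℝ ∞ K) (m : ℕ) :
    ContDiff ℝ ∞ fun z : E × ℝ => ∫ s in (0 : ℝ)..1, s ^ m * K (z.1, s * z.2) := by
  let χ : ContDiffBump (0 : ℝ) := ⟨1, 2, by norm_num, by norm_num⟩
  let g : E × ℝ → ℝ → ℝ := fun z y => χ y * K (z.1, -y * z.2)
  let f : ℝ → ℝ := (Ioc (0 : ℝ) 1).indicator fun s => s ^ m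
  have hf : LocallyIntegrable f volume := by
    apply Integrable.locallyIntegrable
    rw [integrable_indicator_iff measurableSet_Ioc]
    exact ((continuous_pow m).integrableOn_Icc).mono_set Ioc_subset_Icc_self
  have hg : ContDiff ℝ ∞ (Function.uncurry g) := by
    have h1 : ContDiff ℝ ∞ fun q : (E × ℝ) × ℝ => χ q.2 := χ.contDiff.comp contDiff_snd
    have h2 : ContDiff ℝ ∞ fun q : (E × ℝ) × ℝ => K (q.1.1, -q.2 * q.1.2) := by fun_prop
    exact h1.mul h2
  have := contDiffOn_convolution_right_with_param_comp (μ := volume) (n := ⊤) (𝕜 := ℝ)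
    (ContinuousLinearMap.mul ℝ ℝ) (s := univ) (v := fun _ : E × ℝ => (0 : ℝ)) contDiffOn_const
    (f := f) (g := g) (k := Metric.closedBall 0 2) isOpen_univ (isCompact_closedBall 0 2)
    (by
      intro p y _ hy
      simp only [Metric.mem_closedBall, not_le] at hy
      simp only [g, χ.zero_of_le_dist hy.le, zero_mul]) hf (hg.contDiffOn)
  rw [contDiffOn_univ] at this
  convert this using 2 with z
  rw [MeasureTheory.convolution, intervalIntegral.integral_of_le zero_le_one,
    ← integral_indicator measurableSet_Ioc]
  refine integral_congr_ae (Eventually.of_forall fun s => ?_)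
  by_cases hs : s ∈ Ioc (0 : ℝ) 1
  · have : χ (-s) = 1 := χ.one_of_mem_closedBall (by
      simp only [Metric.mem_closedBall, dist_zero_right, norm_neg, Real.norm_eq_abs, χ]
      rw [abs_le]; exact ⟨by linarith [hs.1], hs.2⟩)
    simp [f, g, hs, this]
  · simp [f, hs]

/-- Division by a power of a coordinate (Hadamard's lemma). -/
theorem exists_smoothAt_eq_pow_mul [FiniteDimensional ℝ E] {ρ K : E × ℝ → ℝ} {z₀ : E} (m : ℕ)
    (hρ : ∀ᶠ z in 𝓝 (z₀, (0 : ℝ)), HasDerivAt (fun τ => ρ (z.1, τ)) (z.2 ^ m * K z) z.2)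
    (h0 : ∀ᶠ z in 𝓝 z₀, ρ (z, 0) = 0) (hK : SmoothAt K (z₀, (0 : ℝ))) :
    ∃ H : E × ℝ → ℝ, SmoothAt H (z₀, 0) ∧
      ρ =ᶠ[𝓝 (z₀, (0 : ℝ))] fun z => z.2 ^ (m + 1) * H z := by
  -- The integral over s ∈ [0, 1] needs K smooth along the whole segment, so the germ is first made
  -- global. The witness comes from ρ(z, τ) = ∫₀^τ σ^m K(z, σ) dσ and the substitution σ = sτ.
  obtain ⟨K', hK', hKK⟩ := hK.exists_contDiff
  refine ⟨fun z => ∫ s in (0 : ℝ)..1, s ^ m * K' (z.1, s * z.2),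
    SmoothAt.of_contDiff (contDiff_integral_pow_mul hK' m) _, ?_⟩
  have hall := (hρ.and hKK)
  rw [Metric.eventually_nhds_iff_ball] at hall
  rw [Metric.nhds_basis_ball.eventually_iff] at h0
  obtain ⟨r, hr, hall⟩ := hall
  rw [← ball_prod_same] at hall
  obtain ⟨r', hr', h0⟩ := h0
  have : Metric.ball z₀ (min r r') ×ˢ Metric.ball (0 : ℝ) r ∈ 𝓝 (z₀, (0 : ℝ)) :=
    prod_mem_nhds (Metric.ball_mem_nhds _ (lt_min hr hr')) (Metric.ball_mem_nhds _ hr)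
  filter_upwards [this] with z hz
  obtain ⟨z, τ⟩ := z
  have hz1 : z ∈ Metric.ball z₀ r := Metric.ball_subset_ball (min_le_left _ _) hz.1
  have hz2 : z ∈ Metric.ball z₀ r' := Metric.ball_subset_ball (min_le_right _ _) hz.1
  have hmem : ∀ s ∈ uIcc (0 : ℝ) 1, (z, s * τ) ∈ Metric.ball z₀ r ×ˢ Metric.ball (0 : ℝ) r := by
    intro s hs
    rw [uIcc_of_le zero_le_one] at hs
    refine ⟨hz1, ?_⟩
    have h2 := hz.2
    simp only [Metric.mem_ball, dist_zero_right, norm_mul, Real.norm_eq_abs] at h2 ⊢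
    calc |s| * |τ| ≤ 1 * |τ| := by
          gcongr; rw [abs_le]; exact ⟨by linarith [hs.1], hs.2⟩
      _ < r := by linarith
  have hder : ∀ s ∈ uIcc (0 : ℝ) 1, HasDerivAt (fun s => ρ (z, s * τ))
      (τ ^ (m + 1) * (s ^ m * K' (z, s * τ))) s := by
    intro s hs
    obtain ⟨h1, h2⟩ := hall _ (hmem s hs)
    have h3 := h1.comp s ((hasDerivAt_id s).mul_const τ)
    refine h3.congr_deriv ?_
    rw [h2]; ring
  have hint := intervalIntegral.integral_eq_sub_of_hasDerivAt hder
    (ContinuousOn.intervalIntegrable (Continuous.continuousOn (by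
      have := hK'.continuous
      fun_prop)))
  rw [intervalIntegral.integral_const_mul] at hint
  have h00 : ρ (z, 0) = 0 := h0 hz2
  simp only [one_mul, zero_mul, h00, sub_zero] at hint
  exact hint.symm

theorem SmoothAt.exists_eq_mul [FiniteDimensional ℝ E] {ρ : E × ℝ → ℝ} {z₀ : E}
    (hρ : SmoothAt ρ (z₀, (0 : ℝ))) (h0 : ∀ᶠ z in 𝓝 z₀, ρ (z, 0) = 0) :
    ∃ H : E × ℝ → ℝ, SmoothAt H (z₀, 0) ∧ ρ =ᶠ[𝓝 (z₀, (0 : ℝ))] fun z => z.2 * H z := by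
  have := exists_smoothAt_eq_pow_mul (ρ := ρ) (K := fun z => fderiv ℝ ρ z (0, 1)) 0 ?_ h0
    (hρ.fderiv_apply _)
  · simpa using this
  · filter_upwards [hρ.eventually] with z hz
    have h1 : HasDerivAt (fun τ : ℝ => (z.1, τ)) (0, 1) z.2 :=
      (hasDerivAt_const _ _).prodMk (hasDerivAt_id _)
    have := SmoothAt.hasDerivAt_comp (c := fun τ : ℝ => (z.1, τ)) hz h1
    simpa using this

/-- Taylor's formula in the direction `u`, with smooth remainder. -/
theorem SmoothAt.taylor [FiniteDimensional ℝ E] (z₀ u : E) (N : ℕ) : ∀ {g : E → ℝ},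
    SmoothAt g z₀ → ∃ H : E × ℝ → ℝ, SmoothAt H (z₀, 0) ∧
      ∀ᶠ z in 𝓝 (z₀, (0 : ℝ)), g (z.1 + z.2 • u) =
        ∑ k ∈ Finset.range N,
          z.2 ^ k / (k.factorial : ℝ) * ((fun g' : E → ℝ => fun z => fderiv ℝ g' z u)^[k] g) z.1
        + z.2 ^ N * H z := by
  have hshift : SmoothAt (fun z : E × ℝ => z.1 + z.2 • u) (z₀, 0) :=
    .of_contDiff (by fun_prop) _
  have hfst : SmoothAt (fun z : E × ℝ => z.1) (z₀, 0) := .of_contDiff (by fun_prop) _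
  induction N with
  | zero =>
    intro g hg
    exact ⟨fun z => g (z.1 + z.2 • u), SmoothAt.comp_of_eq _ hg hshift (by simp), by simp⟩
  | succ N ih =>
    intro g hg
    obtain ⟨K, hK, hKe⟩ := ih (hg.fderiv_apply u)
    -- The τ-derivative of the Taylor remainder of g at order N + 1 is the remainder of ∂_u g at
    -- order N, which has the form τ ^ N K by induction; integrating gains one power of τ.
    have := exists_smoothAt_eq_pow_mul (ρ := fun z : E × ℝ => g (z.1 + z.2 • u) -
        ∑ k ∈ Finset.range (N + 1),
          z.2 ^ k / (k.factorial : ℝ) * ((fun g' : E → ℝ => fun z => fderiv ℝ g' z u)^[k] g) z.1)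
        (K := K) (z₀ := z₀) N ?_ ?_ hK
    · obtain ⟨H, hH, hHe⟩ := this
      refine ⟨H, hH, ?_⟩
      filter_upwards [hHe] with z hz
      rw [← hz]; ring
    · have hs : ∀ᶠ z in 𝓝 (z₀, (0 : ℝ)), SmoothAt g (z.1 + z.2 • u) := by
        have := hshift.continuousAt.eventually (p := fun y => SmoothAt g y)
          (by simpa using hg.eventually)
        exact this
      filter_upwards [hKe, hs] with z hz hsz
      have h1 : HasDerivAt (fun τ : ℝ => z.1 + τ • u) u z.2 := by
        simpa using ((hasDerivAt_id z.2).smul_const u).const_add z.1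
      have h2 := SmoothAt.hasDerivAt_comp (c := fun τ : ℝ => z.1 + τ • u) hsz h1
      have h3 : HasDerivAt (fun τ : ℝ => ∑ k ∈ Finset.range (N + 1),
          τ ^ k / (k.factorial : ℝ) *
            ((fun g' : E → ℝ => fun z => fderiv ℝ g' z u)^[k] g) z.1)
          (∑ k ∈ Finset.range N, z.2 ^ k / (k.factorial : ℝ) *
            ((fun g' : E → ℝ => fun z => fderiv ℝ g' z u)^[k + 1] g) z.1) z.2 := by
        simp only [Finset.sum_range_succ' _ N]
        have hk : ∀ k ∈ Finset.range N, HasDerivAt (fun τ : ℝ =>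
            τ ^ (k + 1) / ((k + 1).factorial : ℝ) *
              ((fun g' : E → ℝ => fun z => fderiv ℝ g' z u)^[k + 1] g) z.1)
            (z.2 ^ k / (k.factorial : ℝ) *
              ((fun g' : E → ℝ => fun z => fderiv ℝ g' z u)^[k + 1] g) z.1) z.2 := by
          intro k _
          have := ((hasDerivAt_pow (k + 1) z.2).div_const ((k + 1).factorial : ℝ)).mul_const
            (((fun g' : E → ℝ => fun z => fderiv ℝ g' z u)^[k + 1] g) z.1)
          refine this.congr_deriv ?_
          rw [Nat.factorial_succ]; push_cast
          have : (k.factorial : ℝ) ≠ 0 := by positivity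
          field_simp
        have := (HasDerivAt.fun_sum hk).add_const
          ((0 : ℝ) + g z.1)
        simpa using this
      have h4 := h2.sub h3
      refine h4.congr_deriv ?_
      simp only [Function.iterate_succ, Function.comp_apply]
      rw [hz]; ring
    · refine Eventually.of_forall fun z => ?_
      simp [Finset.sum_range_succ']

end Smooth

end LatticeBoltzmann

namespace LatticeBoltzmann

/-! ### Smooth families of fields and regular operators -/

section Families

variable {d p r : ℕ} {n n' : Type} {E E' : Type*} [NormedAddCommGroup E] [NormedSpace ℝ E]
  [NormedAddCommGroup E'] [NormedSpace ℝ E']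

/-- The field `u` is smooth near `x`. -/
def SmoothField (u : VField d n) (x : Space d) : Prop := ∀ k, SmoothAt (fun y => u y k) x

/-- The family of fields `u` is jointly smooth near `(e, x)`. -/
def SmoothFam (u : E → VField d n) (e : E) (x : Space d) : Prop :=
  ∀ k, SmoothAt (fun z : E × Space d => u z.1 z.2 k) (e, x)

theorem SmoothAt.slice {G : Type*} [NormedAddCommGroup G] [NormedSpace ℝ G]
    {f : E × E' → G} {e : E} {x : E'} (h : SmoothAt f (e, x)) : SmoothAt (fun y => f (e, y)) x :=
  SmoothAt.comp (g := f) (f := fun y => (e, y)) x h (.of_contDiff (by fun_prop) _)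

theorem SmoothFam.field {u : E → VField d n} {e : E} {x : Space d} (h : SmoothFam u e x) :
    SmoothField (u e) x := fun k => (h k).slice

theorem SmoothField.fam {u : VField d n} {x : Space d} (h : SmoothField u x) (e : E) :
    SmoothFam (fun _ : E => u) e x := fun k =>
  SmoothAt.comp (f := fun z : E × Space d => z.2) (g := fun y => u y k) (e, x) (h k)
    (.of_contDiff contDiff_snd _)

theorem SmoothFam.reparam {u : E → VField d n} {φ : E' → E} {e : E'} {x : Space d}
    (h : SmoothFam u (φ e) x) (hφ : ContDiff ℝ ∞ φ) : SmoothFam (fun e => u (φ e)) e x := fun k =>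
  SmoothAt.comp (f := fun z : E' × Space d => (φ z.1, z.2))
    (g := fun z : E × Space d => u z.1 z.2 k) (e, x) (h k)
    (.of_contDiff (by fun_prop) _)

/-- Adjoining s to the parameters turns the derivative that defines dF.G into a partial derivative
of a jointly smooth function. -/
theorem SmoothFam.add_smul {u g : E → VField d n} {e : E} {x : Space d} (hu : SmoothFam u e x)
    (hg : SmoothFam g e x) (s : ℝ) :
    SmoothFam (fun q : E × ℝ => u q.1 + q.2 • g q.1) (e, s) x := fun k =>
  have h1 : SmoothFam (fun q : E × ℝ => u q.1) (e, s) x :=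
    SmoothFam.reparam (φ := fun q : E × ℝ => q.1) hu contDiff_fst
  have h2 : SmoothFam (fun q : E × ℝ => g q.1) (e, s) x :=
    SmoothFam.reparam (φ := fun q : E × ℝ => q.1) hg contDiff_fst
  (h1 k).add ((SmoothAt.of_contDiff (by fun_prop) ((e, s), x)).mul (h2 k))

namespace Scheme

variable (𝓢 : Scheme d p r)

/-- The family `w` is smooth near `(e, x)`, with an admissible value there. -/
def AdmFam (w : E → VField d (Fin p)) (e : E) (x : Space d) : Prop :=
  w e x ∈ 𝓢.U ∧ SmoothFam w e x

variable {𝓢}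

theorem AdmFam.eventually {w : E → VField d (Fin p)} {e : E} {x : Space d}
    (h : 𝓢.AdmFam w e x) : ∀ᶠ z in 𝓝 (e, x), 𝓢.AdmFam w z.1 z.2 := by
  have h1 := (SmoothAt.pi h.2).continuousAt.eventually (𝓢.isOpen_U.mem_nhds h.1)
  filter_upwards [h1, eventually_all.2 fun k => (h.2 k).eventually] with z h2 h3 using ⟨h2, h3⟩

theorem AdmFam.admissibleAt {w : E → VField d (Fin p)} {e : E} {x : Space d}
    (h : 𝓢.AdmFam w e x) : 𝓢.AdmissibleAt (w e) x :=
  ⟨h.1, SmoothAt.pi fun k => (h.2 k).slice⟩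

theorem AdmFam.reparam {w : E → VField d (Fin p)} {φ : E' → E} {e : E'} {x : Space d}
    (h : 𝓢.AdmFam w (φ e) x) (hφ : ContDiff ℝ ∞ φ) : 𝓢.AdmFam (fun e => w (φ e)) e x :=
  ⟨h.1, h.2.reparam hφ⟩

theorem AdmFam.add_smul {w g : E → VField d (Fin p)} {e : E} {x : Space d}
    (h : 𝓢.AdmFam w e x) (hg : SmoothFam g e x) :
    𝓢.AdmFam (fun q : E × ℝ => w q.1 + q.2 • g q.1) (e, 0) x :=
  ⟨by simpa using h.1, h.2.add_smul hg 0⟩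

theorem AdmissibleAt.smoothField {W : VField d (Fin p)} {x : Space d} (h : 𝓢.AdmissibleAt W x) :
    SmoothField W x := fun k => SmoothAt.apply h.2 k

theorem AdmissibleAt.fam {W : VField d (Fin p)} {x : Space d} (h : 𝓢.AdmissibleAt W x) (e : E) :
    𝓢.AdmFam (fun _ : E => W) e x := ⟨h.1, h.smoothField.fam e⟩

theorem AdmissibleAt.eventually {W : VField d (Fin p)} {x : Space d} (h : 𝓢.AdmissibleAt W x) :
    ∀ᶠ y in 𝓝 x, 𝓢.AdmissibleAt W y := by
  filter_upwards [(SmoothAt.continuousAt h.2).eventually (𝓢.isOpen_U.mem_nhds h.1),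
    SmoothAt.eventually h.2] with y h1 h2 using ⟨h1, h2⟩

theorem AdmissibleAt.congr {W W' : VField d (Fin p)} {x : Space d} (h : 𝓢.AdmissibleAt W x)
    (hW : W =ᶠ[𝓝 x] W') : 𝓢.AdmissibleAt W' x :=
  ⟨hW.self_of_nhds ▸ h.1, SmoothAt.congr h.2 hW.symm⟩

/-- Near `s = 0`, the perturbation `W + s g` is admissible. -/
theorem AdmissibleAt.add_smul {W g : VField d (Fin p)} {x : Space d} (h : 𝓢.AdmissibleAt W x)
    (hg : SmoothField g x) : ∀ᶠ s : ℝ in 𝓝 0, 𝓢.AdmissibleAt (W + s • g) x := by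
  have h1 := ((h.fam (0 : ℝ)).add_smul (hg.fam 0)).eventually
  have h2 : ContinuousAt (fun s : ℝ => (((0 : ℝ), s), x)) 0 := by fun_prop
  filter_upwards [h2.eventually h1] with s hs using hs.admissibleAt

variable (𝓢)

/-- An operator is regular if it is local and maps smooth families to smooth families. -/
structure Reg (F : Operator d p n) : Prop where
  smooth : ∀ (E : Type) [NormedAddCommGroup E] [NormedSpace ℝ E] (w : E → VField d (Fin p)) (e : E)
    (x : Space d), 𝓢.AdmFam w e x → SmoothFam (fun e => F (w e)) e x
  congr : ∀ (W W' : VField d (Fin p)) (x : Space d), 𝓢.AdmissibleAt W x → W =ᶠ[𝓝 x] W' →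
    F W x = F W' x

/-- The two operators agree on admissible fields. -/
def Equiv (F G : Operator d p n) : Prop := ∀ W x, 𝓢.AdmissibleAt W x → F W x = G W x

end Scheme

/-- The derivative at `s = 0` of `F(W + s g)`. -/
noncomputable def dOp (F : Operator d p n) (W g : VField d (Fin p)) : VField d n :=
  fun x k => deriv (fun s : ℝ => F (W + s • g) x k) 0

/-- With a field as direction, the differential also applies to directions that are not operators of
W, such as the time derivative of a family. -/
theorem dirDeriv_eq_dOp (F : Operator d p n) (G : Operator d p (Fin p)) (W : VField d (Fin p)) :
    dirDeriv F G W = dOp F W (G W) := rfl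

/-- Rescaling the variable of a derivative requires no differentiability. Homogeneity therefore
holds for arbitrary operators, so the change of small parameter needs no regularity. -/
theorem dOp_smul_right (F : Operator d p n) (W g : VField d (Fin p)) (c : ℝ) :
    dOp F W (c • g) = c • dOp F W g := by
  ext x k
  have := deriv_comp_mul_left c (fun s : ℝ => F (W + s • g) x k) 0
  simp only [mul_zero] at this
  simp only [dOp, Pi.smul_apply, ← this, smul_smul, mul_comm]

theorem dOp_smul_left (F : Operator d p n) (W g : VField d (Fin p)) (c : ℝ) :
    dOp (c • F) W g = c • dOp F W g := by
  ext x k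
  simp only [dOp, Pi.smul_apply, smul_eq_mul]
  exact deriv_const_mul_field c

theorem dOp_id (W g : VField d (Fin p)) : dOp (fun W => W) W g = g := by
  ext x k
  have := ((hasDerivAt_id (0 : ℝ)).mul_const (g x k)).const_add (W x k)
  rw [one_mul] at this
  exact this.deriv

theorem dOp_zero (W g : VField d (Fin p)) : dOp (0 : Operator d p n) W g = 0 := by
  ext x k
  simp [dOp]

/-! ### Differentials of regular operators and the chain rule -/

namespace Scheme

variable {𝓢 : Scheme d p r}

namespace Reg

theorem smoothField {F : Operator d p n} (hF : 𝓢.Reg F) {W : VField d (Fin p)} {x : Space d}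
    (h : 𝓢.AdmissibleAt W x) : SmoothField (F W) x :=
  (hF.smooth ℝ (fun _ => W) 0 x (h.fam 0)).field

theorem eventuallyEq {F : Operator d p n} (hF : 𝓢.Reg F) {W W' : VField d (Fin p)} {x : Space d}
    (h : 𝓢.AdmissibleAt W x) (hW : W =ᶠ[𝓝 x] W') : F W =ᶠ[𝓝 x] F W' := by
  filter_upwards [h.eventually, hW.eventuallyEq_nhds] with y h1 h2 using hF.congr _ _ _ h1 h2

theorem of_equiv {F G : Operator d p n} (hF : 𝓢.Reg F) (h : 𝓢.Equiv F G) : 𝓢.Reg G where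
  smooth E _ _ w e x hw k := by
    refine (hF.smooth E w e x hw k).congr ?_
    filter_upwards [hw.eventually] with z hz
    rw [h _ _ hz.admissibleAt]
  congr W W' x hW hWW := by
    rw [← h _ _ hW, ← h _ _ (hW.congr hWW), hF.congr _ _ _ hW hWW]

/-- W + s g stays admissible at x for small s, so locality of F can be used for each such s. -/
theorem dOp_congr {F : Operator d p n} (hF : 𝓢.Reg F) {W W' g g' : VField d (Fin p)} {x : Space d}
    (h : 𝓢.AdmissibleAt W x) (hg : SmoothField g x) (hW : W =ᶠ[𝓝 x] W') (hgg : g =ᶠ[𝓝 x] g') :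
    dOp F W g x = dOp F W' g' x := by
  ext k
  refine EventuallyEq.deriv_eq ?_
  filter_upwards [h.add_smul hg] with s hs
  rw [hF.congr _ (W' + s • g') _ hs]
  filter_upwards [hW, hgg] with y h1 h2
  simp [h1, h2]

/-- Regularity of F is used for the family enlarged by the parameter s. This is why `Reg` quantifies
over all parameter spaces: one fixed space would not be stable under differentials. -/
theorem smoothFam_dOp {F : Operator d p n} (hF : 𝓢.Reg F) {E : Type} [NormedAddCommGroup E]
    [NormedSpace ℝ E] {w g : E → VField d (Fin p)} {e : E} {x : Space d} (hw : 𝓢.AdmFam w e x)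
    (hg : SmoothFam g e x) : SmoothFam (fun e => dOp F (w e) (g e)) e x := by
  intro k
  have h := hF.smooth _ _ _ _ (hw.add_smul hg) k
  have hφ : SmoothAt (fun z : E × Space d => ((z.1, (0 : ℝ)), z.2)) (e, x) :=
    .of_contDiff (by fun_prop) _
  refine (SmoothAt.comp (e, x) (h.fderiv_apply (((0, 1), 0) : (E × ℝ) × Space d)) hφ).congr ?_
  filter_upwards [hφ.continuousAt.eventually h.eventually] with z hz
  have hc : HasDerivAt (fun s : ℝ => ((z.1, s), z.2)) (((0, 1), 0) : (E × ℝ) × Space d) 0 :=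
    ((hasDerivAt_const _ _).prodMk (hasDerivAt_id _)).prodMk (hasDerivAt_const _ _)
  exact (SmoothAt.hasDerivAt_comp (c := fun s : ℝ => ((z.1, s), z.2)) hz hc).deriv

theorem hasDerivAt {F : Operator d p n} (hF : 𝓢.Reg F) {W g : VField d (Fin p)} {x : Space d}
    (h : 𝓢.AdmissibleAt W x) (hg : SmoothField g x) (k : n) :
    HasDerivAt (fun s : ℝ => F (W + s • g) x k) (dOp F W g x k) 0 := by
  have h1 := hF.smooth _ _ _ _ ((h.fam (0 : ℝ)).add_smul (hg.fam 0)) k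
  have hφ : SmoothAt (fun s : ℝ => (((0 : ℝ), s), x)) 0 := .of_contDiff (by fun_prop) _
  exact (SmoothAt.comp (0 : ℝ) h1 hφ).differentiableAt.hasDerivAt

/-- F(W + a g + b g') is smooth in (a, b), and the derivative along the diagonal is the sum of the
two partial derivatives. -/
theorem dOp_add_right {F : Operator d p n} (hF : 𝓢.Reg F) {W g g' : VField d (Fin p)}
    {x : Space d} (h : 𝓢.AdmissibleAt W x) (hg : SmoothField g x) (hg' : SmoothField g' x) :
    dOp F W (g + g') x = dOp F W g x + dOp F W g' x := by
  ext k
  have h0 := (h.fam (0 : ℝ)).add_smul (hg.fam 0)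
  have h1 := hF.smooth _ _ _ _ (h0.add_smul (g := fun _ => g') (hg'.fam _)) k
  have hφ : SmoothAt (fun s : ℝ × ℝ => ((((0 : ℝ), s.1), s.2), x)) (0, 0) :=
    .of_contDiff (by fun_prop) _
  have h2 := SmoothAt.comp (0, 0) h1 hφ
  have e1 := SmoothAt.hasDerivAt_comp (c := fun s : ℝ => (s, s)) (t := 0) h2
    ((hasDerivAt_id _).prodMk (hasDerivAt_id _))
  have e2 := SmoothAt.hasDerivAt_comp (c := fun s : ℝ => (s, 0)) (t := 0) h2
    ((hasDerivAt_id _).prodMk (hasDerivAt_const _ _))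
  have e3 := SmoothAt.hasDerivAt_comp (c := fun s : ℝ => (0, s)) (t := 0) h2
    ((hasDerivAt_const _ _).prodMk (hasDerivAt_id _))
  have e4 : ((1, 1) : ℝ × ℝ) = (1, 0) + (0, 1) := by simp
  rw [e4, map_add] at e1
  simp only [dOp, Pi.add_apply]
  rw [← e2.deriv, ← e3.deriv] at e1
  simp only [zero_smul, add_zero] at e1
  rw [← e1.deriv]
  simp only [smul_add, add_assoc]

/-- The chain rule: the time derivative of `F(w)` is the differential of `F` in the direction of
the time derivative of `w`. -/
theorem hasDerivAt_comp {F : Operator d p n} (hF : 𝓢.Reg F) {w : ℝ → VField d (Fin p)} {t : ℝ}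
    {x : Space d} (hw : 𝓢.AdmFam w t x) (k : n) :
    HasDerivAt (fun t => F (w t) x k)
      (dOp F (w t) (fun y i => deriv (fun t => w t y i) t) x k) t := by
  have hsh : ∀ i, SmoothAt (fun z : Space d × ℝ => w (t + z.2) z.1 i) (x, 0) := fun i =>
    SmoothAt.comp_of_eq (f := fun z : Space d × ℝ => (t + z.2, z.1))
      (g := fun z : ℝ × Space d => w z.1 z.2 i) (x, 0) (hw.2 i)
      (.of_contDiff (by fun_prop) _) (by simp)
  have hbase : ∀ i, SmoothAt (fun z : Space d × ℝ => w t z.1 i) (x, 0) := fun i =>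
    SmoothAt.comp (f := fun z : Space d × ℝ => (t, z.1))
      (g := fun z : ℝ × Space d => w z.1 z.2 i) (x, 0) (hw.2 i)
      (.of_contDiff (by fun_prop) _)
  -- Hadamard's lemma writes w(t + a) = w(t) + a ρ(a) with ρ jointly smooth. Freeing the two
  -- occurrences of a gives the family w(t) + b ρ(a), whose diagonal is w(t + a).
  have hH := fun i => ((hsh i).sub (hbase i)).exists_eq_mul
    (Eventually.of_forall fun z => by simp)
  choose ρ hρ hρe using hH
  have hfam : 𝓢.AdmFam (fun (q : ℝ × ℝ) y i => w t y i + q.2 * ρ i (y, q.1)) (0, 0) x := by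
    refine ⟨by simpa using hw.1, fun i => ?_⟩
    refine SmoothAt.add ?_ (SmoothAt.mul (.of_contDiff (by fun_prop) _) ?_)
    · exact SmoothAt.comp (f := fun z : (ℝ × ℝ) × Space d => (t, z.2))
        (g := fun z : ℝ × Space d => w z.1 z.2 i) _ (hw.2 i) (.of_contDiff (by fun_prop) _)
    · exact SmoothAt.comp (f := fun z : (ℝ × ℝ) × Space d => (z.2, z.1.1))
        (g := ρ i) _ (hρ i) (.of_contDiff (by fun_prop) _)
  have h1 := SmoothAt.comp (f := fun q : ℝ × ℝ => (q, x)) _ (hF.smooth _ _ _ _ hfam k)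
    (.of_contDiff (by fun_prop) _)
  have e1 := SmoothAt.hasDerivAt_comp (c := fun s : ℝ => (s, s)) (t := 0) h1
    ((hasDerivAt_id _).prodMk (hasDerivAt_id _))
  have e2 := SmoothAt.hasDerivAt_comp (c := fun s : ℝ => (s, 0)) (t := 0) h1
    ((hasDerivAt_id _).prodMk (hasDerivAt_const _ _))
  have e3 := SmoothAt.hasDerivAt_comp (c := fun s : ℝ => (0, s)) (t := 0) h1
    ((hasDerivAt_const _ _).prodMk (hasDerivAt_id _))
  have e4 : ((1, 1) : ℝ × ℝ) = (1, 0) + (0, 1) := by simp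
  rw [e4, map_add, ← e2.deriv, ← e3.deriv] at e1
  -- At b = 0 the family does not depend on a, so only the partial derivative in b survives; at a =
  -- 0 it is the differential in the direction ρ(0) = ∂_t w.
  simp only [zero_mul, add_zero, deriv_const, zero_add] at e1
  have hdir : dOp F (w t) (fun y i => deriv (fun t => w t y i) t) x k =
      deriv (fun s : ℝ => F (fun y i => w t y i + s * ρ i (y, 0)) x k) 0 := by
    have hg0 : SmoothField (fun y i => ρ i (y, (0 : ℝ))) x := fun i =>
      SmoothAt.comp (f := fun y : Space d => (y, (0 : ℝ))) (g := ρ i) _ (hρ i)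
        (.of_contDiff (by fun_prop) _)
    have hgg : (fun y i => ρ i (y, (0 : ℝ))) =ᶠ[𝓝 x] fun y i => deriv (fun t => w t y i) t := by
      have hc : ContinuousAt (fun y : Space d => (y, (0 : ℝ))) x := by fun_prop
      filter_upwards [hc.eventually (eventually_all.2 fun i => (hρe i).eventuallyEq_nhds),
        hc.eventually (eventually_all.2 fun i => (hρ i).eventually)] with y hy hys
      ext i
      have hc2 : ContinuousAt (fun a : ℝ => (y, a)) 0 := by fun_prop
      have h3 : (fun a : ℝ => w (t + a) y i - w t y i) =ᶠ[𝓝 0] fun a => a * ρ i (y, a) :=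
        hc2.eventually (hy i)
      have h4 : DifferentiableAt ℝ (fun a : ℝ => ρ i (y, a)) 0 :=
        (SmoothAt.slice (hys i)).differentiableAt
      have h5 := ((hasDerivAt_id (0 : ℝ)).mul h4.hasDerivAt).congr_of_eventuallyEq h3
      simp only [id_eq, one_mul, zero_mul, add_zero] at h5
      have h6 := h5.deriv
      rw [deriv_sub_const_fun] at h6
      have h7 := deriv_comp_const_add (fun a => w a y i) t 0
      rw [add_zero] at h7
      rw [← h7, h6]
    rw [← hF.dOp_congr hw.admissibleAt hg0 EventuallyEq.rfl hgg]
    rfl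
  rw [hdir]
  have hev : (fun a : ℝ => F (w (t + a)) x k) =ᶠ[𝓝 0]
      fun a : ℝ => F (fun y i => w t y i + a * ρ i (y, a)) x k := by
    have hc : ContinuousAt (fun a : ℝ => (x, a)) 0 := by fun_prop
    have hc2 : ContinuousAt (fun a : ℝ => (t + a, x)) 0 := by fun_prop
    filter_upwards [hc.eventually (eventually_all.2 fun i => (hρe i).eventuallyEq_nhds),
      hc2.eventually (by simpa using hw.eventually)] with a ha hwa
    rw [hF.congr _ _ _ hwa.admissibleAt]
    have hc3 : ContinuousAt (fun y : Space d => (y, a)) x := by fun_prop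
    filter_upwards [hc3.eventually (eventually_all.2 ha)] with y hy
    ext i
    rw [← hy i]; ring
  have e5 := e1.congr_of_eventuallyEq hev
  have e6 := HasDerivAt.comp_sub_const (f := fun a : ℝ => F (w (t + a)) x k) t t (by simpa using e5)
  simpa using e6

end Reg

end Scheme

end Families

end LatticeBoltzmann

namespace LatticeBoltzmann

namespace Scheme

variable {d p r : ℕ} {n n' : Type} {𝓢 : Scheme d p r}

/-! ### Closure properties of regular operators -/

theorem AdmFam.advection_eq {E : Type} [NormedAddCommGroup E] [NormedSpace ℝ E]
    {u : E → VField d (Idx p r)} {e : E} {x : Space d} (hu : SmoothFam u e x) (k : Idx p r) :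
    (fun z : E × Space d => 𝓢.advection (u z.1) z.2 k) =ᶠ[𝓝 (e, x)] fun z =>
      ∑ l, ∑ j, 𝓢.M k j * 𝓢.M⁻¹ j l *
        fderiv ℝ (fun z : E × Space d => u z.1 z.2 l) z (0, 𝓢.v j) := by
  have h : ∀ l j, _ := fun l j => (hu l).fderiv_snd (𝓢.v j)
  filter_upwards [eventually_all.2 fun l => eventually_all.2 (h l)] with z hz
  simp only [advection, hz]

variable (𝓢) in
theorem smoothFam_advection {E : Type} [NormedAddCommGroup E] [NormedSpace ℝ E]
    {u : E → VField d (Idx p r)} {e : E} {x : Space d} (hu : SmoothFam u e x) :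
    SmoothFam (fun e => 𝓢.advection (u e)) e x := fun k =>
  (SmoothAt.sum fun l _ => SmoothAt.sum fun j _ =>
    ((hu l).fderiv_apply (0, 𝓢.v j)).const_mul _).congr (AdmFam.advection_eq hu k)

variable (𝓢) in
theorem advection_congr {u u' : VField d (Idx p r)} {x : Space d} (h : u =ᶠ[𝓝 x] u') :
    𝓢.advection u x = 𝓢.advection u' x := by
  ext k
  simp only [advection]
  refine Finset.sum_congr rfl fun l _ => Finset.sum_congr rfl fun j _ => ?_
  rw [EventuallyEq.fderiv_eq (h.mono fun y hy => congrFun hy l)]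

variable (𝓢) in
theorem advection_smul (c : ℝ) (u : VField d (Idx p r)) :
    𝓢.advection (c • u) = c • 𝓢.advection u := by
  ext x k
  simp only [advection, Pi.smul_apply, smul_eq_mul, Finset.mul_sum]
  refine Finset.sum_congr rfl fun l _ => Finset.sum_congr rfl fun j _ => ?_
  have : fderiv ℝ (fun y => c * u y l) x = c • fderiv ℝ (fun y => u y l) x :=
    congrFun (fderiv_const_smul_field (f := fun y => u y l) c) x
  rw [this]
  simp only [_root_.smul_apply, smul_eq_mul]
  ring

variable (𝓢) in
theorem advection_add {u u' : VField d (Idx p r)} {x : Space d} (hu : SmoothField u x)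
    (hu' : SmoothField u' x) :
    𝓢.advection (u + u') x = 𝓢.advection u x + 𝓢.advection u' x := by
  ext k
  simp only [advection, Pi.add_apply, ← Finset.sum_add_distrib]
  refine Finset.sum_congr rfl fun l _ => Finset.sum_congr rfl fun j _ => ?_
  rw [fderiv_fun_add (hu l).differentiableAt (hu' l).differentiableAt]
  simp only [_root_.add_apply]
  ring

namespace Reg

theorem id : 𝓢.Reg (fun W => W) where
  smooth E _ _ w e x hw := hw.2
  congr W W' x _ h := h.self_of_nhds

theorem equil : 𝓢.Reg 𝓢.equil where
  smooth E _ _ w e x hw k := by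
    have h1 : SmoothAt 𝓢.Φ (w e x) := by
      filter_upwards [𝓢.isOpen_U.mem_nhds hw.1] with y hy
      exact 𝓢.contDiffOn_Φ.contDiffAt (𝓢.isOpen_U.mem_nhds hy)
    exact SmoothAt.apply (SmoothAt.comp (f := fun z : E × Space d => w z.1 z.2) (e, x) h1
      (SmoothAt.pi hw.2)) k
  congr W W' x _ h := by simp only [Scheme.equil, h.self_of_nhds]

theorem zero : 𝓢.Reg (0 : Operator d p n) where
  smooth E _ _ w e x hw k := .of_contDiff contDiff_const _
  congr W W' x _ h := rfl

theorem add {F G : Operator d p n} (hF : 𝓢.Reg F) (hG : 𝓢.Reg G) : 𝓢.Reg (F + G) where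
  smooth E _ _ w e x hw k := (hF.smooth E w e x hw k).add (hG.smooth E w e x hw k)
  congr W W' x hW h := by simp only [Pi.add_apply, hF.congr _ _ _ hW h, hG.congr _ _ _ hW h]

theorem smul {F : Operator d p n} (hF : 𝓢.Reg F) (c : ℝ) : 𝓢.Reg (c • F) where
  smooth E _ _ w e x hw k := (hF.smooth E w e x hw k).const_mul c
  congr W W' x hW h := by simp only [Pi.smul_apply, hF.congr _ _ _ hW h]

theorem neg {F : Operator d p n} (hF : 𝓢.Reg F) : 𝓢.Reg (-F) := by
  simpa using hF.smul (-1)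

theorem sub {F G : Operator d p n} (hF : 𝓢.Reg F) (hG : 𝓢.Reg G) : 𝓢.Reg (F - G) := by
  simpa [sub_eq_add_neg] using hF.add hG.neg

theorem sum {ι : Type*} {s : Finset ι} {F : ι → Operator d p n} (h : ∀ i ∈ s, 𝓢.Reg (F i)) :
    𝓢.Reg (∑ i ∈ s, F i) := by
  classical
  induction s using Finset.induction_on with
  | empty => simpa using zero
  | insert i s hi ih =>
    rw [Finset.sum_insert hi]
    exact (h i (by simp)).add (ih fun j hj => h j (by simp [hj]))

theorem mulVec [Fintype n] {F : Operator d p n} (hF : 𝓢.Reg F) (N : Matrix n' n ℝ) :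
    𝓢.Reg (fun W x => N *ᵥ F W x) where
  smooth E _ _ w e x hw k :=
    SmoothAt.sum fun i _ => (hF.smooth E w e x hw i).const_mul (N k i)
  congr W W' x hW h := by rw [hF.congr _ _ _ hW h]

theorem reindex {F : Operator d p n} (hF : 𝓢.Reg F) (σ : n' → n) :
    𝓢.Reg (fun W x i => F W x (σ i)) where
  smooth E _ _ w e x hw k := hF.smooth E w e x hw (σ k)
  congr W W' x hW h := by rw [hF.congr _ _ _ hW h]

theorem pair {F : Operator d p n} {G : Operator d p n'} (hF : 𝓢.Reg F) (hG : 𝓢.Reg G) :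
    𝓢.Reg (fun W x => Sum.elim (F W x) (G W x)) where
  smooth E _ _ w e x hw k := by
    cases k with
    | inl k => exact hF.smooth E w e x hw k
    | inr k => exact hG.smooth E w e x hw k
  congr W W' x hW h := by rw [hF.congr _ _ _ hW h, hG.congr _ _ _ hW h]

theorem advection {F : Operator d p (Idx p r)} (hF : 𝓢.Reg F) :
    𝓢.Reg (fun W => 𝓢.advection (F W)) where
  smooth E _ _ w e x hw := 𝓢.smoothFam_advection (hF.smooth E w e x hw)
  congr W W' x hW h := 𝓢.advection_congr (hF.eventuallyEq hW h)

theorem dirDeriv {F : Operator d p n} {G : Operator d p (Fin p)} (hF : 𝓢.Reg F) (hG : 𝓢.Reg G) :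
    𝓢.Reg (dirDeriv F G) where
  smooth E _ _ w e x hw := hF.smoothFam_dOp hw (hG.smooth E w e x hw)
  congr W W' x hW h := hF.dOp_congr hW (hG.smoothField hW) h (hG.eventuallyEq hW h)

/-! ### The differential is linear and commutes with linear operators -/

theorem dOp_add_left {F F' : Operator d p n} (hF : 𝓢.Reg F) (hF' : 𝓢.Reg F')
    {W g : VField d (Fin p)} {x : Space d} (h : 𝓢.AdmissibleAt W x) (hg : SmoothField g x) :
    dOp (F + F') W g x = dOp F W g x + dOp F' W g x := by
  ext k
  exact ((hF.hasDerivAt h hg k).add (hF'.hasDerivAt h hg k)).deriv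

theorem dOp_mulVec [Fintype n] {F : Operator d p n} (hF : 𝓢.Reg F) (N : Matrix n' n ℝ)
    {W g : VField d (Fin p)} {x : Space d} (h : 𝓢.AdmissibleAt W x) (hg : SmoothField g x) :
    dOp (fun W x => N *ᵥ F W x) W g x = N *ᵥ dOp F W g x := by
  ext k
  exact (HasDerivAt.fun_sum fun i _ => (hF.hasDerivAt h hg i).const_mul (N k i)).deriv

/-- The s-derivative and the space derivatives of the jointly smooth function (s, y) ↦ F(W + s g)(y)
commute, by symmetry of the second derivative. -/
theorem dOp_advection {F : Operator d p (Idx p r)} (hF : 𝓢.Reg F)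
    {W g : VField d (Fin p)} {x : Space d} (h : 𝓢.AdmissibleAt W x) (hg : SmoothField g x) :
    dOp (fun W => 𝓢.advection (F W)) W g x = 𝓢.advection (dOp F W g) x := by
  ext k
  have hs : ∀ l, SmoothAt (fun z : ℝ × Space d => F (W + z.1 • g) z.2 l) (0, x) := fun l =>
    SmoothAt.comp (f := fun z : ℝ × Space d => (((0 : ℝ), z.1), z.2))
      (g := fun z : (ℝ × ℝ) × Space d => F (W + z.1.2 • g) z.2 l) _
      (hF.smooth _ _ _ _ ((h.fam (0 : ℝ)).add_smul (hg.fam 0)) l) (.of_contDiff (by fun_prop) _)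
  refine HasDerivAt.deriv (HasDerivAt.fun_sum fun l _ => HasDerivAt.fun_sum fun j _ =>
    HasDerivAt.const_mul _ ?_)
  have hfd := (hs l).fderiv_snd (𝓢.v j)
  have hc : ContinuousAt (fun s : ℝ => (s, x)) 0 := by fun_prop
  have hcx : ContinuousAt (fun y : Space d => ((0 : ℝ), y)) x := by fun_prop
  have e1 := SmoothAt.hasDerivAt_comp (c := fun s : ℝ => (s, x)) (t := 0)
    ((hs l).fderiv_apply (0, 𝓢.v j)) ((hasDerivAt_id _).prodMk (hasDerivAt_const _ _))
  have e2 := e1.congr_of_eventuallyEq (hc.eventually hfd)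
  refine e2.congr_deriv ?_
  rw [SmoothAt.fderiv_comm (hs l)]
  have hdt : (fun y => dOp F W g y l) =ᶠ[𝓝 x] fun y =>
      fderiv ℝ (fun z : ℝ × Space d => F (W + z.1 • g) z.2 l) (0, y) (1, 0) := by
    filter_upwards [hcx.eventually (hs l).eventually] with y hy
    exact (SmoothAt.hasDerivAt_comp (c := fun s : ℝ => (s, y)) (t := 0) hy
      ((hasDerivAt_id _).prodMk (hasDerivAt_const _ _))).deriv
  rw [hdt.fderiv_eq]
  exact (((hs l).fderiv_apply (1, 0)).fderiv_snd (𝓢.v j)).self_of_nhds.symm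

end Reg

end Scheme

end LatticeBoltzmann

namespace LatticeBoltzmann

/-! ### The algebraic identity behind the explicit formulas -/

section Formal
variable {X Z : Type*} [AddCommGroup X] [Module ℝ X] [AddCommGroup Z] [Module ℝ Z]

/-- The action on a series of a derivation `∑ εʲ δ j`. -/
def seriesDeriv (δ : ℕ → X →ₗ[ℝ] X) (F : ℕ → X) : ℕ → X :=
  fun k => ∑ i ∈ Finset.range (k + 1), δ (k - i) (F i)

/-- The coefficients of `exp(ε ∂) m - exp(-ε Λ) m*`. -/
noncomputable def seriesResidual (δ : ℕ → X →ₗ[ℝ] X) (Λ : X →ₗ[ℝ] X) (m mstar : ℕ → X) (n : ℕ) : X :=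
  ∑ k ∈ Finset.range (n + 1), (1 ^ k / (k.factorial : ℝ)) • (seriesDeriv δ)^[k] m (n - k)
  - ∑ k ∈ Finset.range (n + 1), ((-1) ^ k / (k.factorial : ℝ)) • (Λ^[k]) (mstar (n - k))

set_option maxHeartbeats 4000000 in
-- X and Z stand for the classes of conserved and nonconserved operators, and `S` is here the Hénon
-- matrix Σ, not the relaxation matrix. B₂ and D₂ are expanded as AB + BD and CB + DD. Commutation
-- with A, B, C, D, Σ moves every derivation inwards; what remains is a linear combination of words,
-- compared coefficient by coefficient. Nothing is assumed on δ i ∘ δ j versus δ j ∘ δ i. Of the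
-- fourth coefficients of m and m* only the conserved parts matter, since the nonconserved equation
-- is tested up to order three.
theorem seriesResidual_eq_zero (A : X →ₗ[ℝ] X) (B : Z →ₗ[ℝ] X) (C : X →ₗ[ℝ] Z) (D : Z →ₗ[ℝ] Z)
    (S : Z →ₗ[ℝ] Z) (δ : ℕ → X →ₗ[ℝ] X) (θ : ℕ → Z →ₗ[ℝ] Z)
    (hA : ∀ j x, δ j (A x) = A (δ j x)) (hB : ∀ j z, δ j (B z) = B (θ j z))
    (hC : ∀ j x, θ j (C x) = C (δ j x)) (hD : ∀ j z, θ j (D z) = D (θ j z))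
    (hS : ∀ j z, θ j (S z) = S (θ j z)) (W G₁ G₂ G₃ G₄ : X) (Φ P₁ P₂ P₃ : Z)
    (hW₁ : δ 0 W = G₁) (hW₂ : δ 1 W = G₂) (hW₃ : δ 2 W = G₃) (hW₄ : δ 3 W = G₄)
    (hG₁ : G₁ = A W + B Φ) (hP₁ : P₁ = θ 0 Φ - (C W + D Φ)) (hG₂ : G₂ = B (S P₁))
    (hP₂ : P₂ = S (θ 0 P₁) + θ 1 Φ - D (S P₁))
    (hG₃ : G₃ = B (S P₂) - (1 / 6 : ℝ) • B (θ 0 P₁) + (1 / 12 : ℝ) • (A (B P₁) + B (D P₁)))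
    (hP₃ : P₃ = S (θ 1 P₁) + θ 2 Φ - D (S P₂) + S (θ 0 P₂) + (1 / 6 : ℝ) • D (θ 0 P₁)
      - (1 / 12 : ℝ) • (C (B P₁) + D (D P₁)) - (1 / 12 : ℝ) • θ 0 (θ 0 P₁))
    (hG₄ : G₄ = B (S P₃) + (1 / 4 : ℝ) • (A (B P₂) + B (D P₂))
      + (1 / 6 : ℝ) • B (C (B (S P₁)) + D (D (S P₁))) - (1 / 6 : ℝ) • A (B P₂)
      - (1 / 6 : ℝ) • B (θ 1 (θ 0 Φ)) - (1 / 6 : ℝ) • B (θ 0 (θ 1 Φ))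
      - (1 / 6 : ℝ) • B (S (θ 0 (θ 0 P₁))))
    (Λ : X × Z →ₗ[ℝ] X × Z) (hΛ : ∀ u, Λ u = (A u.1 + B u.2, C u.1 + D u.2))
    (Δ : ℕ → X × Z →ₗ[ℝ] X × Z) (hΔ : ∀ j u, Δ j u = (- δ j u.1, - θ j u.2))
    (m mstar : ℕ → X × Z)
    (hm0 : m 0 = (W, Φ)) (hm1 : m 1 = (0, S P₁ + (1 / 2 : ℝ) • P₁))
    (hm2 : m 2 = (0, S P₂ + (1 / 2 : ℝ) • P₂)) (hm3 : m 3 = (0, S P₃ + (1 / 2 : ℝ) • P₃))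
    (hm4 : (m 4).1 = 0) (hs0 : mstar 0 = (W, Φ)) (hs1 : mstar 1 = (0, S P₁ - (1 / 2 : ℝ) • P₁))
    (hs2 : mstar 2 = (0, S P₂ - (1 / 2 : ℝ) • P₂)) (hs3 : mstar 3 = (0, S P₃ - (1 / 2 : ℝ) • P₃))
    (hs4 : (mstar 4).1 = 0) :
    (∀ n ≤ 4, (seriesResidual Δ Λ m mstar n).1 = 0) ∧
    (∀ n ≤ 3, (seriesResidual Δ Λ m mstar n).2 = 0) := by
  constructor
  · intro n hn
    interval_cases n
    · simp [seriesResidual, hm0, hs0]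
    · simp [seriesResidual, seriesDeriv, Finset.sum_range_succ, hm0, hs0, hm1, hs1, hΔ, hΛ, hW₁,
        hG₁]
    · simp [seriesResidual, seriesDeriv, Finset.sum_range_succ, hm0, hs0, hm1, hs1, hm2, hs2, hΔ, hΛ,
        hW₁, hW₂, hG₁, hG₂, hP₁, hA, hB, hC, hD, hS]
      module
    · simp [seriesResidual, seriesDeriv, Finset.sum_range_succ, hm0, hs0, hm1, hs1, hm2, hs2, hm3, hs3, hΔ, hΛ,
        hW₁, hW₂, hW₃, hG₁, hG₂, hG₃, hP₁, hP₂, hA, hB, hC, hD, hS, Nat.factorial]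
      module
    · simp [seriesResidual, seriesDeriv, Finset.sum_range_succ, hm0, hs0, hm1, hs1, hm2, hs2, hm3, hs3, hm4, hs4, hΔ, hΛ,
        hW₁, hW₂, hW₃, hW₄, hG₁, hG₂, hG₃, hG₄, hP₁, hP₂, hP₃, hA, hB, hC, hD, hS, Nat.factorial]
      module
  · intro n hn
    interval_cases n
    · simp [seriesResidual, hm0, hs0]
    · simp [seriesResidual, seriesDeriv, Finset.sum_range_succ, hm0, hs0, hm1, hs1, hΔ, hΛ, hW₁,
        hG₁, hP₁]
      module
    · simp [seriesResidual, seriesDeriv, Finset.sum_range_succ, hm0, hs0, hm1, hs1, hm2, hs2, hΔ, hΛ,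
        hW₁, hW₂, hG₁, hG₂, hP₁, hP₂, hA, hB, hC, hD, hS]
      module
    · simp [seriesResidual, seriesDeriv, Finset.sum_range_succ, hm0, hs0, hm1, hs1, hm2, hs2, hm3, hs3, hΔ, hΛ,
        hW₁, hW₂, hW₃, hG₁, hG₂, hG₃, hP₁, hP₂, hP₃, hA, hB, hC, hD, hS, Nat.factorial]
      module
end Formal
end LatticeBoltzmann

namespace LatticeBoltzmann

namespace Scheme

variable {d p r : ℕ} {n n' n'' : Type} {𝓢 : Scheme d p r}

/-! ### The vector space of regular operators modulo their values on inadmissible fields -/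

namespace Equiv

theorem refl (F : Operator d p n) : 𝓢.Equiv F F := fun _ _ _ => rfl

theorem symm {F G : Operator d p n} (h : 𝓢.Equiv F G) : 𝓢.Equiv G F :=
  fun W x hW => (h W x hW).symm

theorem trans {F G H : Operator d p n} (h : 𝓢.Equiv F G) (h' : 𝓢.Equiv G H) : 𝓢.Equiv F H :=
  fun W x hW => (h W x hW).trans (h' W x hW)

theorem add {F G F' G' : Operator d p n} (h : 𝓢.Equiv F F') (h' : 𝓢.Equiv G G') :
    𝓢.Equiv (F + G) (F' + G') := fun W x hW => by
  simp only [Pi.add_apply, h W x hW, h' W x hW]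

theorem smul {F F' : Operator d p n} (h : 𝓢.Equiv F F') (c : ℝ) : 𝓢.Equiv (c • F) (c • F') :=
  fun W x hW => by simp only [Pi.smul_apply, h W x hW]

theorem neg {F F' : Operator d p n} (h : 𝓢.Equiv F F') : 𝓢.Equiv (-F) (-F') :=
  fun W x hW => by simp only [Pi.neg_apply, h W x hW]

theorem sum {ι : Type*} {s : Finset ι} {F F' : ι → Operator d p n}
    (h : ∀ i ∈ s, 𝓢.Equiv (F i) (F' i)) : 𝓢.Equiv (∑ i ∈ s, F i) (∑ i ∈ s, F' i) :=
  fun W x hW => by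
    simp only [Finset.sum_apply]
    exact Finset.sum_congr rfl fun i hi => h i hi W x hW

theorem eventuallyEq {F G : Operator d p n} (h : 𝓢.Equiv F G) {W : VField d (Fin p)} {x : Space d}
    (hW : 𝓢.AdmissibleAt W x) : F W =ᶠ[𝓝 x] G W := by
  filter_upwards [hW.eventually] with y hy using h W y hy

theorem dirDeriv {F F' : Operator d p n} {G G' : Operator d p (Fin p)} (hF : 𝓢.Reg F)
    (hG : 𝓢.Reg G) (h : 𝓢.Equiv F F') (h' : 𝓢.Equiv G G') :
    𝓢.Equiv (dirDeriv F G) (dirDeriv F' G') := fun W x hW => by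
  have h1 : LatticeBoltzmann.dirDeriv F G W x = dOp F' W (G W) x := by
    ext k
    refine EventuallyEq.deriv_eq ?_
    filter_upwards [hW.add_smul (hG.smoothField hW)] with s hs
    rw [h _ _ hs]
  rw [h1, (hF.of_equiv h).dOp_congr hW (hG.smoothField hW) EventuallyEq.rfl (h'.eventuallyEq hW)]
  rfl

end Equiv

variable (𝓢) in
open Classical in
/-- `F`, replaced by zero on inadmissible fields. -/
noncomputable def mask (F : Operator d p n) : Operator d p n :=
  fun W x => if 𝓢.AdmissibleAt W x then F W x else 0

theorem equiv_mask (F : Operator d p n) : 𝓢.Equiv F (𝓢.mask F) := fun W x hW => by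
  simp [mask, hW]

variable (𝓢 n) in
/-- The space of regular operators that vanish on inadmissible fields. -/
def RegOp : Submodule ℝ (Operator d p n) where
  carrier := {F | 𝓢.Reg F ∧ ∀ W x, ¬ 𝓢.AdmissibleAt W x → F W x = 0}
  add_mem' := fun h h' => ⟨h.1.add h'.1, fun W x hW => by simp [h.2 W x hW, h'.2 W x hW]⟩
  zero_mem' := ⟨Reg.zero, fun W x _ => rfl⟩
  smul_mem' := fun c F h => ⟨h.1.smul c, fun W x hW => by simp [h.2 W x hW]⟩

theorem regOp_reg (a : 𝓢.RegOp n) : 𝓢.Reg (a : Operator d p n) := a.2.1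

/-- Vanishing off the admissible fields selects one representative per class, so agreement on
admissible fields becomes equality and no quotient is needed. -/
theorem RegOp.ext {a b : 𝓢.RegOp n} (h : 𝓢.Equiv (a : Operator d p n) b) : a = b := by
  apply Subtype.ext
  funext W x
  by_cases hW : 𝓢.AdmissibleAt W x
  · exact h W x hW
  · rw [a.2.2 W x hW, b.2.2 W x hW]

variable (𝓢) in
open Classical in
/-- The class of a regular operator. -/
noncomputable def cls (F : Operator d p n) : 𝓢.RegOp n :=
  if h : 𝓢.Reg F then
    ⟨𝓢.mask F, h.of_equiv (equiv_mask F), fun W x hW => by simp [mask, hW]⟩ else 0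

theorem equiv_cls {F : Operator d p n} (h : 𝓢.Reg F) : 𝓢.Equiv F (𝓢.cls F : Operator d p n) := by
  simpa only [cls, h, dite_true] using equiv_mask F

theorem cls_eq {F : Operator d p n} {a : 𝓢.RegOp n} (h : 𝓢.Equiv F (a : Operator d p n)) :
    𝓢.cls F = a :=
  RegOp.ext ((equiv_cls ((regOp_reg a).of_equiv h.symm)).symm.trans h)

theorem cls_coe (a : 𝓢.RegOp n) : 𝓢.cls (a : Operator d p n) = a := cls_eq (Equiv.refl _)

theorem cls_congr {F G : Operator d p n} (hG : 𝓢.Reg G) (h : 𝓢.Equiv F G) : 𝓢.cls F = 𝓢.cls G :=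
  cls_eq (h.trans (equiv_cls hG))

theorem cls_add {F G : Operator d p n} (hF : 𝓢.Reg F) (hG : 𝓢.Reg G) :
    𝓢.cls (F + G) = 𝓢.cls F + 𝓢.cls G := cls_eq ((equiv_cls hF).add (equiv_cls hG))

theorem cls_smul {F : Operator d p n} (hF : 𝓢.Reg F) (c : ℝ) :
    𝓢.cls (c • F) = c • 𝓢.cls F := cls_eq ((equiv_cls hF).smul c)

theorem cls_neg {F : Operator d p n} (hF : 𝓢.Reg F) : 𝓢.cls (-F) = - 𝓢.cls F :=
  cls_eq (equiv_cls hF).neg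

theorem cls_sub {F G : Operator d p n} (hF : 𝓢.Reg F) (hG : 𝓢.Reg G) :
    𝓢.cls (F - G) = 𝓢.cls F - 𝓢.cls G := by
  rw [sub_eq_add_neg, cls_add hF hG.neg, cls_neg hG, sub_eq_add_neg]

theorem cls_zero : 𝓢.cls (0 : Operator d p n) = 0 := cls_eq (Equiv.refl _)

theorem cls_sum {ι : Type*} {s : Finset ι} {F : ι → Operator d p n} (h : ∀ i ∈ s, 𝓢.Reg (F i)) :
    𝓢.cls (∑ i ∈ s, F i) = ∑ i ∈ s, 𝓢.cls (F i) :=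
  cls_eq (by
    have := Equiv.sum fun i hi => equiv_cls (h i hi)
    simpa using this)

variable (𝓢) in
/-- `L` induces a linear map on regular operators. -/
structure LinOp (L : Operator d p n → Operator d p n') : Prop where
  reg : ∀ {F}, 𝓢.Reg F → 𝓢.Reg (L F)
  congr : ∀ {F G}, 𝓢.Reg F → 𝓢.Equiv F G → 𝓢.Equiv (L F) (L G)
  add : ∀ {F G}, 𝓢.Reg F → 𝓢.Reg G → 𝓢.Equiv (L (F + G)) (L F + L G)
  smul : ∀ {F} (c : ℝ), 𝓢.Reg F → 𝓢.Equiv (L (c • F)) (c • L F)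

theorem LinOp.comp {L : Operator d p n → Operator d p n'} {L' : Operator d p n' → Operator d p n''}
    (h' : 𝓢.LinOp L') (h : 𝓢.LinOp L) : 𝓢.LinOp (fun F => L' (L F)) where
  reg hF := h'.reg (h.reg hF)
  congr hF hG := h'.congr (h.reg hF) (h.congr hF hG)
  add hF hG := (h'.congr (h.reg (hF.add hG)) (h.add hF hG)).trans (h'.add (h.reg hF) (h.reg hG))
  smul c hF := (h'.congr (h.reg (hF.smul c)) (h.smul c hF)).trans (h'.smul c (h.reg hF))

/-- The linear map on regular operators that is induced by `L`. -/
noncomputable def LinOp.toLin {L : Operator d p n → Operator d p n'} (h : 𝓢.LinOp L) :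
    𝓢.RegOp n →ₗ[ℝ] 𝓢.RegOp n' where
  toFun a := 𝓢.cls (L a)
  map_add' a b := by
    rw [← cls_add (h.reg (regOp_reg a)) (h.reg (regOp_reg b))]
    exact cls_congr ((h.reg (regOp_reg a)).add (h.reg (regOp_reg b))) (h.add (regOp_reg a) (regOp_reg b))
  map_smul' c a := by
    rw [RingHom.id_apply, ← cls_smul (h.reg (regOp_reg a))]
    exact cls_congr ((h.reg (regOp_reg a)).smul c) (h.smul c (regOp_reg a))

theorem LinOp.toLin_cls {L : Operator d p n → Operator d p n'} (h : 𝓢.LinOp L)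
    {F : Operator d p n} (hF : 𝓢.Reg F) : h.toLin (𝓢.cls F) = 𝓢.cls (L F) :=
  cls_congr (h.reg hF) (h.congr (regOp_reg (𝓢.cls F)) (equiv_cls hF).symm)

theorem linOp_dirDeriv {G : Operator d p (Fin p)} (hG : 𝓢.Reg G) :
    𝓢.LinOp (fun F : Operator d p n => dirDeriv F G) where
  reg hF := hF.dirDeriv hG
  congr hF h := Equiv.dirDeriv hF hG h (Equiv.refl G)
  add hF hF' W x hW := hF.dOp_add_left hF' hW (hG.smoothField hW)
  smul c hF W x hW := congrFun (dOp_smul_left _ W (G W) c) x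

variable (𝓢) in
/-- `L` induces a linear map on regular operators, which commutes with directional derivatives. -/
structure LinDiffOp (L : Operator d p n → Operator d p n') : Prop extends 𝓢.LinOp L where
  comm : ∀ {F G}, 𝓢.Reg F → 𝓢.Reg G → 𝓢.Equiv (dirDeriv (L F) G) (L (dirDeriv F G))

theorem LinDiffOp.comp {L : Operator d p n → Operator d p n'}
    {L' : Operator d p n' → Operator d p n''}
    (h' : 𝓢.LinDiffOp L') (h : 𝓢.LinDiffOp L) : 𝓢.LinDiffOp (fun F => L' (L F)) where
  toLinOp := h'.toLinOp.comp h.toLinOp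
  comm hF hG := (h'.comm (h.reg hF) hG).trans (h'.congr ((h.reg hF).dirDeriv hG) (h.comm hF hG))

theorem LinDiffOp.toLin_dirDeriv {L : Operator d p n → Operator d p n'} (h : 𝓢.LinDiffOp L)
    {G : Operator d p (Fin p)} (hG : 𝓢.Reg G) (a : 𝓢.RegOp n) :
    (linOp_dirDeriv hG).toLin (h.toLin a) = h.toLin ((linOp_dirDeriv hG).toLin a) := by
  rw [← cls_coe a, h.toLin_cls (regOp_reg a), LinOp.toLin_cls _ (h.reg (regOp_reg a)), LinOp.toLin_cls _ (regOp_reg a),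
    h.toLin_cls ((regOp_reg a).dirDeriv hG)]
  exact cls_congr (h.reg ((regOp_reg a).dirDeriv hG)) (h.comm (regOp_reg a) hG)

theorem linDiffOp_mulVec [Fintype n] (N : Matrix n' n ℝ) :
    𝓢.LinDiffOp (fun F : Operator d p n => fun W x => N *ᵥ F W x) where
  reg hF := hF.mulVec N
  congr hF h W x hW := by simp only [h W x hW]
  add hF hG W x hW := Matrix.mulVec_add _ _ _
  smul c hF W x hW := by simp only [Pi.smul_apply, Matrix.mulVec_smul]
  comm hF hG W x hW := hF.dOp_mulVec N hW (hG.smoothField hW)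

theorem linDiffOp_reindex (σ : n' → n) :
    𝓢.LinDiffOp (fun F : Operator d p n => fun W x i => F W x (σ i)) where
  reg hF := hF.reindex σ
  congr hF h W x hW := by simp only [h W x hW]
  add hF hG W x hW := rfl
  smul c hF W x hW := rfl
  comm hF hG W x hW := rfl

theorem linDiffOp_pair_zero :
    𝓢.LinDiffOp (fun F : Operator d p n => fun W x => Sum.elim (F W x) (0 : n' → ℝ)) where
  reg hF := hF.pair Reg.zero
  congr hF h W x hW := by simp only [h W x hW]
  add hF hG W x hW := by ext (k | k) <;> simp
  smul c hF W x hW := by ext (k | k) <;> simp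
  comm hF hG W x hW := by
    ext (k | k)
    · rfl
    · simp [dirDeriv]

theorem linDiffOp_zero_pair :
    𝓢.LinDiffOp (fun F : Operator d p n => fun W x => Sum.elim (0 : n' → ℝ) (F W x)) where
  reg hF := Reg.zero.pair hF
  congr hF h W x hW := by simp only [h W x hW]
  add hF hG W x hW := by ext (k | k) <;> simp
  smul c hF W x hW := by ext (k | k) <;> simp
  comm hF hG W x hW := by
    ext (k | k)
    · simp [dirDeriv]
    · rfl

theorem linDiffOp_advection : 𝓢.LinDiffOp (fun F W => 𝓢.advection (F W)) where
  reg hF := hF.advection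
  congr hF h W x hW := 𝓢.advection_congr (h.eventuallyEq hW)
  add hF hG W x hW := 𝓢.advection_add (hF.smoothField hW) (hG.smoothField hW)
  smul c hF W x hW := congrFun (𝓢.advection_smul c _) x
  comm hF hG W x hW := hF.dOp_advection hW (hG.smoothField hW)

theorem linDiffOp_advection_iterate (k : ℕ) :
    𝓢.LinDiffOp (fun F W => 𝓢.advection^[k] (F W)) := by
  induction k with
  | zero => exact linDiffOp_reindex (fun i => i)
  | succ k ih =>
    have := (linDiffOp_advection (𝓢 := 𝓢)).comp ih
    simpa only [Function.iterate_succ_apply'] using this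

/-- A block is an inclusion, followed by Λ ^ k and a projection, each of which is linear and
commutes with differentials; the other three blocks are treated alike. -/
theorem linDiffOp_blockA (k : ℕ) : 𝓢.LinDiffOp (fun F W => 𝓢.blockA k (F W)) :=
  (linDiffOp_reindex Sum.inl).comp ((linDiffOp_advection_iterate k).comp linDiffOp_pair_zero)

theorem linDiffOp_blockB (k : ℕ) : 𝓢.LinDiffOp (fun F W => 𝓢.blockB k (F W)) :=
  (linDiffOp_reindex Sum.inl).comp ((linDiffOp_advection_iterate k).comp linDiffOp_zero_pair)

theorem linDiffOp_blockC (k : ℕ) : 𝓢.LinDiffOp (fun F W => 𝓢.blockC k (F W)) :=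
  (linDiffOp_reindex Sum.inr).comp ((linDiffOp_advection_iterate k).comp linDiffOp_pair_zero)

theorem linDiffOp_blockD (k : ℕ) : 𝓢.LinDiffOp (fun F W => 𝓢.blockD k (F W)) :=
  (linDiffOp_reindex Sum.inr).comp ((linDiffOp_advection_iterate k).comp linDiffOp_zero_pair)

theorem linDiffOp_henon : 𝓢.LinDiffOp (fun F W => 𝓢.henon (F W)) :=
  linDiffOp_mulVec _

end Scheme

end LatticeBoltzmann

namespace LatticeBoltzmann

namespace Scheme

variable {d p r : ℕ} {n n' n'' : Type} (𝓢 : Scheme d p r)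

/-! ### The explicit operators are consistent with the scheme -/

/-- The operators `Γ₁, …, Γ₄`, extended by zero. -/
noncomputable def gammaSeq : ℕ → Operator d p (Fin p)
  | 1 => 𝓢.Gamma1
  | 2 => 𝓢.Gamma2
  | 3 => 𝓢.Gamma3
  | 4 => 𝓢.Gamma4
  | _ => 0

/-- The operators `Ψ₁, …, Ψ₃`, extended by zero. -/
noncomputable def psiSeq : ℕ → Operator d p (Fin r)
  | 1 => 𝓢.Psi1
  | 2 => 𝓢.Psi2
  | 3 => 𝓢.Psi3
  | _ => 0

theorem reg_Gamma1 : 𝓢.Reg 𝓢.Gamma1 :=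
  ((linDiffOp_blockA 1).reg Reg.id).add ((linDiffOp_blockB 1).reg Reg.equil)

theorem reg_Psi1 : 𝓢.Reg 𝓢.Psi1 :=
  (Reg.equil.dirDeriv 𝓢.reg_Gamma1).sub
    (((linDiffOp_blockC 1).reg Reg.id).add ((linDiffOp_blockD 1).reg Reg.equil))

theorem reg_Gamma2 : 𝓢.Reg 𝓢.Gamma2 :=
  (linDiffOp_blockB 1).reg (linDiffOp_henon.reg 𝓢.reg_Psi1)

theorem reg_Psi2 : 𝓢.Reg 𝓢.Psi2 :=
  ((linDiffOp_henon.reg (𝓢.reg_Psi1.dirDeriv 𝓢.reg_Gamma1)).add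
    (Reg.equil.dirDeriv 𝓢.reg_Gamma2)).sub
    ((linDiffOp_blockD 1).reg (linDiffOp_henon.reg 𝓢.reg_Psi1))

theorem reg_Gamma3 : 𝓢.Reg 𝓢.Gamma3 :=
  (((linDiffOp_blockB 1).reg (linDiffOp_henon.reg 𝓢.reg_Psi2)).sub
    (((linDiffOp_blockB 1).reg (𝓢.reg_Psi1.dirDeriv 𝓢.reg_Gamma1)).smul _)).add
    (((linDiffOp_blockB 2).reg 𝓢.reg_Psi1).smul _)

theorem reg_Psi3 : 𝓢.Reg 𝓢.Psi3 :=
  ((((((linDiffOp_henon.reg (𝓢.reg_Psi1.dirDeriv 𝓢.reg_Gamma2)).add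
    (Reg.equil.dirDeriv 𝓢.reg_Gamma3)).sub
    ((linDiffOp_blockD 1).reg (linDiffOp_henon.reg 𝓢.reg_Psi2))).add
    (linDiffOp_henon.reg (𝓢.reg_Psi2.dirDeriv 𝓢.reg_Gamma1))).add
    (((linDiffOp_blockD 1).reg (𝓢.reg_Psi1.dirDeriv 𝓢.reg_Gamma1)).smul _)).sub
    (((linDiffOp_blockD 2).reg 𝓢.reg_Psi1).smul _)).sub
    (((𝓢.reg_Psi1.dirDeriv 𝓢.reg_Gamma1).dirDeriv 𝓢.reg_Gamma1).smul _)

theorem reg_Gamma4 : 𝓢.Reg 𝓢.Gamma4 :=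
  (((((((linDiffOp_blockB 1).reg (linDiffOp_henon.reg 𝓢.reg_Psi3)).add
    (((linDiffOp_blockB 2).reg 𝓢.reg_Psi2).smul _)).add
    (((linDiffOp_blockB 1).reg ((linDiffOp_blockD 2).reg
      (linDiffOp_henon.reg 𝓢.reg_Psi1))).smul _)).sub
    (((linDiffOp_blockA 1).reg ((linDiffOp_blockB 1).reg 𝓢.reg_Psi2)).smul _)).sub
    (((linDiffOp_blockB 1).reg
      ((Reg.equil.dirDeriv 𝓢.reg_Gamma1).dirDeriv 𝓢.reg_Gamma2)).smul _)).sub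
    (((linDiffOp_blockB 1).reg
      ((Reg.equil.dirDeriv 𝓢.reg_Gamma2).dirDeriv 𝓢.reg_Gamma1)).smul _)).sub
    (((linDiffOp_blockB 1).reg (linDiffOp_henon.reg
      ((𝓢.reg_Psi1.dirDeriv 𝓢.reg_Gamma1).dirDeriv 𝓢.reg_Gamma1))).smul _)

theorem reg_gammaSeq : ∀ j, 𝓢.Reg (𝓢.gammaSeq j)
  | 0 => Reg.zero
  | 1 => 𝓢.reg_Gamma1
  | 2 => 𝓢.reg_Gamma2
  | 3 => 𝓢.reg_Gamma3
  | 4 => 𝓢.reg_Gamma4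
  | _ + 5 => Reg.zero

theorem reg_psiSeq : ∀ j, 𝓢.Reg (𝓢.psiSeq j)
  | 0 => Reg.zero
  | 1 => 𝓢.reg_Psi1
  | 2 => 𝓢.reg_Psi2
  | 3 => 𝓢.reg_Psi3
  | _ + 4 => Reg.zero

/-! ### Regularity of the formal series and their passage to classes -/

variable {𝓢}

theorem reg_serW : ∀ k, 𝓢.Reg (serW d p k)
  | 0 => Reg.id
  | _ + 1 => Reg.zero

theorem reg_serEquil : ∀ k, 𝓢.Reg (𝓢.serEquil k)
  | 0 => Reg.equil
  | _ + 1 => Reg.zero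

theorem reg_serY {P : ℕ → Operator d p (Fin r)} (hP : ∀ k, 𝓢.Reg (P k)) : ∀ k, 𝓢.Reg (𝓢.serY P k)
  | 0 => Reg.equil
  | k + 1 => (hP (k + 1)).mulVec _

theorem reg_serYstar {P : ℕ → Operator d p (Fin r)} (hP : ∀ k, 𝓢.Reg (P k)) (k : ℕ) :
    𝓢.Reg (𝓢.serYstar P k) :=
  (reg_serY hP k).add (((reg_serEquil k).sub (reg_serY hP k)).mulVec _)

theorem reg_serM {P : ℕ → Operator d p (Fin r)} (hP : ∀ k, 𝓢.Reg (P k)) (k : ℕ) :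
    𝓢.Reg (𝓢.serM P k) := (reg_serW k).pair (reg_serY hP k)

theorem reg_serMstar {P : ℕ → Operator d p (Fin r)} (hP : ∀ k, 𝓢.Reg (P k)) (k : ℕ) :
    𝓢.Reg (𝓢.serMstar P k) := (reg_serW k).pair (reg_serYstar hP k)

theorem reg_timeDeriv {V : ℕ → Operator d p (Fin p)} {F : ℕ → Operator d p n}
    (hV : ∀ k, 𝓢.Reg (V k)) (hF : ∀ k, 𝓢.Reg (F k)) (k : ℕ) : 𝓢.Reg (timeDeriv V F k) :=
  Reg.sum fun i _ => (hF i).dirDeriv (hV _)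

theorem reg_timeDeriv_iterate {V : ℕ → Operator d p (Fin p)} {F : ℕ → Operator d p n}
    (hV : ∀ k, 𝓢.Reg (V k)) (hF : ∀ k, 𝓢.Reg (F k)) (l k : ℕ) :
    𝓢.Reg ((timeDeriv V)^[l] F k) := by
  induction l generalizing k with
  | zero => exact hF k
  | succ l ih => rw [Function.iterate_succ_apply']; exact reg_timeDeriv hV ih k

/-- As a sum of operators rather than of fields, the residual can be treated term by term for
regularity and classes. -/
theorem residual_eq (τ : ℝ) (V : ℕ → Operator d p (Fin p)) (P : ℕ → Operator d p (Fin r)) (k : ℕ) :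
    𝓢.residual τ V P k =
      ∑ i ∈ Finset.range (k + 1), (τ ^ i / (i.factorial : ℝ)) •
        (timeDeriv V)^[i] (𝓢.serM P) (k - i)
      - ∑ i ∈ Finset.range (k + 1), ((-τ) ^ i / (i.factorial : ℝ)) •
        fun W => 𝓢.advection^[i] (𝓢.serMstar P (k - i) W) := by
  ext W x j
  simp [residual, Finset.sum_apply]

theorem reg_residual {V : ℕ → Operator d p (Fin p)} {P : ℕ → Operator d p (Fin r)}
    (hV : ∀ k, 𝓢.Reg (V k)) (hP : ∀ k, 𝓢.Reg (P k)) (τ : ℝ) (k : ℕ) :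
    𝓢.Reg (𝓢.residual τ V P k) := by
  rw [residual_eq]
  exact (Reg.sum fun i _ => (reg_timeDeriv_iterate hV (reg_serM hP) i (k - i)).smul _).sub
    (Reg.sum fun i _ => ((linDiffOp_advection_iterate i).reg (reg_serMstar hP (k - i))).smul _)

variable (𝓢) in
/-- The classes of the conserved and nonconserved components of an operator. -/
noncomputable def clsPair (F : Operator d p (Idx p r)) : 𝓢.RegOp (Fin p) × 𝓢.RegOp (Fin r) :=
  (𝓢.cls fun W x i => F W x (Sum.inl i), 𝓢.cls fun W x i => F W x (Sum.inr i))

variable (𝓢) in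
/-- The advection operator acting on classes. -/
noncomputable def advLin :
    𝓢.RegOp (Fin p) × 𝓢.RegOp (Fin r) →ₗ[ℝ] 𝓢.RegOp (Fin p) × 𝓢.RegOp (Fin r) :=
  LinearMap.prod
    ((linDiffOp_blockA 1).toLin.coprod (linDiffOp_blockB 1).toLin)
    ((linDiffOp_blockC 1).toLin.coprod (linDiffOp_blockD 1).toLin)

theorem clsPair_sum {ι : Type*} {s : Finset ι} {F : ι → Operator d p (Idx p r)}
    (h : ∀ i ∈ s, 𝓢.Reg (F i)) : 𝓢.clsPair (∑ i ∈ s, F i) = ∑ i ∈ s, 𝓢.clsPair (F i) := by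
  refine Prod.ext ?_ ?_
  · rw [Prod.fst_sum]
    simp only [clsPair]
    rw [← cls_sum fun i hi => (h i hi).reindex Sum.inl]
    congr 1; ext W x k; simp
  · rw [Prod.snd_sum]
    simp only [clsPair]
    rw [← cls_sum fun i hi => (h i hi).reindex Sum.inr]
    congr 1; ext W x k; simp

theorem clsPair_smul {F : Operator d p (Idx p r)} (h : 𝓢.Reg F) (c : ℝ) :
    𝓢.clsPair (c • F) = c • 𝓢.clsPair F :=
  Prod.ext (cls_smul (h.reindex Sum.inl) c) (cls_smul (h.reindex Sum.inr) c)

theorem clsPair_sub {F G : Operator d p (Idx p r)} (hF : 𝓢.Reg F) (hG : 𝓢.Reg G) :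
    𝓢.clsPair (F - G) = 𝓢.clsPair F - 𝓢.clsPair G :=
  Prod.ext (cls_sub (hF.reindex Sum.inl) (hG.reindex Sum.inl))
    (cls_sub (hF.reindex Sum.inr) (hG.reindex Sum.inr))

/-- Split F into (F₁, 0) + (0, F₂); additivity of Λ on smooth fields gives the block form. -/
theorem clsPair_advection {F : Operator d p (Idx p r)} (h : 𝓢.Reg F) :
    𝓢.clsPair (fun W => 𝓢.advection (F W)) = 𝓢.advLin (𝓢.clsPair F) := by
  have hl := h.reindex Sum.inl
  have hr := h.reindex Sum.inr
  have hsplit : F = (fun W x => Sum.elim (fun i => F W x (Sum.inl i)) (0 : Fin r → ℝ))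
      + fun W x => Sum.elim (0 : Fin p → ℝ) (fun i => F W x (Sum.inr i)) := by
    ext W x (k | k) <;> simp
  have hadd := linDiffOp_advection.add (𝓢 := 𝓢) (linDiffOp_pair_zero.reg hl)
    (linDiffOp_zero_pair.reg hr)
  rw [← hsplit] at hadd
  change _ = ((linDiffOp_blockA 1).toLin (𝓢.cls _) + (linDiffOp_blockB 1).toLin (𝓢.cls _),
    (linDiffOp_blockC 1).toLin (𝓢.cls _) + (linDiffOp_blockD 1).toLin (𝓢.cls _))
  rw [LinOp.toLin_cls _ hl, LinOp.toLin_cls _ hr, LinOp.toLin_cls _ hl, LinOp.toLin_cls _ hr,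
    ← cls_add ((linDiffOp_blockA 1).reg hl) ((linDiffOp_blockB 1).reg hr),
    ← cls_add ((linDiffOp_blockC 1).reg hl) ((linDiffOp_blockD 1).reg hr)]
  refine Prod.ext (cls_congr ?_ ?_) (cls_congr ?_ ?_)
  · exact ((linDiffOp_blockA 1).reg hl).add ((linDiffOp_blockB 1).reg hr)
  · exact fun W x hW => funext fun i => congrFun (hadd W x hW) (Sum.inl i)
  · exact ((linDiffOp_blockC 1).reg hl).add ((linDiffOp_blockD 1).reg hr)
  · exact fun W x hW => funext fun i => congrFun (hadd W x hW) (Sum.inr i)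

theorem clsPair_advection_iterate {F : Operator d p (Idx p r)} (h : 𝓢.Reg F) (k : ℕ) :
    𝓢.clsPair (fun W => 𝓢.advection^[k] (F W)) = (𝓢.advLin)^[k] (𝓢.clsPair F) := by
  induction k with
  | zero => rfl
  | succ k ih =>
    simp only [Function.iterate_succ_apply']
    rw [clsPair_advection ((linDiffOp_advection_iterate k).reg h), ih]

/-- The derivation in the direction `G`, acting on classes. -/
noncomputable def derivLin {G : Operator d p (Fin p)} (hG : 𝓢.Reg G) :
    𝓢.RegOp (Fin p) × 𝓢.RegOp (Fin r) →ₗ[ℝ] 𝓢.RegOp (Fin p) × 𝓢.RegOp (Fin r) :=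
  LinearMap.prodMap (linOp_dirDeriv hG).toLin (linOp_dirDeriv hG).toLin

theorem clsPair_dirDeriv {F : Operator d p (Idx p r)} {G : Operator d p (Fin p)} (h : 𝓢.Reg F)
    (hG : 𝓢.Reg G) : 𝓢.clsPair (dirDeriv F G) = derivLin hG (𝓢.clsPair F) :=
  Prod.ext ((linOp_dirDeriv hG).toLin_cls (h.reindex Sum.inl)).symm
    ((linOp_dirDeriv hG).toLin_cls (h.reindex Sum.inr)).symm

theorem clsPair_timeDeriv {V : ℕ → Operator d p (Fin p)} {F : ℕ → Operator d p (Idx p r)}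
    (hV : ∀ k, 𝓢.Reg (V k)) (hF : ∀ k, 𝓢.Reg (F k)) (k : ℕ) :
    𝓢.clsPair (timeDeriv V F k) =
      seriesDeriv (fun j => derivLin (hV j)) (fun k => 𝓢.clsPair (F k)) k := by
  rw [timeDeriv, clsPair_sum fun i _ => (hF i).dirDeriv (hV _)]
  exact Finset.sum_congr rfl fun i _ => clsPair_dirDeriv (hF i) (hV _)

theorem clsPair_timeDeriv_iterate {V : ℕ → Operator d p (Fin p)}
    {F : ℕ → Operator d p (Idx p r)} (hV : ∀ k, 𝓢.Reg (V k)) (hF : ∀ k, 𝓢.Reg (F k)) (l k : ℕ) :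
    𝓢.clsPair ((timeDeriv V)^[l] F k) =
      (seriesDeriv (fun j => derivLin (hV j)))^[l] (fun k => 𝓢.clsPair (F k)) k := by
  induction l generalizing k with
  | zero => rfl
  | succ l ih =>
    rw [Function.iterate_succ_apply', Function.iterate_succ_apply',
      clsPair_timeDeriv hV (reg_timeDeriv_iterate hV hF l)]
    congr 1
    exact funext ih

theorem clsPair_residual {V : ℕ → Operator d p (Fin p)} {P : ℕ → Operator d p (Fin r)}
    (hV : ∀ k, 𝓢.Reg (V k)) (hP : ∀ k, 𝓢.Reg (P k)) (k : ℕ) :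
    𝓢.clsPair (𝓢.residual 1 V P k) = seriesResidual (fun j => derivLin (hV j)) 𝓢.advLin
      (fun k => 𝓢.clsPair (𝓢.serM P k)) (fun k => 𝓢.clsPair (𝓢.serMstar P k)) k := by
  have h1 := fun i (_ : i ∈ Finset.range (k + 1)) =>
    (reg_timeDeriv_iterate hV (reg_serM hP) i (k - i)).smul (1 ^ i / (i.factorial : ℝ))
  have h2 := fun i (_ : i ∈ Finset.range (k + 1)) =>
      ((linDiffOp_advection_iterate i).reg (reg_serMstar hP (k - i))).smul
        ((-1) ^ i / (i.factorial : ℝ))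
  rw [residual_eq, clsPair_sub (Reg.sum h1) (Reg.sum h2), clsPair_sum h1, clsPair_sum h2, seriesResidual]
  congr 1
  · refine Finset.sum_congr rfl fun i _ => ?_
    rw [clsPair_smul (reg_timeDeriv_iterate hV (reg_serM hP) i (k - i)),
      clsPair_timeDeriv_iterate hV (reg_serM hP)]
  · refine Finset.sum_congr rfl fun i _ => ?_
    rw [clsPair_smul ((linDiffOp_advection_iterate i).reg (reg_serMstar hP (k - i))),
      clsPair_advection_iterate (reg_serMstar hP _)]

/-- This is S⁻¹ = Σ + I/2. -/
theorem cls_serY_succ {P : ℕ → Operator d p (Fin r)} (hP : ∀ k, 𝓢.Reg (P k)) (k : ℕ) :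
    𝓢.cls (𝓢.serY P (k + 1)) =
      linDiffOp_henon.toLin (𝓢.cls (P (k + 1))) + (1 / 2 : ℝ) • 𝓢.cls (P (k + 1)) := by
  rw [LinOp.toLin_cls _ (hP _), ← cls_smul (hP _), ← cls_add (linDiffOp_henon.reg (hP _))
    ((hP _).smul _)]
  congr 1
  ext W x i
  simp [serY, actSinv, henon, Matrix.sub_mulVec, Matrix.smul_mulVec]

/-- Beyond order zero Φ(W) contributes nothing, so relaxation sends S⁻¹P to S⁻¹P - P, and S⁻¹ - I =
Σ - I/2. -/
theorem cls_serYstar_succ {P : ℕ → Operator d p (Fin r)} (hP : ∀ k, 𝓢.Reg (P k)) (k : ℕ) :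
    𝓢.cls (𝓢.serYstar P (k + 1)) =
      linDiffOp_henon.toLin (𝓢.cls (P (k + 1))) - (1 / 2 : ℝ) • 𝓢.cls (P (k + 1)) := by
  have hS : 𝓢.S * 𝓢.S⁻¹ = 1 := Matrix.mul_nonsing_inv _ ((Matrix.isUnit_iff_isUnit_det _).1 𝓢.isUnit_S)
  rw [LinOp.toLin_cls _ (hP _), ← cls_smul (hP _), ← cls_sub (linDiffOp_henon.reg (hP _))
    ((hP _).smul _)]
  congr 1
  ext W x i
  simp [serYstar, serY, serEquil, actS, actSinv, henon, Matrix.sub_mulVec, Matrix.smul_mulVec,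
    Matrix.mulVec_neg, hS]
  ring

theorem cls_dirDeriv_id {G : Operator d p (Fin p)} (hG : 𝓢.Reg G) :
    (linOp_dirDeriv hG).toLin (𝓢.cls fun W => W) = 𝓢.cls G := by
  rw [LinOp.toLin_cls _ Reg.id]
  congr 1
  exact funext fun W => dOp_id W (G W)

/-- These are the second-column entries of the block product Λ · Λ, read off from Λ² applied to (0,
F). -/
theorem toLin_block_two {F : Operator d p (Fin r)} (hF : 𝓢.Reg F) :
    ((linDiffOp_blockB (𝓢 := 𝓢) 2).toLin (𝓢.cls F) = (linDiffOp_blockA 1).toLin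
      ((linDiffOp_blockB 1).toLin (𝓢.cls F)) +
        (linDiffOp_blockB 1).toLin ((linDiffOp_blockD 1).toLin (𝓢.cls F))) ∧
    ((linDiffOp_blockD (𝓢 := 𝓢) 2).toLin (𝓢.cls F) = (linDiffOp_blockC 1).toLin
      ((linDiffOp_blockB 1).toLin (𝓢.cls F)) +
        (linDiffOp_blockD 1).toLin ((linDiffOp_blockD 1).toLin (𝓢.cls F))) := by
  have h := clsPair_advection_iterate (linDiffOp_zero_pair (n' := Fin p) |>.reg hF) 2
  have h0 : 𝓢.clsPair (fun W x => Sum.elim (0 : Fin p → ℝ) (F W x)) = (0, 𝓢.cls F) :=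
    Prod.ext cls_zero rfl
  rw [h0] at h
  change _ = ((linDiffOp_blockA 1).toLin ((linDiffOp_blockA 1).toLin 0 +
      (linDiffOp_blockB 1).toLin (𝓢.cls F)) +
    (linDiffOp_blockB 1).toLin ((linDiffOp_blockC 1).toLin 0 +
      (linDiffOp_blockD 1).toLin (𝓢.cls F)),
    (linDiffOp_blockC 1).toLin ((linDiffOp_blockA 1).toLin 0 +
      (linDiffOp_blockB 1).toLin (𝓢.cls F)) +
    (linDiffOp_blockD 1).toLin ((linDiffOp_blockC 1).toLin 0 +
      (linDiffOp_blockD 1).toLin (𝓢.cls F))) at h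
  simp only [map_zero, zero_add] at h
  rw [LinOp.toLin_cls (linDiffOp_blockB 2).toLinOp hF,
    LinOp.toLin_cls (linDiffOp_blockD 2).toLinOp hF]
  exact ⟨congrArg Prod.fst h, congrArg Prod.snd h⟩

/-- Needed because ∂_t W = -Γ, whereas the formulas differentiate along +Γ. -/
theorem toLin_dirDeriv_neg {G : Operator d p (Fin p)} (hG : 𝓢.Reg G)
    (hG' : 𝓢.Reg fun W => - G W) (a : 𝓢.RegOp n) :
    (linOp_dirDeriv hG').toLin a = - (linOp_dirDeriv hG).toLin a := by
  change 𝓢.cls _ = - 𝓢.cls _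
  rw [← cls_neg ((regOp_reg a).dirDeriv hG)]
  congr 1
  refine funext fun W => ?_
  have := dOp_smul_right (a : Operator d p n) W (G W) (-1)
  rw [neg_one_smul, neg_one_smul] at this
  exact this

/-- The definitions of Γ and Ψ transported to classes, in the shape that the algebraic identity
takes as hypotheses. -/
theorem cls_explicit :
    𝓢.cls 𝓢.Gamma1 = (linDiffOp_blockA 1).toLin (𝓢.cls fun W => W)
      + (linDiffOp_blockB 1).toLin (𝓢.cls 𝓢.equil) ∧
    𝓢.cls 𝓢.Psi1 = (linOp_dirDeriv 𝓢.reg_Gamma1).toLin (𝓢.cls 𝓢.equil)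
      - ((linDiffOp_blockC 1).toLin (𝓢.cls fun W => W)
        + (linDiffOp_blockD 1).toLin (𝓢.cls 𝓢.equil)) ∧
    𝓢.cls 𝓢.Gamma2 = (linDiffOp_blockB 1).toLin (linDiffOp_henon.toLin (𝓢.cls 𝓢.Psi1)) ∧
    𝓢.cls 𝓢.Psi2 = linDiffOp_henon.toLin ((linOp_dirDeriv 𝓢.reg_Gamma1).toLin (𝓢.cls 𝓢.Psi1))
      + (linOp_dirDeriv 𝓢.reg_Gamma2).toLin (𝓢.cls 𝓢.equil)
      - (linDiffOp_blockD 1).toLin (linDiffOp_henon.toLin (𝓢.cls 𝓢.Psi1)) ∧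
    𝓢.cls 𝓢.Gamma3 = (linDiffOp_blockB 1).toLin (linDiffOp_henon.toLin (𝓢.cls 𝓢.Psi2))
      - (1 / 6 : ℝ) • (linDiffOp_blockB 1).toLin
        ((linOp_dirDeriv 𝓢.reg_Gamma1).toLin (𝓢.cls 𝓢.Psi1))
      + (1 / 12 : ℝ) • (linDiffOp_blockB 2).toLin (𝓢.cls 𝓢.Psi1) ∧
    𝓢.cls 𝓢.Psi3 = linDiffOp_henon.toLin ((linOp_dirDeriv 𝓢.reg_Gamma2).toLin (𝓢.cls 𝓢.Psi1))
      + (linOp_dirDeriv 𝓢.reg_Gamma3).toLin (𝓢.cls 𝓢.equil)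
      - (linDiffOp_blockD 1).toLin (linDiffOp_henon.toLin (𝓢.cls 𝓢.Psi2))
      + linDiffOp_henon.toLin ((linOp_dirDeriv 𝓢.reg_Gamma1).toLin (𝓢.cls 𝓢.Psi2))
      + (1 / 6 : ℝ) • (linDiffOp_blockD 1).toLin
        ((linOp_dirDeriv 𝓢.reg_Gamma1).toLin (𝓢.cls 𝓢.Psi1))
      - (1 / 12 : ℝ) • (linDiffOp_blockD 2).toLin (𝓢.cls 𝓢.Psi1)
      - (1 / 12 : ℝ) • (linOp_dirDeriv 𝓢.reg_Gamma1).toLin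
        ((linOp_dirDeriv 𝓢.reg_Gamma1).toLin (𝓢.cls 𝓢.Psi1)) ∧
    𝓢.cls 𝓢.Gamma4 = (linDiffOp_blockB 1).toLin (linDiffOp_henon.toLin (𝓢.cls 𝓢.Psi3))
      + (1 / 4 : ℝ) • (linDiffOp_blockB 2).toLin (𝓢.cls 𝓢.Psi2)
      + (1 / 6 : ℝ) • (linDiffOp_blockB 1).toLin
        ((linDiffOp_blockD 2).toLin (linDiffOp_henon.toLin (𝓢.cls 𝓢.Psi1)))
      - (1 / 6 : ℝ) • (linDiffOp_blockA 1).toLin ((linDiffOp_blockB 1).toLin (𝓢.cls 𝓢.Psi2))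
      - (1 / 6 : ℝ) • (linDiffOp_blockB 1).toLin ((linOp_dirDeriv 𝓢.reg_Gamma2).toLin
        ((linOp_dirDeriv 𝓢.reg_Gamma1).toLin (𝓢.cls 𝓢.equil)))
      - (1 / 6 : ℝ) • (linDiffOp_blockB 1).toLin ((linOp_dirDeriv 𝓢.reg_Gamma1).toLin
        ((linOp_dirDeriv 𝓢.reg_Gamma2).toLin (𝓢.cls 𝓢.equil)))
      - (1 / 6 : ℝ) • (linDiffOp_blockB 1).toLin (linDiffOp_henon.toLin
        ((linOp_dirDeriv 𝓢.reg_Gamma1).toLin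
          ((linOp_dirDeriv 𝓢.reg_Gamma1).toLin (𝓢.cls 𝓢.Psi1)))) := by
  let opA : Operator d p (Fin p) → Operator d p (Fin p) := fun F W => 𝓢.blockA 1 (F W)
  let opB (k : ℕ) : Operator d p (Fin r) → Operator d p (Fin p) := fun F W => 𝓢.blockB k (F W)
  let opC : Operator d p (Fin p) → Operator d p (Fin r) := fun F W => 𝓢.blockC 1 (F W)
  let opD (k : ℕ) : Operator d p (Fin r) → Operator d p (Fin r) := fun F W => 𝓢.blockD k (F W)
  let opH : Operator d p (Fin r) → Operator d p (Fin r) := fun F W => 𝓢.henon (F W)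
  have rA : ∀ F, 𝓢.Reg F → 𝓢.Reg (opA F) := fun F h => (linDiffOp_blockA 1).reg h
  have rB : ∀ k F, 𝓢.Reg F → 𝓢.Reg (opB k F) := fun k F h => (linDiffOp_blockB k).reg h
  have rC : ∀ F, 𝓢.Reg F → 𝓢.Reg (opC F) := fun F h => (linDiffOp_blockC 1).reg h
  have rD : ∀ k F, 𝓢.Reg F → 𝓢.Reg (opD k F) := fun k F h => (linDiffOp_blockD k).reg h
  have rH : ∀ F, 𝓢.Reg F → 𝓢.Reg (opH F) := fun F h => linDiffOp_henon.reg h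
  have cA : ∀ F, 𝓢.Reg F → (linDiffOp_blockA 1).toLin (𝓢.cls F) = 𝓢.cls (opA F) :=
    fun F h => LinOp.toLin_cls _ h
  have cB : ∀ k F, 𝓢.Reg F → (linDiffOp_blockB k).toLin (𝓢.cls F) = 𝓢.cls (opB k F) :=
    fun k F h => LinOp.toLin_cls _ h
  have cC : ∀ F, 𝓢.Reg F → (linDiffOp_blockC 1).toLin (𝓢.cls F) = 𝓢.cls (opC F) :=
    fun F h => LinOp.toLin_cls _ h
  have cD : ∀ k F, 𝓢.Reg F → (linDiffOp_blockD k).toLin (𝓢.cls F) = 𝓢.cls (opD k F) :=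
    fun k F h => LinOp.toLin_cls _ h
  have cH : ∀ F, 𝓢.Reg F → linDiffOp_henon.toLin (𝓢.cls F) = 𝓢.cls (opH F) :=
    fun F h => LinOp.toLin_cls _ h
  have cG : ∀ (F : Operator d p (Fin r)) G (hG : 𝓢.Reg G), 𝓢.Reg F →
    (linOp_dirDeriv hG).toLin (𝓢.cls F) = 𝓢.cls (dirDeriv F G) :=
    fun F G hG h => LinOp.toLin_cls _ h
  have rG : ∀ (F : Operator d p (Fin r)) G, 𝓢.Reg F → 𝓢.Reg G → 𝓢.Reg (dirDeriv F G) :=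
    fun F G h hG => h.dirDeriv hG
  have rI : 𝓢.Reg (fun W => W) := Reg.id
  have rE := Reg.equil (𝓢 := 𝓢)
  have radd : ∀ (m : Type) (F G : Operator d p m), 𝓢.Reg F → 𝓢.Reg G → 𝓢.Reg (F + G) :=
    fun m F G h h' => h.add h'
  have rsub : ∀ (m : Type) (F G : Operator d p m), 𝓢.Reg F → 𝓢.Reg G → 𝓢.Reg (F - G) :=
    fun m F G h h' => h.sub h'
  have rsmul : ∀ (m : Type) (F : Operator d p m) (c : ℝ), 𝓢.Reg F → 𝓢.Reg (c • F) :=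
    fun m F c h => h.smul c
  have g1 := 𝓢.reg_Gamma1
  have g2 := 𝓢.reg_Gamma2
  have g3 := 𝓢.reg_Gamma3
  have p1 := 𝓢.reg_Psi1
  have p2 := 𝓢.reg_Psi2
  have p3 := 𝓢.reg_Psi3
  refine ⟨?_, ?_, ?_, ?_, ?_, ?_, ?_⟩ <;>
  simp (maxDischargeDepth := 20) only [cA, cB, cC, cD, cH, cG, rA, rB, rC, rD, rH, rG, rI, rE, g1, g2, g3, p1, p2, p3,
    radd, rsub, rsmul, ← cls_add, ← cls_sub, ← cls_smul] <;> rfl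

variable (𝓢) in
-- Existence: the residuals have zero class by the algebraic identity, and a regular operator of
-- zero class vanishes on admissible fields. This solution is also the reference for uniqueness.
theorem isTaylor_gammaSeq : 𝓢.IsTaylor 𝓢.gammaSeq 𝓢.psiSeq := by
  have hV : ∀ j, 𝓢.Reg (fun W => -𝓢.gammaSeq (j + 1) W) := fun j => (𝓢.reg_gammaSeq _).neg
  have hP := 𝓢.reg_psiSeq
  have hres := clsPair_residual hV hP
  have hid : 𝓢.Reg (fun W => W) := Reg.id
  have heq := Reg.equil (𝓢 := 𝓢)
  have hstar0 : 𝓢.serYstar 𝓢.psiSeq 0 = 𝓢.equil := by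
    ext W x i; simp [serYstar, serY, serEquil, actS]
  obtain ⟨e1, e2, e3, e4, e5, e6, e7⟩ := cls_explicit (𝓢 := 𝓢)
  rw [(toLin_block_two 𝓢.reg_Psi1).1] at e5
  rw [(toLin_block_two 𝓢.reg_Psi1).2] at e6
  -- In Γ₄ the block D₂ acts on ΣΨ₁, which must be seen as the class of a single operator before D₂
  -- is expanded.
  rw [(toLin_block_two 𝓢.reg_Psi2).1, LinOp.toLin_cls linDiffOp_henon.toLinOp 𝓢.reg_Psi1,
    (toLin_block_two (linDiffOp_henon.reg 𝓢.reg_Psi1)).2,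
    ← LinOp.toLin_cls linDiffOp_henon.toLinOp 𝓢.reg_Psi1] at e7
  have key := seriesResidual_eq_zero
    (linDiffOp_blockA 1).toLin (linDiffOp_blockB 1).toLin (linDiffOp_blockC 1).toLin
    (linDiffOp_blockD 1).toLin linDiffOp_henon.toLin
    (fun j => (linOp_dirDeriv (𝓢.reg_gammaSeq (j + 1))).toLin)
    (fun j => (linOp_dirDeriv (𝓢.reg_gammaSeq (j + 1))).toLin)
    (fun j x => (linDiffOp_blockA 1).toLin_dirDeriv (𝓢.reg_gammaSeq (j + 1)) x)
    (fun j x => (linDiffOp_blockB 1).toLin_dirDeriv (𝓢.reg_gammaSeq (j + 1)) x)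
    (fun j x => (linDiffOp_blockC 1).toLin_dirDeriv (𝓢.reg_gammaSeq (j + 1)) x)
    (fun j x => (linDiffOp_blockD 1).toLin_dirDeriv (𝓢.reg_gammaSeq (j + 1)) x)
    (fun j x => linDiffOp_henon.toLin_dirDeriv (𝓢.reg_gammaSeq (j + 1)) x)
    (𝓢.cls fun W => W) (𝓢.cls 𝓢.Gamma1) (𝓢.cls 𝓢.Gamma2) (𝓢.cls 𝓢.Gamma3) (𝓢.cls 𝓢.Gamma4)
    (𝓢.cls 𝓢.equil) (𝓢.cls 𝓢.Psi1) (𝓢.cls 𝓢.Psi2) (𝓢.cls 𝓢.Psi3)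
    (cls_dirDeriv_id 𝓢.reg_Gamma1) (cls_dirDeriv_id 𝓢.reg_Gamma2) (cls_dirDeriv_id 𝓢.reg_Gamma3)
    (cls_dirDeriv_id 𝓢.reg_Gamma4)
    e1 e2 e3 e4 e5 e6 e7
    𝓢.advLin (fun u => rfl) (fun j => derivLin (hV j))
    (fun j u => Prod.ext (toLin_dirDeriv_neg (𝓢.reg_gammaSeq (j + 1)) (hV j) u.1)
      (toLin_dirDeriv_neg (𝓢.reg_gammaSeq (j + 1)) (hV j) u.2))
    (fun k => 𝓢.clsPair (𝓢.serM 𝓢.psiSeq k)) (fun k => 𝓢.clsPair (𝓢.serMstar 𝓢.psiSeq k))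
    rfl (Prod.ext cls_zero (cls_serY_succ hP 0)) (Prod.ext cls_zero (cls_serY_succ hP 1))
    (Prod.ext cls_zero (cls_serY_succ hP 2)) cls_zero
    (Prod.ext rfl (congrArg 𝓢.cls hstar0)) (Prod.ext cls_zero (cls_serYstar_succ hP 0))
    (Prod.ext cls_zero (cls_serYstar_succ hP 1)) (Prod.ext cls_zero (cls_serYstar_succ hP 2))
    cls_zero
  intro W x hW
  have hz : ∀ {m : Type} {F : Operator d p m}, 𝓢.Reg F → 𝓢.cls F = 0 → F W x = 0 := by
    intro m F hF h0
    rw [equiv_cls hF W x hW, h0]; rfl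
  refine ⟨fun k hk i => ?_, fun k hk i => ?_⟩
  · have h := key.1 k hk
    rw [← hres] at h
    exact congrFun (hz ((reg_residual hV hP 1 k).reindex Sum.inl) h) i
  · have h := key.2 k hk
    rw [← hres] at h
    exact congrFun (hz ((reg_residual hV hP 1 k).reindex Sum.inr) h) i

end Scheme

end LatticeBoltzmann

namespace LatticeBoltzmann

/-! ### Rescaling of the small parameter -/

/-- The action on series is graded: the indices of F and V add up to k, and so do the powers of τ.
-/
theorem timeDeriv_pow_smul {d p : ℕ} {n : Type} (τ : ℝ) (V : ℕ → Operator d p (Fin p))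
    (F : ℕ → Operator d p n) (k : ℕ) :
    timeDeriv (fun j => τ ^ j • V j) (fun j => τ ^ j • F j) k = τ ^ k • timeDeriv V F k := by
  simp only [timeDeriv, Finset.smul_sum]
  refine Finset.sum_congr rfl fun i hi => funext fun W => ?_
  rw [dirDeriv_eq_dOp, Pi.smul_apply, dOp_smul_left, dOp_smul_right, smul_smul, ← pow_add,
    Nat.add_sub_cancel' (by simpa [Nat.lt_succ_iff] using hi)]
  rfl

theorem timeDeriv_iterate_pow_smul {d p : ℕ} {n : Type} (τ : ℝ) (V : ℕ → Operator d p (Fin p))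
    (F : ℕ → Operator d p n) (l : ℕ) :
    (timeDeriv (fun j => τ ^ j • V j))^[l] (fun j => τ ^ j • F j) =
      fun k => τ ^ k • (timeDeriv V)^[l] F k := by
  induction l with
  | zero => rfl
  | succ l ih =>
    rw [Function.iterate_succ_apply', ih, Function.iterate_succ_apply']
    exact funext fun k => timeDeriv_pow_smul τ V _ k

namespace Scheme

variable {d p r : ℕ} {n : Type} (𝓢 : Scheme d p r)

theorem advection_iterate_smul (c : ℝ) (u : VField d (Idx p r)) (k : ℕ) :
    𝓢.advection^[k] (c • u) = c • 𝓢.advection^[k] u := by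
  induction k with
  | zero => rfl
  | succ k ih => rw [Function.iterate_succ_apply', ih, advection_smul, Function.iterate_succ_apply']

theorem serY_pow_smul (τ : ℝ) (P : ℕ → Operator d p (Fin r)) (k : ℕ) :
    𝓢.serY (fun j => τ ^ j • P j) k = τ ^ k • 𝓢.serY P k := by
  cases k with
  | zero => simp [serY]
  | succ k =>
    ext W x i
    simp [serY, actSinv, Matrix.mulVec_smul]

theorem serEquil_pow_smul (τ : ℝ) (k : ℕ) : 𝓢.serEquil k = τ ^ k • 𝓢.serEquil k := by
  cases k <;> simp [serEquil]

theorem serW_pow_smul (τ : ℝ) (k : ℕ) : serW d p k = τ ^ k • serW d p k := by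
  cases k <;> simp [serW]

theorem serM_pow_smul (τ : ℝ) (P : ℕ → Operator d p (Fin r)) (k : ℕ) :
    𝓢.serM (fun j => τ ^ j • P j) k = τ ^ k • 𝓢.serM P k := by
  ext W x (i | i)
  · exact congrFun (congrFun (congrFun (serW_pow_smul τ k) W) x) i
  · exact congrFun (congrFun (congrFun (𝓢.serY_pow_smul τ P k) W) x) i

theorem serYstar_pow_smul (τ : ℝ) (P : ℕ → Operator d p (Fin r)) (k : ℕ) :
    𝓢.serYstar (fun j => τ ^ j • P j) k = τ ^ k • 𝓢.serYstar P k := by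
  ext W x i
  rw [serYstar, serY_pow_smul, serEquil_pow_smul 𝓢 τ k]
  simp only [Pi.smul_apply, actS, serYstar, Pi.add_apply, Pi.sub_apply, ← smul_sub,
    Matrix.mulVec_smul, ← smul_add]

theorem serMstar_pow_smul (τ : ℝ) (P : ℕ → Operator d p (Fin r)) (k : ℕ) :
    𝓢.serMstar (fun j => τ ^ j • P j) k = τ ^ k • 𝓢.serMstar P k := by
  ext W x (i | i)
  · exact congrFun (congrFun (congrFun (serW_pow_smul τ k) W) x) i
  · exact congrFun (congrFun (congrFun (𝓢.serYstar_pow_smul τ P k) W) x) i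

/-- This is the substitution of ετ for ε: the exponential supplies τ ^ i and the coefficient of
index k - i supplies the rest. -/
theorem residual_pow_smul (τ : ℝ) (V : ℕ → Operator d p (Fin p)) (P : ℕ → Operator d p (Fin r))
    (k : ℕ) :
    𝓢.residual τ (fun j => τ ^ j • V j) (fun j => τ ^ j • P j) k = τ ^ k • 𝓢.residual 1 V P k := by
  rw [residual_eq, residual_eq, smul_sub, Finset.smul_sum, Finset.smul_sum]
  have hM : 𝓢.serM (fun j => τ ^ j • P j) = fun k => τ ^ k • 𝓢.serM P k :=
    funext fun k => 𝓢.serM_pow_smul τ P k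
  congr 1
  · refine Finset.sum_congr rfl fun i hi => ?_
    have hik : i + (k - i) = k := Nat.add_sub_cancel' (by simpa [Nat.lt_succ_iff] using hi)
    rw [hM, timeDeriv_iterate_pow_smul, smul_smul, smul_smul]
    congr 1
    conv_rhs => rw [← hik, pow_add]
    simp only [one_pow]
    ring
  · refine Finset.sum_congr rfl fun i hi => funext fun W => ?_
    have hik : i + (k - i) = k := Nat.add_sub_cancel' (by simpa [Nat.lt_succ_iff] using hi)
    simp only [Pi.smul_apply]
    rw [serMstar_pow_smul, Pi.smul_apply, advection_iterate_smul, smul_smul, smul_smul]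
    congr 1
    conv_rhs => rw [← hik, pow_add]
    simp only [neg_pow τ]
    ring

theorem isChapmanEnskog_iff {τ : ℝ} (hτ : 0 < τ) (Γ : ℕ → Operator d p (Fin p))
    (Ψ : ℕ → Operator d p (Fin r)) : 𝓢.IsChapmanEnskog τ Γ Ψ ↔ 𝓢.IsTaylor Γ Ψ := by
  have hV : (fun (j : ℕ) (W : VField d (Fin p)) => -(τ ^ j • Γ (j + 1) W)) =
      fun j => τ ^ j • fun W => -Γ (j + 1) W := by
    ext j W x i; simp
  have hP : (fun (j : ℕ) (W : VField d (Fin p)) => τ ^ j • Ψ j W) = fun j => τ ^ j • Ψ j := rfl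
  rw [IsChapmanEnskog, IsTaylor, hV, hP]
  simp only [IsConsistent, residual_pow_smul, Pi.smul_apply, smul_eq_mul, mul_eq_zero,
    (pow_pos hτ _).ne', false_or]

/-! ### Uniqueness of consistent expansions -/

variable {𝓢}

/-- Coefficients up to m involve only coefficients up to m. Regularity is asked on one side only, so
a regular expansion can be compared with an arbitrary one. -/
theorem timeDeriv_iterate_congr {V V' : ℕ → Operator d p (Fin p)} (hV : ∀ k, 𝓢.Reg (V k)) (m : ℕ)
    (hVV : ∀ i ≤ m, 𝓢.Equiv (V i) (V' i)) (l : ℕ) : ∀ {F F' : ℕ → Operator d p n},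
    (∀ k, 𝓢.Reg (F k)) → (∀ i ≤ m, 𝓢.Equiv (F i) (F' i)) →
    ∀ i ≤ m, 𝓢.Equiv ((timeDeriv V)^[l] F i) ((timeDeriv V')^[l] F' i) := by
  induction l with
  | zero => exact fun _ h => h
  | succ l ih =>
    intro F F' hF hFF
    refine ih (reg_timeDeriv hV hF) fun i hi => ?_
    exact Equiv.sum fun j hj => Equiv.dirDeriv (hF j) (hV _)
      (hFF j ((Nat.lt_succ_iff.1 (Finset.mem_range.1 hj)).trans hi)) (hVV _ (by omega))

theorem serY_congr {P P' : ℕ → Operator d p (Fin r)} {m : ℕ}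
    (h : ∀ i, 0 < i → i ≤ m → 𝓢.Equiv (P i) (P' i)) :
    ∀ i ≤ m, 𝓢.Equiv (𝓢.serY P i) (𝓢.serY P' i)
  | 0, _ => Equiv.refl _
  | i + 1, hi => fun W x hW => by
    simp only [serY, actSinv, h (i + 1) (by omega) hi W x hW]

theorem serM_congr {P P' : ℕ → Operator d p (Fin r)} {m : ℕ}
    (h : ∀ i, 0 < i → i ≤ m → 𝓢.Equiv (P i) (P' i)) (i : ℕ) (hi : i ≤ m) :
    𝓢.Equiv (𝓢.serM P i) (𝓢.serM P' i) := fun W x hW => by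
  simp only [serM, serY_congr h i hi W x hW]

theorem serMstar_congr {P P' : ℕ → Operator d p (Fin r)} {m : ℕ}
    (h : ∀ i, 0 < i → i ≤ m → 𝓢.Equiv (P i) (P' i)) (i : ℕ) (hi : i ≤ m) :
    𝓢.Equiv (𝓢.serMstar P i) (𝓢.serMstar P' i) := fun W x hW => by
  simp only [serMstar, serYstar, Pi.add_apply, Pi.sub_apply, actS, serY_congr h i hi W x hW]

/-- The conserved part of m is W, without corrections, so only the differential of the identity
along V m remains. -/
theorem timeDeriv_serM_inl (V : ℕ → Operator d p (Fin p)) (P : ℕ → Operator d p (Fin r)) (m : ℕ)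
    (W : VField d (Fin p)) (x : Space d) (i : Fin p) :
    timeDeriv V (𝓢.serM P) m W x (Sum.inl i) = V m W x i := by
  simp only [timeDeriv, Finset.sum_apply]
  rw [Finset.sum_range_succ', Finset.sum_eq_zero, zero_add]
  · exact congrFun (congrFun (dOp_id W (V m W)) x) i
  · intro k _
    exact congrFun (congrFun (dOp_zero (n := Fin p) W (V (m - (k + 1)) W)) x) i

/-- Each coefficient of the residual determines the next term of the expansion of `∂_t W`. -/
theorem residual_succ_inl (V : ℕ → Operator d p (Fin p)) (P : ℕ → Operator d p (Fin r)) (m : ℕ)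
    (W : VField d (Fin p)) (x : Space d) (i : Fin p) :
    𝓢.residual 1 V P (m + 1) W x (Sum.inl i) = V m W x i +
      (∑ k ∈ Finset.range m, (1 ^ (k + 2) / ((k + 2).factorial : ℝ)) *
          (timeDeriv V)^[k + 2] (𝓢.serM P) (m + 1 - (k + 2)) W x (Sum.inl i)
        - ∑ k ∈ Finset.range (m + 1), ((-1) ^ (k + 1) / ((k + 1).factorial : ℝ)) *
          𝓢.advection^[k + 1] (𝓢.serMstar P (m + 1 - (k + 1)) W) x (Sum.inl i)) := by
  rw [residual_eq]
  simp only [Pi.sub_apply, Finset.sum_apply, Pi.smul_apply, smul_eq_mul]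
  rw [Finset.sum_range_succ' _ (m + 1), Finset.sum_range_succ' _ m,
    Finset.sum_range_succ' _ (m + 1)]
  have h0 : (timeDeriv V)^[0] (𝓢.serM P) (m + 1 - 0) W x (Sum.inl i) = 0 := rfl
  have h0' : 𝓢.advection^[0] (𝓢.serMstar P (m + 1 - 0) W) x (Sum.inl i) = 0 := rfl
  have h1 : (timeDeriv V)^[0 + 1] (𝓢.serM P) (m + 1 - (0 + 1)) W x (Sum.inl i) = V m W x i :=
    timeDeriv_serM_inl V P m W x i
  rw [h0, h0', h1]
  simp only [add_assoc, Nat.reduceAdd, Nat.factorial]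
  norm_num
  ring

/-- Each coefficient of the residual determines the next term of the expansion of `Y`. -/
theorem residual_succ_inr (V : ℕ → Operator d p (Fin p)) (P : ℕ → Operator d p (Fin r)) (m : ℕ)
    (W : VField d (Fin p)) (x : Space d) (i : Fin r) :
    𝓢.residual 1 V P (m + 1) W x (Sum.inr i) = P (m + 1) W x i +
      (∑ k ∈ Finset.range (m + 1), (1 ^ (k + 1) / ((k + 1).factorial : ℝ)) *
          (timeDeriv V)^[k + 1] (𝓢.serM P) (m + 1 - (k + 1)) W x (Sum.inr i)
        - ∑ k ∈ Finset.range (m + 1), ((-1) ^ (k + 1) / ((k + 1).factorial : ℝ)) *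
          𝓢.advection^[k + 1] (𝓢.serMstar P (m + 1 - (k + 1)) W) x (Sum.inr i)) := by
  rw [residual_eq]
  simp only [Pi.sub_apply, Finset.sum_apply, Pi.smul_apply, smul_eq_mul]
  rw [Finset.sum_range_succ' _ (m + 1), Finset.sum_range_succ' _ (m + 1)]
  have h0 : (timeDeriv V)^[0] (𝓢.serM P) (m + 1 - 0) W x (Sum.inr i) =
      𝓢.serY P (m + 1) W x i := rfl
  -- Relaxation subtracts S(S⁻¹P) = P; this is how P (m + 1) itself enters the residual.
  have h0' : 𝓢.advection^[0] (𝓢.serMstar P (m + 1 - 0) W) x (Sum.inr i) =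
      𝓢.serY P (m + 1) W x i - P (m + 1) W x i := by
    have hS : 𝓢.S * 𝓢.S⁻¹ = 1 :=
      Matrix.mul_nonsing_inv _ ((Matrix.isUnit_iff_isUnit_det _).1 𝓢.isUnit_S)
    simp [serMstar, serYstar, serEquil, serY, actS, actSinv, Matrix.mulVec_neg, hS, sub_eq_add_neg]
  rw [h0, h0']
  simp only [Nat.factorial]
  norm_num
  ring

theorem residual_zero (V : ℕ → Operator d p (Fin p)) (P : ℕ → Operator d p (Fin r)) :
    𝓢.residual 1 V P 0 = 0 := by
  ext W x (i | i) <;>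
  simp [residual, serM, serMstar, serYstar, serY, serEquil, actS]

section Uniqueness

variable {V V' : ℕ → Operator d p (Fin p)} {P P' : ℕ → Operator d p (Fin r)}

/-- Apart from V m, the time terms contain at least two time derivatives and hence see only V i with
i < m, while the advection terms see P up to m. -/
theorem residual_inl_sub (hV : ∀ k, 𝓢.Reg (V k)) (hP : ∀ k, 𝓢.Reg (P k)) (m : ℕ)
    (hVV : ∀ i < m, 𝓢.Equiv (V i) (V' i)) (hPP : ∀ i, 0 < i → i ≤ m → 𝓢.Equiv (P i) (P' i))
    {W : VField d (Fin p)} {x : Space d} (hW : 𝓢.AdmissibleAt W x) (i : Fin p) :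
    𝓢.residual 1 V P (m + 1) W x (Sum.inl i) - V m W x i =
      𝓢.residual 1 V' P' (m + 1) W x (Sum.inl i) - V' m W x i := by
  rw [residual_succ_inl, residual_succ_inl, add_sub_cancel_left, add_sub_cancel_left]
  congr 1
  · refine Finset.sum_congr rfl fun k hk => ?_
    have hk := Finset.mem_range.1 hk
    rw [timeDeriv_iterate_congr hV (m + 1 - (k + 2)) (fun i hi => hVV i (by omega)) _
      (reg_serM hP) (serM_congr fun i h0 hi => hPP i h0 (by omega)) _ le_rfl W x hW]
  · refine Finset.sum_congr rfl fun k hk => ?_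
    exact congrArg (fun v : Idx p r → ℝ => _ * v (Sum.inl i))
      ((linDiffOp_advection_iterate (k + 1)).congr (reg_serMstar hP _)
        (serMstar_congr (fun i h0 hi => hPP i h0 (by omega)) (m + 1 - (k + 1)) le_rfl) W x hW)

/-- Here V m does occur, through dΦ.V m, so V m has to be identified before P (m + 1). -/
theorem residual_inr_sub (hV : ∀ k, 𝓢.Reg (V k)) (hP : ∀ k, 𝓢.Reg (P k)) (m : ℕ)
    (hVV : ∀ i ≤ m, 𝓢.Equiv (V i) (V' i)) (hPP : ∀ i, 0 < i → i ≤ m → 𝓢.Equiv (P i) (P' i))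
    {W : VField d (Fin p)} {x : Space d} (hW : 𝓢.AdmissibleAt W x) (i : Fin r) :
    𝓢.residual 1 V P (m + 1) W x (Sum.inr i) - P (m + 1) W x i =
      𝓢.residual 1 V' P' (m + 1) W x (Sum.inr i) - P' (m + 1) W x i := by
  rw [residual_succ_inr, residual_succ_inr, add_sub_cancel_left, add_sub_cancel_left]
  congr 1
  · refine Finset.sum_congr rfl fun k hk => ?_
    rw [timeDeriv_iterate_congr hV (m + 1 - (k + 1)) (fun i hi => hVV i (by omega)) _
      (reg_serM hP) (serM_congr fun i h0 hi => hPP i h0 (by omega)) _ le_rfl W x hW]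
  · refine Finset.sum_congr rfl fun k hk => ?_
    exact congrArg (fun v : Idx p r → ℝ => _ * v (Sum.inr i))
      ((linDiffOp_advection_iterate (k + 1)).congr (reg_serMstar hP _)
        (serMstar_congr (fun i h0 hi => hPP i h0 (by omega)) (m + 1 - (k + 1)) le_rfl) W x hW)

/-- The system is triangular in the order V 0, P 1, V 1, P 2, …, V 3. Subtracting two vanishing
residuals identifies one unknown at a time; conversely, equal unknowns give equal residuals. Only
the reference solution has to be regular. -/
theorem isConsistent_iff (hV : ∀ k, 𝓢.Reg (V k)) (hP : ∀ k, 𝓢.Reg (P k))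
    (h : 𝓢.IsConsistent 1 V P) :
    𝓢.IsConsistent 1 V' P' ↔
      (∀ i < 4, 𝓢.Equiv (V i) (V' i)) ∧ ∀ i, 0 < i → i ≤ 3 → 𝓢.Equiv (P i) (P' i) := by
  constructor
  · intro h'
    -- The bound i ≤ 3 is kept apart because no tested equation determines P 4.
    have key : ∀ m ≤ 4, (∀ i < m, 𝓢.Equiv (V i) (V' i)) ∧
        ∀ i, 0 < i → i ≤ m → i ≤ 3 → 𝓢.Equiv (P i) (P' i) := by
      intro m
      induction m with
      | zero => exact fun _ => ⟨fun i hi => by omega, fun i h0 hi => by omega⟩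
      | succ m ih =>
        intro hm
        obtain ⟨ihV, ihP⟩ := ih (by omega)
        have hVm : 𝓢.Equiv (V m) (V' m) := fun W x hW => funext fun i => by
          have := residual_inl_sub hV hP m ihV (fun i h0 hi => ihP i h0 hi (by omega)) hW i
          rw [(h W x hW).1 _ hm, (h' W x hW).1 _ hm] at this
          linarith
        have hVV : ∀ i < m + 1, 𝓢.Equiv (V i) (V' i) := fun i hi => by
          rcases Nat.lt_succ_iff_lt_or_eq.1 hi with hi | rfl
          · exact ihV i hi
          · exact hVm
        refine ⟨hVV, fun i h0 hi h3 => ?_⟩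
        rcases Nat.le_succ_iff.1 hi with hi | rfl
        · exact ihP i h0 hi h3
        · intro W x hW
          funext i
          have := residual_inr_sub hV hP m (fun i hi => hVV i (by omega))
            (fun i h0 hi => ihP i h0 hi (by omega)) hW i
          rw [(h W x hW).2 _ h3, (h' W x hW).2 _ h3] at this
          linarith
    exact ⟨(key 4 le_rfl).1, fun i h0 hi => (key 4 le_rfl).2 i h0 (by omega) hi⟩
  · rintro ⟨hVV, hPP⟩ W x hW
    refine ⟨fun m hm i => ?_, fun m hm i => ?_⟩
    · cases m with
      | zero => rw [residual_zero]; rfl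
      | succ m =>
        have := residual_inl_sub hV hP m (fun i hi => hVV i (by omega))
          (fun i h0 hi => hPP i h0 (by omega)) hW i
        rw [(h W x hW).1 _ hm, hVV m (by omega) W x hW] at this
        linarith
    · cases m with
      | zero => rw [residual_zero]; rfl
      | succ m =>
        have := residual_inr_sub hV hP m (fun i hi => hVV i (by omega))
          (fun i h0 hi => hPP i h0 (by omega)) hW i
        rw [(h W x hW).2 _ hm, hPP (m + 1) (by omega) hm W x hW] at this
        linarith

end Uniqueness

variable (𝓢) in
theorem isTaylor_iff (Γ : ℕ → Operator d p (Fin p)) (Ψ : ℕ → Operator d p (Fin r)) :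
    𝓢.IsTaylor Γ Ψ ↔ 𝓢.IsExplicit Γ Ψ := by
  rw [IsTaylor, isConsistent_iff (fun j => (𝓢.reg_gammaSeq (j + 1)).neg) 𝓢.reg_psiSeq
    𝓢.isTaylor_gammaSeq]
  constructor
  · rintro ⟨h, h'⟩ W x hW
    have hΓ : ∀ i < 4, Γ (i + 1) W x = 𝓢.gammaSeq (i + 1) W x := fun i hi =>
      (neg_injective (h i hi W x hW)).symm
    exact ⟨hΓ 0 (by omega), (h' 1 (by omega) (by omega) W x hW).symm, hΓ 1 (by omega),
      (h' 2 (by omega) (by omega) W x hW).symm, hΓ 2 (by omega),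
      (h' 3 (by omega) (by omega) W x hW).symm, hΓ 3 (by omega)⟩
  · intro h
    refine ⟨fun i hi W x hW => ?_, fun i h0 hi W x hW => ?_⟩
    · obtain ⟨h1, -, h2, -, h3, -, h4⟩ := h W x hW
      refine congrArg Neg.neg ?_
      interval_cases i
      exacts [h1.symm, h2.symm, h3.symm, h4.symm]
    · obtain ⟨-, h1, -, h2, -, h3, -⟩ := h W x hW
      interval_cases i
      exacts [h1.symm, h2.symm, h3.symm]

end Scheme

end LatticeBoltzmann

namespace LatticeBoltzmann

/-! ### Smooth functions of order `Δt ^ m`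

The time step is written `Δt = η²`, so that functions that are smooth up to `Δt = 0` become smooth
functions of `η` near `0`. Points are `z = ((t, η), x)`. -/

section Order

variable {d : ℕ} {n n' : Type}

/-- `g` is the product of `(η²) ^ m` and of a smooth function. -/
def IsO (m : ℕ) (g : (ℝ × ℝ) × Space d → ℝ) (z₀ : (ℝ × ℝ) × Space d) : Prop :=
  ∃ h : (ℝ × ℝ) × Space d → ℝ, SmoothAt h z₀ ∧ g =ᶠ[𝓝 z₀] fun z => (z.1.2 ^ 2) ^ m * h z

namespace IsO

variable {m m' : ℕ} {g g' : (ℝ × ℝ) × Space d → ℝ} {z₀ : (ℝ × ℝ) × Space d}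

theorem smoothAt_pow (k : ℕ) (z₀ : (ℝ × ℝ) × Space d) :
    SmoothAt (fun z : (ℝ × ℝ) × Space d => (z.1.2 ^ 2) ^ k) z₀ :=
  .of_contDiff (by fun_prop) _

theorem smoothAt (h : IsO m g z₀) : SmoothAt g z₀ := by
  obtain ⟨h, hs, he⟩ := h
  exact ((smoothAt_pow m z₀).mul hs).congr he

theorem of_smoothAt (h : SmoothAt g z₀) : IsO 0 g z₀ :=
  ⟨g, h, Eventually.of_forall fun z => by simp⟩

theorem congr (h : IsO m g z₀) (hg : g' =ᶠ[𝓝 z₀] g) : IsO m g' z₀ := by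
  obtain ⟨h, hs, he⟩ := h
  exact ⟨h, hs, hg.trans he⟩

theorem zero : IsO m (fun _ => 0 : (ℝ × ℝ) × Space d → ℝ) z₀ :=
  ⟨fun _ => 0, .of_contDiff contDiff_const _, Eventually.of_forall fun z => by simp⟩

theorem add (h : IsO m g z₀) (h' : IsO m g' z₀) : IsO m (fun z => g z + g' z) z₀ := by
  obtain ⟨h, hs, he⟩ := h
  obtain ⟨h', hs', he'⟩ := h'
  refine ⟨_, hs.add hs', ?_⟩
  filter_upwards [he, he'] with z h1 h2
  rw [h1, h2]; ring

theorem const_mul (h : IsO m g z₀) (c : ℝ) : IsO m (fun z => c * g z) z₀ := by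
  obtain ⟨h, hs, he⟩ := h
  refine ⟨_, hs.const_mul c, ?_⟩
  filter_upwards [he] with z h1
  rw [h1]; ring

theorem sub (h : IsO m g z₀) (h' : IsO m g' z₀) : IsO m (fun z => g z - g' z) z₀ :=
  (h.add (h'.const_mul (-1))).congr (Eventually.of_forall fun z => by ring)

theorem sum {ι : Type*} {s : Finset ι} {g : ι → (ℝ × ℝ) × Space d → ℝ}
    (h : ∀ i ∈ s, IsO m (g i) z₀) : IsO m (fun z => ∑ i ∈ s, g i z) z₀ := by
  classical
  induction s using Finset.induction_on with
  | empty => simpa using zero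
  | insert i s hi ih =>
    simp only [Finset.sum_insert hi]
    exact (h i (by simp)).add (ih fun j hj => h j (by simp [hj]))

theorem pow_mul (h : IsO m g z₀) (k : ℕ) : IsO (k + m) (fun z => (z.1.2 ^ 2) ^ k * g z) z₀ := by
  obtain ⟨h, hs, he⟩ := h
  refine ⟨h, hs, ?_⟩
  filter_upwards [he] with z h1
  rw [h1, pow_add]; ring

theorem mono (h : IsO m g z₀) (hm : m' ≤ m) : IsO m' g z₀ := by
  obtain ⟨h, hs, he⟩ := h
  refine ⟨_, (smoothAt_pow (m - m') z₀).mul hs, ?_⟩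
  filter_upwards [he] with z h1
  rw [h1, ← mul_assoc, ← pow_add, Nat.add_sub_cancel' hm]

/-- Division by `η²`. -/
theorem of_mul (hg : SmoothAt g z₀) (h : IsO (m + 1) (fun z => z.1.2 ^ 2 * g z) z₀) :
    IsO m g z₀ := by
  obtain ⟨h, hs, he⟩ := h
  refine ⟨h, hs, ?_⟩
  have hk := hg.sub ((smoothAt_pow m z₀).mul hs)
  filter_upwards [hk.eventually, he.eventuallyEq_nhds] with z hkz hez
  -- A failure at z would persist nearby by continuity. But cancelling η² is possible wherever η ≠
  -- 0, so η would vanish on a whole neighbourhood of z.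
  by_contra hne
  have hne' : g z - (z.1.2 ^ 2) ^ m * h z ≠ 0 := sub_ne_zero.2 hne
  have hz : ∀ᶠ z' in 𝓝 z, z'.1.2 = 0 := by
    filter_upwards [hkz.continuousAt.eventually_ne hne', hez] with z' h1 h2
    by_contra h0
    apply h1
    have : z'.1.2 ^ 2 ≠ 0 := pow_ne_zero 2 h0
    apply mul_left_cancel₀ this
    rw [mul_sub, h2, pow_succ]; ring
  have hc : Tendsto (fun s : ℝ => ((z.1.1, s), z.2)) (𝓝 z.1.2) (𝓝 z) := by
    have : ContinuousAt (fun s : ℝ => ((z.1.1, s), z.2)) z.1.2 := by fun_prop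
    exact this
  have h3 : ∀ᶠ s in 𝓝[≠] z.1.2, s = 0 := (hc.eventually hz).filter_mono nhdsWithin_le_nhds
  obtain ⟨s, hs1, hs2⟩ := (h3.and self_mem_nhdsWithin).exists
  exact hs2 (hs1.trans hz.self_of_nhds.symm)

/-- The factor (η²) ^ m depends neither on x nor on t, so derivatives fall on the smooth quotient
and no order is lost; a plain bound on g would not allow this. -/
theorem fderiv_snd (h : IsO m g z₀) (v : Space d) :
    IsO m (fun z => fderiv ℝ (fun y => g (z.1, y)) z.2 v) z₀ := by
  obtain ⟨h, hs, he⟩ := h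
  refine ⟨_, (hs.fderiv_apply (0, v)), ?_⟩
  filter_upwards [he.eventuallyEq_nhds, hs.fderiv_snd v] with z h1 h2
  have hc : ContinuousAt (fun y => (z.1, y)) z.2 := by fun_prop
  have h3 : (fun y => g (z.1, y)) =ᶠ[𝓝 z.2] (z.1.2 ^ 2) ^ m • fun y => h (z.1, y) :=
    hc.eventually h1
  rw [h3.fderiv_eq, fderiv_const_smul_field, ← h2]
  rfl

theorem deriv_fst (h : IsO m g z₀) :
    IsO m (fun z => deriv (fun t => g ((t, z.1.2), z.2)) z.1.1) z₀ := by
  obtain ⟨h, hs, he⟩ := h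
  refine ⟨_, (hs.fderiv_apply ((1, 0), 0)), ?_⟩
  filter_upwards [he.eventuallyEq_nhds, hs.eventually] with z h1 h2
  have hc : ContinuousAt (fun t => ((t, z.1.2), z.2)) z.1.1 := by fun_prop
  have h3 : (fun t => g ((t, z.1.2), z.2)) =ᶠ[𝓝 z.1.1]
      fun t => (z.1.2 ^ 2) ^ m * h ((t, z.1.2), z.2) := hc.eventually h1
  rw [h3.deriv_eq, deriv_const_mul_field]
  congr 1
  exact (SmoothAt.hasDerivAt_comp (c := fun t => ((t, z.1.2), z.2)) h2
    (((hasDerivAt_id _).prodMk (hasDerivAt_const _ _)).prodMk (hasDerivAt_const _ _))).deriv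

end IsO

/-! ### Time derivatives of families and approximation -/

/-- The time derivative of a family of fields. -/
noncomputable def tD (u : ℝ × ℝ → VField d n) : ℝ × ℝ → VField d n :=
  fun e y k => deriv (fun t => u (t, e.2) y k) e.1

variable {e₀ : ℝ × ℝ} {x₀ : Space d}

theorem SmoothFam.hasDerivAt {u : ℝ × ℝ → VField d n} (hu : SmoothFam u e₀ x₀) (k : n) :
    HasDerivAt (fun t => u (t, e₀.2) x₀ k) (tD u e₀ x₀ k) e₀.1 :=
  (SmoothAt.hasDerivAt_comp (c := fun t => ((t, e₀.2), x₀)) (hu k)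
    (((hasDerivAt_id _).prodMk (hasDerivAt_const _ _)).prodMk
      (hasDerivAt_const _ _))).differentiableAt.hasDerivAt

theorem smoothFam_tD {u : ℝ × ℝ → VField d n} (hu : SmoothFam u e₀ x₀) :
    SmoothFam (tD u) e₀ x₀ := fun k => (IsO.of_smoothAt (hu k)).deriv_fst.smoothAt

/-- The smooth families `u` and `u'` differ by `(η²) ^ m` times a smooth family. -/
structure Approx (m : ℕ) (u u' : ℝ × ℝ → VField d n) (e₀ : ℝ × ℝ) (x₀ : Space d) : Prop where
  left : SmoothFam u e₀ x₀
  right : SmoothFam u' e₀ x₀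
  isO : ∀ k, IsO m (fun z => u z.1 z.2 k - u' z.1 z.2 k) (e₀, x₀)

namespace Approx

variable {m : ℕ} {u u' u'' v v' : ℝ × ℝ → VField d n}

theorem trans (h : Approx m u u' e₀ x₀) (h' : Approx m u' u'' e₀ x₀) : Approx m u u'' e₀ x₀ :=
  ⟨h.left, h'.right, fun k => ((h.isO k).add (h'.isO k)).congr
    (Eventually.of_forall fun z => by ring)⟩

theorem tD (h : Approx m u u' e₀ x₀) : Approx m (tD u) (tD u') e₀ x₀ := by
  refine ⟨smoothFam_tD h.left, smoothFam_tD h.right, fun k => (h.isO k).deriv_fst.congr ?_⟩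
  filter_upwards [(h.left k).eventually, (h.right k).eventually] with z h1 h2
  have e1 := SmoothAt.hasDerivAt_comp (c := fun t => ((t, z.1.2), z.2)) h1
    (((hasDerivAt_id z.1.1).prodMk (hasDerivAt_const _ _)).prodMk (hasDerivAt_const _ _))
  have e2 := SmoothAt.hasDerivAt_comp (c := fun t => ((t, z.1.2), z.2)) h2
    (((hasDerivAt_id z.1.1).prodMk (hasDerivAt_const _ _)).prodMk (hasDerivAt_const _ _))
  exact (deriv_fun_sub e1.differentiableAt e2.differentiableAt).symm

theorem advection {p r : ℕ} (𝓢 : Scheme d p r) {u u' : ℝ × ℝ → VField d (Idx p r)}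
    (h : Approx m u u' e₀ x₀) :
    Approx m (fun e => 𝓢.advection (u e)) (fun e => 𝓢.advection (u' e)) e₀ x₀ := by
  refine ⟨𝓢.smoothFam_advection h.left, 𝓢.smoothFam_advection h.right, fun k => ?_⟩
  refine (IsO.sum (s := Finset.univ) fun l _ => IsO.sum (s := Finset.univ) fun j _ =>
    ((h.isO l).fderiv_snd (𝓢.v j)).const_mul (𝓢.M k j * 𝓢.M⁻¹ j l)).congr ?_
  filter_upwards [eventually_all.2 fun l => (h.left l).eventually,
    eventually_all.2 fun l => (h.right l).eventually] with z h1 h2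
  simp only [Scheme.advection, ← Finset.sum_sub_distrib]
  refine Finset.sum_congr rfl fun l _ => Finset.sum_congr rfl fun j _ => ?_
  rw [fderiv_fun_sub (h1 l).slice.differentiableAt (h2 l).slice.differentiableAt]
  simp only [_root_.sub_apply]
  ring

end Approx

end Order

namespace Scheme

variable {d p r : ℕ} {n : Type} {𝓢 : Scheme d p r} {e₀ : ℝ × ℝ} {x₀ : Space d}

theorem Reg.dOp_sum_right {F : Operator d p n} (hF : 𝓢.Reg F) {ι : Type*} (s : Finset ι)
    {W : VField d (Fin p)} {g : ι → VField d (Fin p)} (c : ι → ℝ) {x : Space d}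
    (h : 𝓢.AdmissibleAt W x) (hg : ∀ i ∈ s, SmoothField (g i) x) :
    dOp F W (∑ i ∈ s, c i • g i) x = ∑ i ∈ s, c i • dOp F W (g i) x := by
  classical
  have hsum : ∀ s' ⊆ s, SmoothField (∑ i ∈ s', c i • g i) x := fun s' hs' k => by
    have : SmoothAt (fun y => ∑ i ∈ s', c i * g i y k) x :=
      SmoothAt.sum fun i hi => (hg i (hs' hi) k).const_mul _
    simpa [Finset.sum_apply] using this
  induction s using Finset.induction_on with
  | empty =>
    simp only [Finset.sum_empty]
    have := dOp_smul_right F W 0 0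
    rw [zero_smul, zero_smul] at this
    rw [this]; rfl
  | insert i s hi ih =>
    have h1 : SmoothField (c i • g i) x := by
      simpa using hsum {i} (by simp)
    rw [Finset.sum_insert hi, Finset.sum_insert hi, hF.dOp_add_right h h1
      (hsum s (Finset.subset_insert _ _)), dOp_smul_right,
      ih (fun j hj => hg j (by simp [hj])) fun s' hs' => hsum s' (hs'.trans (Finset.subset_insert _ _))]
    rfl

/-- The sum of a series of operators, truncated after the order four. -/
noncomputable def ev (w : ℝ × ℝ → VField d (Fin p)) (F : ℕ → Operator d p n) :
    ℝ × ℝ → VField d n :=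
  fun e => ∑ i ∈ Finset.range 5, (e.2 ^ 2) ^ i • F i (w e)

theorem ev_apply (w : ℝ × ℝ → VField d (Fin p)) (F : ℕ → Operator d p n) (e : ℝ × ℝ)
    (x : Space d) (k : n) :
    ev w F e x k = ∑ i ∈ Finset.range 5, (e.2 ^ 2) ^ i * F i (w e) x k := by
  simp [ev, Finset.sum_apply]

variable {w : ℝ × ℝ → VField d (Fin p)} {V : ℕ → Operator d p (Fin p)} {m : ℕ}

theorem smoothFam_ev (hw : 𝓢.AdmFam w e₀ x₀) {F : ℕ → Operator d p n} (hF : ∀ k, 𝓢.Reg (F k)) :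
    SmoothFam (ev w F) e₀ x₀ := fun k => by
  simp only [ev_apply]
  exact SmoothAt.sum fun i _ =>
    (IsO.smoothAt_pow i _).mul ((hF i).smooth _ _ _ _ hw k)

theorem Reg.tD_eq (hw : 𝓢.AdmFam w e₀ x₀) {F : Operator d p n} (hF : 𝓢.Reg F) :
    ∀ᶠ z in 𝓝 (e₀, x₀), tD (fun e => F (w e)) z.1 z.2 = dOp F (w z.1) (tD w z.1) z.2 := by
  filter_upwards [hw.eventually] with z hz
  ext k
  have h1 : 𝓢.AdmFam (fun t => w (t, z.1.2)) z.1.1 z.2 :=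
    AdmFam.reparam (φ := fun t => (t, z.1.2)) hz (by fun_prop)
  exact (hF.hasDerivAt_comp h1 k).deriv

/-- By the chain rule the time derivative of F(w) is dF in the direction ∂_t w. Linearity in the
direction sends the error (η²) ^ m g to (η²) ^ m dF.g, again with a smooth quotient. -/
theorem Reg.approx_tD (hw : 𝓢.AdmFam w e₀ x₀) (hV : ∀ k, 𝓢.Reg (V k))
    (h : Approx m (tD w) (ev w V) e₀ x₀) {F : Operator d p n} (hF : 𝓢.Reg F) :
    Approx m (tD fun e => F (w e)) (ev w fun j => LatticeBoltzmann.dirDeriv F (V j)) e₀ x₀ := by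
  refine ⟨smoothFam_tD (hF.smooth _ _ _ _ hw), smoothFam_ev hw fun j => hF.dirDeriv (hV j),
    fun k => ?_⟩
  choose g hg hge using h.isO
  have hgs : SmoothFam (fun e y i => g i (e, y)) e₀ x₀ := hg
  refine ⟨fun z => dOp F (w z.1) (fun y i => g i (z.1, y)) z.2 k, hF.smoothFam_dOp hw hgs k, ?_⟩
  filter_upwards [hF.tD_eq hw, hw.eventually, eventually_all.2 fun i => (hge i).eventuallyEq_nhds,
    eventually_all.2 fun i => (hg i).eventually,
    eventually_all.2 fun i => (h.left i).eventually] with z h1 h2 h3 h4 h5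
  have hW := h2.admissibleAt
  have hc : ContinuousAt (fun y => (z.1, y)) z.2 := by fun_prop
  have h6 : tD w z.1 =ᶠ[𝓝 z.2] ev w V z.1 + (z.1.2 ^ 2) ^ m • fun y i => g i (z.1, y) := by
    filter_upwards [hc.eventually (eventually_all.2 h3)] with y hy
    ext i
    have := hy i
    simp only [Pi.add_apply, Pi.smul_apply, smul_eq_mul] at this ⊢
    linarith
  have hgf : SmoothField (fun y i => g i (z.1, y)) z.2 := fun i => (h4 i).slice
  have hgf' : SmoothField ((z.1.2 ^ 2) ^ m • fun y i => g i (z.1, y)) z.2 := fun i =>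
    (hgf i).const_mul _
  have hevf : SmoothField (ev w V z.1) z.2 := (smoothFam_ev h2 hV).field
  rw [h1, hF.dOp_congr hW (fun i => (h5 i).slice) EventuallyEq.rfl h6,
    hF.dOp_add_right hW hevf hgf', dOp_smul_right, ev_apply]
  have h7 : dOp F (w z.1) (ev w V z.1) z.2 = _ := hF.dOp_sum_right (Finset.range 5)
    (fun i => (z.1.2 ^ 2) ^ i) hW fun i _ => (hV i).smoothField hW
  rw [h7]
  simp [Finset.sum_apply, dirDeriv_eq_dOp]

/-- The last sum collects the pairs of total degree at least 5; in it the second index is 5 + j - i,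
so each term has degree 5 + j. -/
theorem cauchy_product (c : ℝ) (a : ℕ → ℕ → ℝ) :
    ∑ i ∈ Finset.range 5, ∑ j ∈ Finset.range 5, c ^ i * (c ^ j * a i j) =
      ∑ k ∈ Finset.range 5, c ^ k * ∑ i ∈ Finset.range (k + 1), a i (k - i) +
      c ^ 5 * ∑ i ∈ Finset.range 5, ∑ j ∈ Finset.range i, c ^ j * a i (5 + j - i) := by
  simp only [Finset.sum_range_succ, Finset.sum_range_zero]
  norm_num
  ring

/-- The time derivative of a series of operators. -/
theorem approx_tD_ev (hw : 𝓢.AdmFam w e₀ x₀) (hV : ∀ k, 𝓢.Reg (V k))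
    (h : Approx m (tD w) (ev w V) e₀ x₀) (hm : m ≤ 5) {F : ℕ → Operator d p n}
    (hF : ∀ k, 𝓢.Reg (F k)) : Approx m (tD (ev w F)) (ev w (timeDeriv V F)) e₀ x₀ := by
  refine ⟨smoothFam_tD (smoothFam_ev hw hF), smoothFam_ev hw (reg_timeDeriv hV hF), fun k => ?_⟩
  have h1 : IsO m (fun z : (ℝ × ℝ) × Space d => ∑ i ∈ Finset.range 5, (z.1.2 ^ 2) ^ i *
      (tD (fun e => F i (w e)) z.1 z.2 k - ev w (fun j => dirDeriv (F i) (V j)) z.1 z.2 k))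
      (e₀, x₀) :=
    IsO.sum fun i _ => ((((hF i).approx_tD hw hV h).isO k).pow_mul i).mono (Nat.le_add_left m i)
  have h2 : IsO 5 (fun z : (ℝ × ℝ) × Space d => (z.1.2 ^ 2) ^ 5 * ∑ i ∈ Finset.range 5,
      ∑ j ∈ Finset.range i, (z.1.2 ^ 2) ^ j * dirDeriv (F i) (V (5 + j - i)) (w z.1) z.2 k)
      (e₀, x₀) := by
    refine (IsO.of_smoothAt ?_).pow_mul 5
    exact SmoothAt.sum fun i _ => SmoothAt.sum fun j _ => (IsO.smoothAt_pow j _).mul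
      (((hF i).dirDeriv (hV _)).smooth _ _ _ _ hw k)
  refine (h1.add (h2.mono hm)).congr ?_
  filter_upwards [hw.eventually] with z hz
  have h3 : tD (ev w F) z.1 z.2 k =
      ∑ i ∈ Finset.range 5, (z.1.2 ^ 2) ^ i * tD (fun e => F i (w e)) z.1 z.2 k := by
    simp only [tD, ev_apply]
    exact HasDerivAt.deriv (HasDerivAt.fun_sum fun i _ =>
      (((hF i).smooth _ _ _ _ hz).hasDerivAt k).const_mul _)
  rw [h3]
  simp only [ev_apply, mul_sub, Finset.sum_sub_distrib, Finset.mul_sum _ _ ((z.1.2 ^ 2) ^ _)]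
  rw [cauchy_product (z.1.2 ^ 2) fun i j => dirDeriv (F i) (V j) (w z.1) z.2 k]
  simp only [timeDeriv, Finset.sum_apply, Finset.mul_sum]
  abel

/-- Differentiating an approximation keeps its order, and the derivative of the truncated series is
then replaced by the formal one. -/
theorem approx_tD_iterate (hw : 𝓢.AdmFam w e₀ x₀) (hV : ∀ k, 𝓢.Reg (V k))
    (h : Approx m (tD w) (ev w V) e₀ x₀) (hm : m ≤ 5) {F : ℕ → Operator d p n}
    (hF : ∀ k, 𝓢.Reg (F k)) {u : ℝ × ℝ → VField d n} (hu : Approx m u (ev w F) e₀ x₀) (l : ℕ) :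
    Approx m (tD^[l] u) (ev w ((timeDeriv V)^[l] F)) e₀ x₀ := by
  induction l with
  | zero => exact hu
  | succ l ih =>
    simp only [Function.iterate_succ_apply']
    exact ih.tD.trans (approx_tD_ev hw hV h hm (reg_timeDeriv_iterate hV hF l))

theorem advection_sum {ι : Type*} (s : Finset ι) (c : ι → ℝ) {u : ι → VField d (Idx p r)}
    {x : Space d} (hu : ∀ i ∈ s, SmoothField (u i) x) :
    𝓢.advection (∑ i ∈ s, c i • u i) x = ∑ i ∈ s, c i • 𝓢.advection (u i) x := by
  classical
  have hsum : ∀ s' ⊆ s, SmoothField (∑ i ∈ s', c i • u i) x := fun s' hs' k => by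
    have : SmoothAt (fun y => ∑ i ∈ s', c i * u i y k) x :=
      SmoothAt.sum fun i hi => (hu i (hs' hi) k).const_mul _
    simpa [Finset.sum_apply] using this
  induction s using Finset.induction_on with
  | empty =>
    simp only [Finset.sum_empty]
    have := 𝓢.advection_smul 0 0
    rw [zero_smul, zero_smul] at this
    rw [this]; rfl
  | insert i s hi ih =>
    have h1 : SmoothField (c i • u i) x := by
      simpa using hsum {i} (by simp)
    rw [Finset.sum_insert hi, Finset.sum_insert hi, 𝓢.advection_add h1
      (hsum s (Finset.subset_insert _ _)), advection_smul,
      ih (fun j hj => hu j (by simp [hj])) fun s' hs' => hsum s' (hs'.trans (Finset.subset_insert _ _))]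
    rfl

theorem approx_advection_iterate (hw : 𝓢.AdmFam w e₀ x₀) {F : ℕ → Operator d p (Idx p r)}
    (hF : ∀ k, 𝓢.Reg (F k)) {u : ℝ × ℝ → VField d (Idx p r)} (hu : Approx m u (ev w F) e₀ x₀)
    (l : ℕ) :
    Approx m (fun e => 𝓢.advection^[l] (u e)) (ev w fun k W => 𝓢.advection^[l] (F k W)) e₀ x₀ := by
  induction l with
  | zero => exact hu
  | succ l ih =>
    simp only [Function.iterate_succ_apply']
    have hFl : ∀ k, 𝓢.Reg (fun W => 𝓢.advection^[l] (F k W)) := fun k =>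
      (linDiffOp_advection_iterate l).reg (hF k)
    refine (ih.advection 𝓢).trans ⟨(ih.advection 𝓢).right, smoothFam_ev hw fun k =>
      (hFl k).advection, fun k => IsO.zero.congr ?_⟩
    filter_upwards [hw.eventually] with z hz
    have := advection_sum (𝓢 := 𝓢) (Finset.range 5) (fun i => (z.1.2 ^ 2) ^ i)
      (u := fun i => 𝓢.advection^[l] (F i (w z.1))) (x := z.2)
      fun i _ => (hFl i).smoothField hz.admissibleAt
    rw [ev_apply, sub_eq_zero]
    refine (congrFun this k).trans ?_
    simp [Finset.sum_apply]

end Scheme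

end LatticeBoltzmann

namespace LatticeBoltzmann

/-! ### Functions that vanish on the grid -/

section Flat

variable {d p r : ℕ} (𝓢 : Scheme d p r)

/-- The points `((n η², η), x)`, with `η > 0` and with `x` in the lattice for `Δt = η²`. -/
def Scheme.grid : Set ((ℝ × ℝ) × Space d) :=
  {z | 0 < z.1.2 ∧ (∃ n : ℕ, z.1.1 = n * z.1.2 ^ 2) ∧ z.2 ∈ 𝓢.lattice (z.1.2 ^ 2)}

/-- Round t up to a multiple of η², and round the coordinates of x / (λη²) down to integers. The
errors are at most η² in time and λη² times the sum of the norms of the basis vectors in space. -/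
theorem Scheme.exists_tendsto_grid {t : ℝ} (ht : 0 ≤ t) (x : Space d) :
    ∃ ζ : ℝ → (ℝ × ℝ) × Space d, Tendsto ζ (𝓝[>] 0) (𝓝 ((t, 0), x)) ∧
      ∀ η, 0 < η → ζ η ∈ 𝓢.grid := by
  let c : ℝ → ℝ := fun η => 𝓢.lam * η ^ 2
  have hc : ∀ η, 0 < η → 0 < c η := fun η hη => mul_pos 𝓢.lam_pos (by positivity)
  refine ⟨fun η => ((⌈t / η ^ 2⌉₊ * η ^ 2, η), c η • (ZSpan.floor 𝓢.basis ((c η)⁻¹ • x) : Space d)),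
    ?_, fun η hη => ⟨hη, ⟨_, rfl⟩, _, (ZSpan.floor 𝓢.basis ((c η)⁻¹ • x)).2, rfl⟩⟩
  have hid : Tendsto (fun η : ℝ => η) (𝓝[>] 0) (𝓝 0) := nhdsWithin_le_nhds
  have hsq : Tendsto (fun η : ℝ => η ^ 2) (𝓝[>] 0) (𝓝 0) := by simpa using hid.pow 2
  refine Tendsto.prodMk_nhds (Tendsto.prodMk_nhds ?_ hid) ?_
  · rw [tendsto_iff_dist_tendsto_zero]
    refine squeeze_zero' (Eventually.of_forall fun _ => dist_nonneg) ?_ hsq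
    filter_upwards [self_mem_nhdsWithin] with η hη
    have hη2 : 0 < η ^ 2 := pow_pos hη 2
    have h1 : t ≤ ⌈t / η ^ 2⌉₊ * η ^ 2 := (div_le_iff₀ hη2).1 (Nat.le_ceil _)
    have h2 : (⌈t / η ^ 2⌉₊ : ℝ) < t / η ^ 2 + 1 := Nat.ceil_lt_add_one (by positivity)
    have h3 : ⌈t / η ^ 2⌉₊ * η ^ 2 ≤ t + η ^ 2 := by
      calc ⌈t / η ^ 2⌉₊ * η ^ 2 ≤ (t / η ^ 2 + 1) * η ^ 2 := by gcongr
        _ = t + η ^ 2 := by rw [add_mul, one_mul, div_mul_cancel₀ _ hη2.ne']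
    rw [Real.dist_eq, abs_le]
    constructor <;> linarith
  · rw [tendsto_iff_dist_tendsto_zero]
    have hlim : Tendsto (fun η => c η * ∑ i, ‖𝓢.basis i‖) (𝓝[>] 0) (𝓝 0) := by
      simpa [c] using (hsq.const_mul 𝓢.lam).mul_const (∑ i, ‖𝓢.basis i‖)
    refine squeeze_zero' (Eventually.of_forall fun _ => dist_nonneg) ?_ hlim
    filter_upwards [self_mem_nhdsWithin] with η hη
    have hcη := hc η hη
    have h1 : c η • (ZSpan.floor 𝓢.basis ((c η)⁻¹ • x) : Space d) - x =
        -(c η • ZSpan.fract 𝓢.basis ((c η)⁻¹ • x)) := by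
      rw [ZSpan.fract_apply, smul_sub, smul_inv_smul₀ hcη.ne']
      abel
    rw [dist_eq_norm, h1, norm_neg, norm_smul, Real.norm_of_nonneg hcη.le]
    gcongr
    exact ZSpan.norm_fract_le 𝓢.basis _

theorem exists_eq_eta_mul {ρ : (ℝ × ℝ) × Space d → ℝ} {t : ℝ} {x : Space d}
    (hρ : SmoothAt ρ ((t, 0), x))
    (h0 : ∀ᶠ z in 𝓝 (t, x), ρ ((z.1, 0), z.2) = 0) :
    ∃ h : (ℝ × ℝ) × Space d → ℝ, SmoothAt h ((t, 0), x) ∧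
      ρ =ᶠ[𝓝 ((t, 0), x)] fun z => z.1.2 * h z := by
  have h1 : SmoothAt (fun q : (ℝ × Space d) × ℝ => ρ ((q.1.1, q.2), q.1.2)) ((t, x), 0) :=
    SmoothAt.comp (f := fun q : (ℝ × Space d) × ℝ => ((q.1.1, q.2), q.1.2)) _ hρ
      (.of_contDiff (by fun_prop) _)
  obtain ⟨H, hH, hHe⟩ := h1.exists_eq_mul h0
  refine ⟨fun z => H ((z.1.1, z.2), z.1.2), SmoothAt.comp
    (f := fun z : (ℝ × ℝ) × Space d => ((z.1.1, z.2), z.1.2)) _ hH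
      (.of_contDiff (by fun_prop) _), ?_⟩
  have hc : ContinuousAt (fun z : (ℝ × ℝ) × Space d => ((z.1.1, z.2), z.1.2)) ((t, 0), x) := by
    fun_prop
  exact hc.eventually hHe

/-- A smooth function that vanishes on the grid is flat at `η = 0`. -/
theorem Scheme.isO_of_grid {R : (ℝ × ℝ) × Space d → ℝ} {t : ℝ} (ht : 0 < t) {x : Space d}
    (hR : SmoothAt R ((t, 0), x)) (h : ∀ᶠ z in 𝓝 ((t, 0), x), z ∈ 𝓢.grid → R z = 0) (m : ℕ) :
    IsO m R ((t, 0), x) := by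
  -- Hadamard's lemma extracts one factor η at a time; 2m of them make (η²) ^ m.
  suffices H : ∀ l : ℕ, ∃ h : (ℝ × ℝ) × Space d → ℝ, SmoothAt h ((t, 0), x) ∧
      R =ᶠ[𝓝 ((t, 0), x)] fun z => z.1.2 ^ l * h z by
    obtain ⟨h, hs, he⟩ := H (2 * m)
    exact ⟨h, hs, by simpa only [pow_mul] using he⟩
  intro l
  induction l with
  | zero => exact ⟨R, hR, Eventually.of_forall fun z => by simp⟩
  | succ l ih =>
    obtain ⟨g, hg, hge⟩ := ih
    have h0 : ∀ᶠ z in 𝓝 (t, x), g ((z.1, 0), z.2) = 0 := by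
      have hc : ContinuousAt (fun z : ℝ × Space d => ((z.1, (0 : ℝ)), z.2)) (t, x) := by fun_prop
      have hpos : ∀ᶠ z : ℝ × Space d in 𝓝 (t, x), 0 < z.1 :=
        continuousAt_fst.eventually (lt_mem_nhds ht)
      filter_upwards [hc.eventually hg.eventually, hc.eventually (eventually_eventually_nhds.2 h),
        hc.eventually hge.eventuallyEq_nhds, hpos] with z h1 h2 h3 h4
      obtain ⟨ζ, hζ, hζg⟩ := 𝓢.exists_tendsto_grid h4.le z.2
      -- On the grid η > 0, so the quotient g vanishes there as R does. Grid points converge to each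
      -- nearby ((t', 0), x'), hence g = 0 at η = 0 and another factor can be extracted.
      have h5 : ∀ᶠ η in 𝓝[>] (0 : ℝ), g (ζ η) = 0 := by
        filter_upwards [hζ.eventually h2, hζ.eventually h3, self_mem_nhdsWithin] with η h6 h7 h8
        have h9 := hζg η h8
        rw [h6 h9] at h7
        exact (mul_eq_zero.1 h7.symm).resolve_left (pow_pos h9.1 l).ne'
      have h6 : Tendsto (fun η => g (ζ η)) (𝓝[>] 0) (𝓝 (g ((z.1, 0), z.2))) :=
        h1.continuousAt.tendsto.comp hζ
      exact tendsto_nhds_unique (h6.congr' h5) tendsto_const_nhds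
    obtain ⟨g', hg', hge'⟩ := exists_eq_eta_mul hg h0
    refine ⟨g', hg', ?_⟩
    filter_upwards [hge, hge'] with z h1 h2
    rw [h1, h2]; ring

end Flat

/-! ### Taylor expansions -/

section Taylor

variable {d p r : ℕ} {n : Type}

/-- Taylor's formula along u, evaluated at the length η²; a remainder smooth in both base point and
length stays smooth after this substitution. -/
theorem isO_taylor {g : (ℝ × ℝ) × Space d → ℝ} {t : ℝ} {x : Space d}
    (hg : SmoothAt g ((t, 0), x)) (u : (ℝ × ℝ) × Space d) (N : ℕ) :
    IsO N (fun z => g (z + (z.1.2 ^ 2) • u) - ∑ k ∈ Finset.range N,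
      (z.1.2 ^ 2) ^ k / (k.factorial : ℝ) *
        ((fun g' : (ℝ × ℝ) × Space d → ℝ => fun z => fderiv ℝ g' z u)^[k] g) z) ((t, 0), x) := by
  obtain ⟨H, hH, hHe⟩ := SmoothAt.taylor _ u N hg
  refine ⟨fun z => H (z, z.1.2 ^ 2), SmoothAt.comp_of_eq
    (f := fun z : (ℝ × ℝ) × Space d => (z, z.1.2 ^ 2)) _ hH (.of_contDiff (by fun_prop) _)
    (by simp), ?_⟩
  have hc : Tendsto (fun z : (ℝ × ℝ) × Space d => (z, z.1.2 ^ 2)) (𝓝 ((t, 0), x))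
      (𝓝 (((t, 0), x), 0)) := by
    have : ContinuousAt (fun z : (ℝ × ℝ) × Space d => (z, z.1.2 ^ 2)) ((t, 0), x) := by fun_prop
    simpa [ContinuousAt] using this
  filter_upwards [hc.eventually hHe] with z hz
  rw [hz]; ring

theorem tD_iterate_eq {u : ℝ × ℝ → VField d n} {e₀ : ℝ × ℝ} {x₀ : Space d}
    (hu : SmoothFam u e₀ x₀) (k : n) (l : ℕ) :
    (fun z : (ℝ × ℝ) × Space d => tD^[l] u z.1 z.2 k) =ᶠ[𝓝 (e₀, x₀)]
      (fun g' : (ℝ × ℝ) × Space d → ℝ => fun z => fderiv ℝ g' z ((1, 0), 0))^[l]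
        (fun z => u z.1 z.2 k) := by
  induction l with
  | zero => rfl
  | succ l ih =>
    have hs : SmoothFam (tD^[l] u) e₀ x₀ := by
      clear ih
      induction l with
      | zero => exact hu
      | succ l ih => rw [Function.iterate_succ_apply']; exact smoothFam_tD ih
    rw [Function.iterate_succ_apply']
    filter_upwards [ih.eventuallyEq_nhds, (hs k).eventually] with z h1 h2
    rw [Function.iterate_succ_apply', ← h1.fderiv_eq]
    exact (SmoothAt.hasDerivAt_comp (c := fun t => ((t, z.1.2), z.2)) h2
      (((hasDerivAt_id _).prodMk (hasDerivAt_const _ _)).prodMk (hasDerivAt_const _ _))).deriv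

theorem smoothAt_iterate_fderiv {g : (ℝ × ℝ) × Space d → ℝ} {z₀ : (ℝ × ℝ) × Space d}
    (hg : SmoothAt g z₀) (u : (ℝ × ℝ) × Space d) (l : ℕ) :
    SmoothAt ((fun g' : (ℝ × ℝ) × Space d → ℝ => fun z => fderiv ℝ g' z u)^[l] g) z₀ := by
  induction l with
  | zero => exact hg
  | succ l ih => rw [Function.iterate_succ_apply']; exact ih.fderiv_apply u

/-- The iterates of the advection operator, in terms of the particle distribution. -/
theorem Scheme.advection_iterate_eq (𝓢 : Scheme d p r) {g : ℝ × ℝ → VField d (Idx p r)}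
    {e₀ : ℝ × ℝ} {x₀ : Space d} (hg : SmoothFam g e₀ x₀) (l : ℕ) :
    ∀ᶠ z in 𝓝 (e₀, x₀), ∀ k, 𝓢.advection^[l] (fun y => 𝓢.M *ᵥ g z.1 y) z.2 k =
      ∑ j, 𝓢.M k j * ((-1) ^ l *
        ((fun g' : (ℝ × ℝ) × Space d → ℝ => fun z => fderiv ℝ g' z ((0, 0), -𝓢.v j))^[l]
          (fun z => g z.1 z.2 j)) z) := by
  induction l with
  | zero => exact Eventually.of_forall fun z k => by simp [Matrix.mulVec, dotProduct]
  | succ l ih =>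
    have hs := fun j => smoothAt_iterate_fderiv (hg j) ((0, 0), -𝓢.v j) l
    filter_upwards [eventually_eventually_nhds.2 ih,
      eventually_all.2 fun j => (hs j).eventually,
      eventually_all.2 fun j => (hs j).fderiv_snd (𝓢.v j)] with z h1 h2 h3 k
    simp only [Function.iterate_succ_apply']
    have hc : ContinuousAt (fun y => (z.1, y)) z.2 := by fun_prop
    set G : Idx p r → (ℝ × ℝ) × Space d → ℝ := fun j =>
      (fun g' : (ℝ × ℝ) × Space d → ℝ => fun z => fderiv ℝ g' z ((0, 0), -𝓢.v j))^[l]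
          (fun z => g z.1 z.2 j) with hG
    have h4 : ∀ a j, fderiv ℝ (fun y => 𝓢.advection^[l] (fun y => 𝓢.M *ᵥ g z.1 y) y a) z.2 (𝓢.v j)
        = ∑ i, 𝓢.M a i * ((-1) ^ l * fderiv ℝ (fun y => G i (z.1, y)) z.2 (𝓢.v j)) := by
      intro a j
      have h5 : (fun y => 𝓢.advection^[l] (fun y => 𝓢.M *ᵥ g z.1 y) y a) =ᶠ[𝓝 z.2]
          fun y => ∑ i, 𝓢.M a i * ((-1) ^ l * G i (z.1, y)) := by
        filter_upwards [hc.eventually h1] with y hy using hy a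
      rw [h5.fderiv_eq]
      have h6 := HasFDerivAt.fun_sum (u := Finset.univ) fun i _ =>
        (((h2 i).slice.differentiableAt.hasFDerivAt).const_mul ((-1 : ℝ) ^ l)).const_mul (𝓢.M a i)
      rw [h6.fderiv]
      simp
      rfl
    -- Consecutive factors M⁻¹ M cancel, so Λ acts on M g as M times the diagonal transport
    -- operators. The direction -v j, chosen to match the shift x - v j Δt, accounts for the sign
    -- (-1) ^ l.
    have hinv : 𝓢.M⁻¹ * 𝓢.M = 1 :=
      Matrix.nonsing_inv_mul _ ((Matrix.isUnit_iff_isUnit_det _).1 𝓢.isUnit_M)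
    simp only [Scheme.advection, h4]
    rw [Finset.sum_comm]
    refine Finset.sum_congr rfl fun j _ => ?_
    have h7 : ∀ a, 𝓢.M k j * 𝓢.M⁻¹ j a *
        (∑ i, 𝓢.M a i * ((-1) ^ l * fderiv ℝ (fun y => G i (z.1, y)) z.2 (𝓢.v j))) =
        𝓢.M k j * ∑ i, 𝓢.M⁻¹ j a * 𝓢.M a i *
          ((-1) ^ l * fderiv ℝ (fun y => G i (z.1, y)) z.2 (𝓢.v j)) := by
      intro a
      simp only [Finset.mul_sum]
      exact Finset.sum_congr rfl fun i _ => by ring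
    simp only [h7]
    rw [← Finset.mul_sum, Finset.sum_comm]
    simp only [← Finset.sum_mul, ← Matrix.mul_apply, hinv, Matrix.one_apply, ite_mul, one_mul,
      zero_mul, Finset.sum_ite_eq, Finset.mem_univ, if_true]
    have h8 : fderiv ℝ (fun y => G j (z.1, y)) z.2 (𝓢.v j) = fderiv ℝ (G j) z (0, 𝓢.v j) := h3 j
    have h9 : (((0, 0), -𝓢.v j) : (ℝ × ℝ) × Space d) = -(0, 𝓢.v j) := by simp
    change _ = 𝓢.M k j * ((-1) ^ (l + 1) * fderiv ℝ (G j) z ((0, 0), -𝓢.v j))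
    rw [h8, h9, map_neg, pow_succ]
    ring

end Taylor

end LatticeBoltzmann

namespace LatticeBoltzmann

namespace Scheme

variable {d p r : ℕ} (𝓢 : Scheme d p r)

/-! ### From the scheme to the expansions -/

/-- The moments `m = (W, Y)`. -/
def moments (w : ℝ × ℝ → VField d (Fin p)) (Y : ℝ × ℝ → VField d (Fin r)) :
    ℝ × ℝ → VField d (Idx p r) := fun e y => Sum.elim (w e y) (Y e y)

/-- The moments `m* = (W, Y*)` after relaxation. -/
def relaxed (w : ℝ × ℝ → VField d (Fin p)) (Y : ℝ × ℝ → VField d (Fin r)) :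
    ℝ × ℝ → VField d (Idx p r) :=
  fun e y => Sum.elim (w e y) (Y e y + 𝓢.S *ᵥ (𝓢.Φ (w e y) - Y e y))

variable {𝓢} {w : ℝ × ℝ → VField d (Fin p)} {Y : ℝ × ℝ → VField d (Fin r)} {e₀ : ℝ × ℝ}
  {x₀ : Space d} {V : ℕ → Operator d p (Fin p)} {P : ℕ → Operator d p (Fin r)} {m : ℕ}

theorem smoothFam_moments (hw : 𝓢.AdmFam w e₀ x₀) (hY : SmoothFam Y e₀ x₀) :
    SmoothFam (moments w Y) e₀ x₀
  | Sum.inl k => hw.2 k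
  | Sum.inr k => hY k

theorem smoothFam_relaxed (hw : 𝓢.AdmFam w e₀ x₀) (hY : SmoothFam Y e₀ x₀) :
    SmoothFam (𝓢.relaxed w Y) e₀ x₀ := by
  rintro (k | k)
  · exact hw.2 k
  · have h : SmoothAt (fun z : (ℝ × ℝ) × Space d =>
        ∑ i, 𝓢.S k i * (𝓢.equil (w z.1) z.2 i - Y z.1 z.2 i)) (e₀, x₀) :=
      SmoothAt.sum fun i _ => (((Reg.equil.smooth _ _ _ _ hw) i).sub (hY i)).const_mul (𝓢.S k i)
    exact (hY k).add h

theorem ev_serM_inl (e : ℝ × ℝ) (x : Space d) (i : Fin p) :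
    ev w (𝓢.serM P) e x (Sum.inl i) = w e x i := by
  simp [ev_apply, Finset.sum_range_succ, serM, serW]

theorem ev_serMstar_inl (e : ℝ × ℝ) (x : Space d) (i : Fin p) :
    ev w (𝓢.serMstar P) e x (Sum.inl i) = w e x i := by
  simp [ev_apply, Finset.sum_range_succ, serMstar, serW]

theorem ev_serM_inr (e : ℝ × ℝ) (x : Space d) (i : Fin r) :
    ev w (𝓢.serM P) e x (Sum.inr i) = ev w (𝓢.serY P) e x i := by
  simp [ev_apply, serM]

theorem ev_serMstar_inr (e : ℝ × ℝ) (x : Space d) (i : Fin r) :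
    ev w (𝓢.serMstar P) e x (Sum.inr i) = (ev w (𝓢.serY P) e x +
      𝓢.S *ᵥ (𝓢.Φ (w e x) - ev w (𝓢.serY P) e x)) i := by
  have h : 𝓢.Φ (w e x) = ∑ i ∈ Finset.range 5, (e.2 ^ 2) ^ i • 𝓢.serEquil i (w e) x := by
    simp [Finset.sum_range_succ, serEquil, equil]
  have h' : ev w (𝓢.serY P) e x = ∑ i ∈ Finset.range 5, (e.2 ^ 2) ^ i • 𝓢.serY P i (w e) x := by
    simp [ev, Finset.sum_apply]
  rw [ev_apply, h, h', ← Finset.sum_sub_distrib, Matrix.mulVec_sum, ← Finset.sum_add_distrib,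
    Finset.sum_apply]
  refine Finset.sum_congr rfl fun k _ => ?_
  rw [← smul_sub, Matrix.mulVec_smul, ← smul_add]
  rfl

/-- Φ(W) is exact on both sides, so the error on Y* is I - S applied to the error on Y. -/
theorem relaxed_sub_ev (e : ℝ × ℝ) (x : Space d) (i : Fin r) :
    𝓢.relaxed w Y e x (Sum.inr i) - ev w (𝓢.serMstar P) e x (Sum.inr i) =
      (Y e x i - ev w (𝓢.serY P) e x i) -
        ∑ j, 𝓢.S i j * (Y e x j - ev w (𝓢.serY P) e x j) := by
  rw [ev_serMstar_inr]
  simp only [relaxed, Sum.elim_inr, Pi.add_apply, Matrix.mulVec, dotProduct, Pi.sub_apply, mul_sub,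
    Finset.sum_sub_distrib]
  ring

theorem approx_moments (hw : 𝓢.AdmFam w e₀ x₀) (hP : ∀ k, 𝓢.Reg (P k))
    (h : Approx m Y (ev w (𝓢.serY P)) e₀ x₀) :
    Approx m (moments w Y) (ev w (𝓢.serM P)) e₀ x₀ := by
  refine ⟨smoothFam_moments hw h.left, smoothFam_ev hw (reg_serM hP), ?_⟩
  rintro (k | k)
  · exact IsO.zero.congr (Eventually.of_forall fun z => by simp [ev_serM_inl, moments])
  · exact (h.isO k).congr (Eventually.of_forall fun z => by simp [ev_serM_inr, moments])

theorem approx_relaxed (hw : 𝓢.AdmFam w e₀ x₀) (hP : ∀ k, 𝓢.Reg (P k))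
    (h : Approx m Y (ev w (𝓢.serY P)) e₀ x₀) :
    Approx m (𝓢.relaxed w Y) (ev w (𝓢.serMstar P)) e₀ x₀ := by
  refine ⟨smoothFam_relaxed hw h.left, smoothFam_ev hw (reg_serMstar hP), ?_⟩
  rintro (k | k)
  · exact IsO.zero.congr (Eventually.of_forall fun z => by simp [ev_serMstar_inl, relaxed])
  · exact ((h.isO k).sub (IsO.sum (s := Finset.univ) fun j _ =>
      (h.isO j).const_mul (𝓢.S k j))).congr (Eventually.of_forall fun z => relaxed_sub_ev _ _ _)

/-! ### Comparison of the defect with the formal residual; the bootstrap -/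

/-- The defect of the equation `exp(Δt ∂_t) m = exp(-Δt Λ) m*`, truncated after the order four. -/
noncomputable def defect (𝓢 : Scheme d p r) (u ustar : ℝ × ℝ → VField d (Idx p r)) (k : Idx p r)
    (z : (ℝ × ℝ) × Space d) : ℝ :=
  ∑ l ∈ Finset.range 5, (z.1.2 ^ 2) ^ l *
    (1 ^ l / (l.factorial : ℝ) * tD^[l] u z.1 z.2 k
      - (-1) ^ l / (l.factorial : ℝ) * 𝓢.advection^[l] (ustar z.1) z.2 k)

/-- The formal residual approximates the expansion of the scheme. -/
theorem isO_ev_residual (hw : 𝓢.AdmFam w e₀ x₀) (hV : ∀ k, 𝓢.Reg (V k)) (hP : ∀ k, 𝓢.Reg (P k))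
    (k : Idx p r) :
    IsO 5 (fun z => ∑ l ∈ Finset.range 5, (z.1.2 ^ 2) ^ l *
      (1 ^ l / (l.factorial : ℝ) * ev w ((timeDeriv V)^[l] (𝓢.serM P)) z.1 z.2 k
        - (-1) ^ l / (l.factorial : ℝ) *
          ev w (fun j W => 𝓢.advection^[l] (𝓢.serMstar P j W)) z.1 z.2 k)
      - ev w (𝓢.residual 1 V P) z.1 z.2 k) (e₀, x₀) := by
  -- The term with i derivatives acting on coefficients of index j; the residual of order n is the
  -- antidiagonal sum i + j = n.
  let a : ℕ → ℕ → Operator d p (Idx p r) := fun i j =>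
    (1 ^ i / (i.factorial : ℝ)) • (timeDeriv V)^[i] (𝓢.serM P) j
      - ((-1) ^ i / (i.factorial : ℝ)) • fun W => 𝓢.advection^[i] (𝓢.serMstar P j W)
  have ha : ∀ i j, 𝓢.Reg (a i j) := fun i j =>
    ((reg_timeDeriv_iterate hV (reg_serM hP) i j).smul _).sub
      (((linDiffOp_advection_iterate i).reg (reg_serMstar hP j)).smul _)
  have h : IsO 5 (fun z : (ℝ × ℝ) × Space d => (z.1.2 ^ 2) ^ 5 * ∑ i ∈ Finset.range 5,
      ∑ j ∈ Finset.range i, (z.1.2 ^ 2) ^ j * a i (5 + j - i) (w z.1) z.2 k) (e₀, x₀) := by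
    refine (IsO.of_smoothAt ?_).pow_mul 5
    exact SmoothAt.sum fun i _ => SmoothAt.sum fun j _ => (IsO.smoothAt_pow j _).mul
      ((ha i _).smooth _ _ _ _ hw k)
  refine h.congr (Eventually.of_forall fun z => ?_)
  have hc := cauchy_product (z.1.2 ^ 2) fun i j => a i j (w z.1) z.2 k
  have h1 : ∀ l, 1 ^ l / (l.factorial : ℝ) * ev w ((timeDeriv V)^[l] (𝓢.serM P)) z.1 z.2 k
        - (-1) ^ l / (l.factorial : ℝ) *
          ev w (fun j W => 𝓢.advection^[l] (𝓢.serMstar P j W)) z.1 z.2 k =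
      ∑ j ∈ Finset.range 5, (z.1.2 ^ 2) ^ j * a l j (w z.1) z.2 k := by
    intro l
    simp only [ev_apply, Finset.mul_sum, ← Finset.sum_sub_distrib, a, Pi.sub_apply, Pi.smul_apply,
      smul_eq_mul]
    exact Finset.sum_congr rfl fun j _ => by ring
  have h2 : ev w (𝓢.residual 1 V P) z.1 z.2 k = ∑ n ∈ Finset.range 5, (z.1.2 ^ 2) ^ n *
      ∑ i ∈ Finset.range (n + 1), a i (n - i) (w z.1) z.2 k := by
    rw [ev_apply]
    refine Finset.sum_congr rfl fun n _ => ?_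
    rw [residual_eq]
    simp [a, Finset.sum_apply]
  simp only [h1, h2, Finset.mul_sum _ _ ((z.1.2 ^ 2) ^ _)] at hc ⊢
  linarith

/-- Expresses the smallness of the defect through the differences between the true derivatives and
their series, the quantities that the bootstrap controls. -/
theorem isO_defect_sub (hw : 𝓢.AdmFam w e₀ x₀) (hV : ∀ k, 𝓢.Reg (V k)) (hP : ∀ k, 𝓢.Reg (P k))
    {u ustar : ℝ × ℝ → VField d (Idx p r)} (k : Idx p r)
    (h : IsO 5 (𝓢.defect u ustar k) (e₀, x₀)) :
    IsO 5 (fun z => ∑ l ∈ Finset.range 5, (z.1.2 ^ 2) ^ l *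
      (1 ^ l / (l.factorial : ℝ) *
          (tD^[l] u z.1 z.2 k - ev w ((timeDeriv V)^[l] (𝓢.serM P)) z.1 z.2 k)
        - (-1) ^ l / (l.factorial : ℝ) * (𝓢.advection^[l] (ustar z.1) z.2 k -
          ev w (fun j W => 𝓢.advection^[l] (𝓢.serMstar P j W)) z.1 z.2 k))
      + ev w (𝓢.residual 1 V P) z.1 z.2 k) (e₀, x₀) := by
  refine (h.sub (isO_ev_residual hw hV hP k)).congr (Eventually.of_forall fun z => ?_)
  simp only [defect, ← sub_add, ← Finset.sum_sub_distrib]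
  congr 1
  exact Finset.sum_congr rfl fun l _ => by ring

/-- The term l = 0 of the nonconserved equation is the error on Y minus that on Y*, that is S times
the error on Y. All other terms have order m and carry a factor Δt, so inverting S gains one order.
-/
theorem approx_succ_right (hw : 𝓢.AdmFam w e₀ x₀) (hV : ∀ k, 𝓢.Reg (V k)) (hP : ∀ k, 𝓢.Reg (P k))
    (hcons : 𝓢.IsConsistent 1 V P)
    (hdef : ∀ k, IsO 5 (𝓢.defect (moments w Y) (𝓢.relaxed w Y) k) (e₀, x₀))
    (hm : m < 4) (hA : Approx m (tD w) (ev w V) e₀ x₀)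
    (hB : Approx m Y (ev w (𝓢.serY P)) e₀ x₀) :
    Approx (m + 1) Y (ev w (𝓢.serY P)) e₀ x₀ := by
  refine ⟨hB.left, hB.right, ?_⟩
  -- Consistency removes the nonconserved residual up to order three only; the remaining (η²) ^ 4
  -- term limits the bootstrap to order four.
  have hres : ∀ i, IsO 4 (fun z => ev w (𝓢.residual 1 V P) z.1 z.2 (Sum.inr i)) (e₀, x₀) := by
    intro i
    refine ((IsO.of_smoothAt ((reg_residual hV hP 1 4).smooth _ _ _ _ hw (Sum.inr i))).pow_mul
      4).congr ?_
    filter_upwards [hw.eventually] with z hz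
    have h := (hcons _ _ hz.admissibleAt).2
    rw [ev_apply, Finset.sum_range_succ, Finset.sum_eq_zero, zero_add]
    intro n hn
    rw [h n (by have := Finset.mem_range.1 hn; omega), mul_zero]
  have hM := fun l => approx_tD_iterate hw hV hA (by omega) (reg_serM hP)
    (approx_moments hw hP hB) l
  have hMs := fun l => approx_advection_iterate hw (reg_serMstar hP) (approx_relaxed hw hP hB) l
  have hS : ∀ i, IsO (m + 1) (fun z => ∑ j, 𝓢.S i j * (Y z.1 z.2 j - ev w (𝓢.serY P) z.1 z.2 j))
      (e₀, x₀) := by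
    intro i
    have h1 := ((isO_defect_sub hw hV hP _ (hdef (Sum.inr i))).mono (show m + 1 ≤ 5 by omega)).sub
      ((hres i).mono (show m + 1 ≤ 4 by omega))
    have h2 : IsO (m + 1) (fun z => ∑ l ∈ Finset.range 4, (z.1.2 ^ 2) ^ (l + 1) *
      (1 ^ (l + 1) / ((l + 1).factorial : ℝ) *
          (tD^[l + 1] (moments w Y) z.1 z.2 (Sum.inr i)
            - ev w ((timeDeriv V)^[l + 1] (𝓢.serM P)) z.1 z.2 (Sum.inr i))
        - (-1) ^ (l + 1) / ((l + 1).factorial : ℝ) *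
          (𝓢.advection^[l + 1] (𝓢.relaxed w Y z.1) z.2 (Sum.inr i) -
          ev w (fun j W => 𝓢.advection^[l + 1] (𝓢.serMstar P j W)) z.1 z.2 (Sum.inr i))))
          (e₀, x₀) := by
      refine IsO.sum fun l _ => ?_
      exact (((((hM (l + 1)).isO (Sum.inr i)).const_mul _).sub
        (((hMs (l + 1)).isO (Sum.inr i)).const_mul _)).pow_mul (l + 1)).mono (by omega)
    refine (h1.sub h2).congr (Eventually.of_forall fun z => ?_)
    simp only
    rw [Finset.sum_range_succ' _ 4]
    have h3 := relaxed_sub_ev (𝓢 := 𝓢) (w := w) (Y := Y) (P := P) z.1 z.2 i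
    have h4 : moments w Y z.1 z.2 (Sum.inr i) = Y z.1 z.2 i := rfl
    simp only [Function.iterate_zero, id_eq, pow_zero, Nat.factorial_zero, Nat.cast_one, div_one,
      one_mul, h3, ev_serM_inr, h4]
    ring
  intro i
  have hinv : 𝓢.S⁻¹ * 𝓢.S = 1 :=
    Matrix.nonsing_inv_mul _ ((Matrix.isUnit_iff_isUnit_det _).1 𝓢.isUnit_S)
  refine (IsO.sum (s := Finset.univ) fun l _ => (hS l).const_mul (𝓢.S⁻¹ i l)).congr
    (Eventually.of_forall fun z => ?_)
  have h5 : Y z.1 z.2 - ev w (𝓢.serY P) z.1 z.2 =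
      𝓢.S⁻¹ *ᵥ (𝓢.S *ᵥ (Y z.1 z.2 - ev w (𝓢.serY P) z.1 z.2)) := by
    rw [Matrix.mulVec_mulVec, hinv, Matrix.one_mulVec]
  exact congrFun h5 i

/-- In the conserved equation the term l = 0 cancels and l = 1 contains Δt times the error on ∂_t W.
The advection term at l = 1 has order m + 2 only because Y has already been improved; for l ≥ 2 the
factor Δt² suffices. Division by Δt = η² concludes. -/
theorem approx_succ_left (hw : 𝓢.AdmFam w e₀ x₀) (hV : ∀ k, 𝓢.Reg (V k)) (hP : ∀ k, 𝓢.Reg (P k))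
    (hcons : 𝓢.IsConsistent 1 V P)
    (hdef : ∀ k, IsO 5 (𝓢.defect (moments w Y) (𝓢.relaxed w Y) k) (e₀, x₀))
    (hm : m < 4) (hA : Approx m (tD w) (ev w V) e₀ x₀)
    (hB : Approx (m + 1) Y (ev w (𝓢.serY P)) e₀ x₀) :
    Approx (m + 1) (tD w) (ev w V) e₀ x₀ := by
  refine ⟨hA.left, hA.right, fun i => ?_⟩
  refine IsO.of_mul ((hA.left i).sub (hA.right i)) ?_
  have hB' : Approx m Y (ev w (𝓢.serY P)) e₀ x₀ :=
    ⟨hB.left, hB.right, fun k => (hB.isO k).mono (by omega)⟩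
  have hM := fun l => approx_tD_iterate hw hV hA (by omega) (reg_serM hP)
    (approx_moments hw hP hB') l
  have hMs := fun l => approx_advection_iterate hw (reg_serMstar hP) (approx_relaxed hw hP hB) l
  have h1 := (isO_defect_sub hw hV hP _ (hdef (Sum.inl i))).mono (show m + 1 + 1 ≤ 5 by omega)
  have h2 : IsO (m + 1 + 1) (fun z => ∑ l ∈ Finset.range 3, (z.1.2 ^ 2) ^ (l + 1 + 1) *
      (1 ^ (l + 1 + 1) / ((l + 1 + 1).factorial : ℝ) *
          (tD^[l + 1 + 1] (moments w Y) z.1 z.2 (Sum.inl i)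
            - ev w ((timeDeriv V)^[l + 1 + 1] (𝓢.serM P)) z.1 z.2 (Sum.inl i))
        - (-1) ^ (l + 1 + 1) / ((l + 1 + 1).factorial : ℝ) *
          (𝓢.advection^[l + 1 + 1] (𝓢.relaxed w Y z.1) z.2 (Sum.inl i) -
          ev w (fun j W => 𝓢.advection^[l + 1 + 1] (𝓢.serMstar P j W)) z.1 z.2 (Sum.inl i))))
          (e₀, x₀) := by
    refine IsO.sum fun l _ => ?_
    exact (((((hM (l + 1 + 1)).isO (Sum.inl i)).const_mul _).sub
      ((((hMs (l + 1 + 1)).isO (Sum.inl i)).mono (Nat.le_succ m)).const_mul _)).pow_mul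
        (l + 1 + 1)).mono (by omega)
  have h3 : IsO (m + 1 + 1) (fun z => (z.1.2 ^ 2) ^ 1 *
      (𝓢.advection^[1] (𝓢.relaxed w Y z.1) z.2 (Sum.inl i) -
          ev w (fun j W => 𝓢.advection^[1] (𝓢.serMstar P j W)) z.1 z.2 (Sum.inl i))) (e₀, x₀) :=
    (((hMs 1).isO (Sum.inl i)).pow_mul 1).mono (by omega)
  refine ((h1.sub h2).sub h3).congr ?_
  filter_upwards [hw.eventually] with z hz
  have hres : ev w (𝓢.residual 1 V P) z.1 z.2 (Sum.inl i) = 0 := by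
    rw [ev_apply]
    refine Finset.sum_eq_zero fun n hn => ?_
    rw [(hcons _ _ hz.admissibleAt).1 n (by have := Finset.mem_range.1 hn; omega), mul_zero]
  rw [hres, Finset.sum_range_succ' _ 4, Finset.sum_range_succ' _ 3]
  have h4 : moments w Y z.1 z.2 (Sum.inl i) = w z.1 z.2 i := rfl
  have h4' : 𝓢.relaxed w Y z.1 z.2 (Sum.inl i) = w z.1 z.2 i := rfl
  have h5 : tD^[0 + 1] (moments w Y) z.1 z.2 (Sum.inl i) = tD w z.1 z.2 i := rfl
  have h6 : ev w ((timeDeriv V)^[0 + 1] (𝓢.serM P)) z.1 z.2 (Sum.inl i) = ev w V z.1 z.2 i := by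
    rw [ev_apply, ev_apply]
    exact Finset.sum_congr rfl fun j _ => by
      rw [Function.iterate_succ_apply', Function.iterate_zero, id_eq, timeDeriv_serM_inl]
  rw [h5, h6]
  simp only [Function.iterate_zero, id_eq, pow_zero, Nat.factorial_zero, Nat.cast_one, div_one,
    one_mul, ev_serM_inl, ev_serMstar_inl, h4, h4', zero_add, pow_one, Nat.factorial_one]
  ring

theorem approx_four (hw : 𝓢.AdmFam w e₀ x₀) (hV : ∀ k, 𝓢.Reg (V k)) (hP : ∀ k, 𝓢.Reg (P k))
    (hcons : 𝓢.IsConsistent 1 V P)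
    (hdef : ∀ k, IsO 5 (𝓢.defect (moments w Y) (𝓢.relaxed w Y) k) (e₀, x₀))
    (hY : SmoothFam Y e₀ x₀) :
    Approx 4 (tD w) (ev w V) e₀ x₀ ∧ Approx 4 Y (ev w (𝓢.serY P)) e₀ x₀ := by
  suffices H : ∀ m ≤ 4, Approx m (tD w) (ev w V) e₀ x₀ ∧ Approx m Y (ev w (𝓢.serY P)) e₀ x₀ from
    H 4 le_rfl
  intro m
  induction m with
  | zero =>
    intro _
    have h1 := smoothFam_tD hw.2
    have h2 := smoothFam_ev hw hV
    have h3 := smoothFam_ev hw (reg_serY hP)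
    exact ⟨⟨h1, h2, fun k => IsO.of_smoothAt ((h1 k).sub (h2 k))⟩,
      ⟨hY, h3, fun k => IsO.of_smoothAt ((hY k).sub (h3 k))⟩⟩
  | succ m ih =>
    intro hm
    obtain ⟨hA, hB⟩ := ih (by omega)
    have hB' := approx_succ_right hw hV hP hcons hdef hm hA hB
    exact ⟨approx_succ_left hw hV hP hcons hdef hm hA hB', hB'⟩

end Scheme

end LatticeBoltzmann

namespace LatticeBoltzmann

/-! ### Uniform estimates on compact sets -/

section Uniform

variable {d m : ℕ} {n : Type} [Fintype n]

/-- The sets on which the bound is uniform are stable under subsets and finite unions, so local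
bounds suffice on a compact set. -/
theorem isBigO_principal_prod {X Y E F : Type*} [TopologicalSpace X] [SeminormedAddCommGroup E]
    [SeminormedAddCommGroup F] {u : X × Y → E} {v : X × Y → F} {l : Filter Y} {K : Set X}
    (hK : IsCompact K) (h : ∀ a ∈ K, u =O[𝓝 a ×ˢ l] v) : u =O[𝓟 K ×ˢ l] v := by
  refine hK.induction_on (p := fun s => u =O[𝓟 s ×ˢ l] v) (by simp)
    (fun s t hst ht => ht.mono (Filter.prod_mono_left _ (principal_mono.2 hst)))
    (fun s t hs ht => ?_) fun a ha => ?_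
  · rw [← sup_principal, sup_prod]
    exact hs.sup ht
  · obtain ⟨c, hc⟩ := (h a ha).bound
    obtain ⟨pa, hpa, pb, hpb, hp⟩ := eventually_prod_iff.1 hc
    refine ⟨{b | pa b}, mem_nhdsWithin_of_mem_nhds hpa, IsBigO.of_bound c ?_⟩
    exact eventually_prod_iff.2 ⟨pa, mem_principal_self _, pb, hpb, fun hx _ hy => hp hx hy⟩

/-- Return to Δt through η = √Δt; the smooth quotient is bounded near the point by continuity. -/
theorem IsO.isBigO {g : (ℝ × ℝ) × Space d → ℝ} {t : ℝ} {x : Space d} (h : IsO m g ((t, 0), x)) :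
    (fun q : (Space d × ℝ) × ℝ => g ((q.1.2, √q.2), q.1.1)) =O[𝓝 (x, t) ×ˢ 𝓝[>] 0]
      fun q => q.2 ^ m := by
  obtain ⟨h, hs, he⟩ := h
  have hc : Tendsto (fun q : (Space d × ℝ) × ℝ => ((q.1.2, √q.2), q.1.1))
      (𝓝 (x, t) ×ˢ 𝓝[>] 0) (𝓝 ((t, 0), x)) := by
    have h1 : ContinuousAt (fun q : (Space d × ℝ) × ℝ => ((q.1.2, √q.2), q.1.1)) ((x, t), 0) := by
      fun_prop
    have h2 : Tendsto (fun q : (Space d × ℝ) × ℝ => ((q.1.2, √q.2), q.1.1))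
      (𝓝 ((x, t), 0)) (𝓝 ((t, 0), x)) := by simpa [ContinuousAt] using h1
    refine h2.mono_left ?_
    rw [nhds_prod_eq (x := (x, t))]
    exact Filter.prod_mono_right (𝓝 (x, t)) nhdsWithin_le_nhds
  have hb : (fun q : (Space d × ℝ) × ℝ => h ((q.1.2, √q.2), q.1.1)) =O[𝓝 (x, t) ×ˢ 𝓝[>] 0]
      fun _ => (1 : ℝ) := (hs.continuousAt.tendsto.comp hc).isBigO_one ℝ
  have hm := (isBigO_refl (fun q : (Space d × ℝ) × ℝ => q.2 ^ m) (𝓝 (x, t) ×ˢ 𝓝[>] 0)).mul hb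
  simp only [mul_one] at hm
  refine hm.congr' ?_ EventuallyEq.rfl
  have hpos : ∀ᶠ q : (Space d × ℝ) × ℝ in 𝓝 (x, t) ×ˢ 𝓝[>] 0, 0 < q.2 :=
    tendsto_snd.eventually self_mem_nhdsWithin
  filter_upwards [hc.eventually he, hpos] with q h1 h2
  rw [h1, Real.sq_sqrt h2.le]

theorem isBigO_of_isO {G : Space d → ℝ → ℝ → n → ℝ} {K : Set (Space d × ℝ)} (hK : IsCompact K)
    (h : ∀ q ∈ K, ∀ i, IsO m (fun z => G z.2 z.1.1 (z.1.2 ^ 2) i) ((q.2, 0), q.1)) :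
    (fun q : (Space d × ℝ) × ℝ => G q.1.1 q.1.2 q.2) =O[𝓟 K ×ˢ 𝓝[>] 0] fun q => q.2 ^ m := by
  refine isBigO_principal_prod hK fun q hq => isBigO_pi.2 fun i => ?_
  refine (h q hq i).isBigO.congr' ?_ EventuallyEq.rfl
  have hpos : ∀ᶠ q : (Space d × ℝ) × ℝ in 𝓝 (q.1, q.2) ×ˢ 𝓝[>] 0, 0 < q.2 :=
    tendsto_snd.eventually self_mem_nhdsWithin
  filter_upwards [hpos] with q h2
  rw [Real.sq_sqrt h2.le]

end Uniform

/-! ### Regular solutions of the scheme -/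

theorem SmoothFam.mulVec {d : ℕ} {E : Type*} {n n' : Type} [NormedAddCommGroup E]
    [NormedSpace ℝ E] [Fintype n'] {u : E → VField d n'} {e : E} {x : Space d}
    (hu : SmoothFam u e x) (A : Matrix n n' ℝ) : SmoothFam (fun e y => A *ᵥ u e y) e x := fun k =>
  SmoothAt.sum fun j _ => (hu j).const_mul (A k j)

namespace Scheme

variable {d p r : ℕ} {𝓢 : Scheme d p r} {T δ : ℝ} {f : Space d → ℝ → ℝ → Idx p r → ℝ}

/-- The conserved moments of a solution, with `Δt = η²`. -/
def famW (𝓢 : Scheme d p r) (f : Space d → ℝ → ℝ → Idx p r → ℝ) : ℝ × ℝ → VField d (Fin p) :=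
  fun e y => 𝓢.conserved (f y e.1 (e.2 ^ 2))

/-- The nonconserved moments of a solution, with `Δt = η²`. -/
def famY (𝓢 : Scheme d p r) (f : Space d → ℝ → ℝ → Idx p r → ℝ) : ℝ × ℝ → VField d (Fin r) :=
  fun e y => 𝓢.nonconserved (f y e.1 (e.2 ^ 2))

theorem moments_fam : moments (𝓢.famW f) (𝓢.famY f) = fun e y => 𝓢.M *ᵥ f y e.1 (e.2 ^ 2) := by
  ext e y (k | k) <;> rfl

theorem relaxed_fam : 𝓢.relaxed (𝓢.famW f) (𝓢.famY f) =
    fun e y => 𝓢.M *ᵥ 𝓢.relax (f y e.1 (e.2 ^ 2)) := by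
  ext e y k
  rw [relax, Matrix.mulVec_mulVec, Matrix.mul_nonsing_inv _
    ((Matrix.isUnit_iff_isUnit_det _).1 𝓢.isUnit_M), Matrix.one_mulVec]
  rfl

theorem relax_fam : (fun (e : ℝ × ℝ) y => 𝓢.relax (f y e.1 (e.2 ^ 2))) =
    fun e y => 𝓢.M⁻¹ *ᵥ 𝓢.relaxed (𝓢.famW f) (𝓢.famY f) e y := rfl

namespace IsRegularSolution

variable {t : ℝ}

theorem smoothFam (hf : 𝓢.IsRegularSolution T δ f) (hδ : 0 < δ) (ht : t ∈ Ioo 0 T) (x : Space d) :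
    SmoothFam (fun (e : ℝ × ℝ) y => f y e.1 (e.2 ^ 2)) (t, 0) x := by
  let φ : (ℝ × ℝ) × Space d → Space d × ℝ × ℝ := fun z => (z.2, z.1.1, z.1.2 ^ 2)
  have hφ : ContDiff ℝ ∞ φ := by fun_prop
  -- This set is open and contains points with η ≤ 0, yet η² lies in [0, δ): one-sided regularity in
  -- Δt has become two-sided in η.
  let O : Set ((ℝ × ℝ) × Space d) := {z | z.1.1 ∈ Ioo 0 T ∧ z.1.2 ^ 2 < δ}
  have hO : IsOpen O := (isOpen_Ioo.preimage (continuous_fst.comp continuous_fst)).inter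
    (isOpen_Iio.preimage ((continuous_snd.comp continuous_fst).pow 2))
  have h := hf.contDiffOn.comp (s := O) hφ.contDiffOn
    fun z hz => ⟨mem_univ _, hz.1, sq_nonneg _, hz.2⟩
  have hs : SmoothAt (fun z : (ℝ × ℝ) × Space d => f z.2 z.1.1 (z.1.2 ^ 2)) ((t, 0), x) := by
    have hmem : ((t, (0 : ℝ)), x) ∈ O := ⟨ht, by simpa using hδ⟩
    filter_upwards [hO.eventually_mem hmem] with z hz
    exact h.contDiffAt (hO.mem_nhds hz)
  exact fun k => SmoothAt.apply hs k

theorem admFam (hf : 𝓢.IsRegularSolution T δ f) (hδ : 0 < δ) (ht : t ∈ Ioo 0 T) (x : Space d) :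
    𝓢.AdmFam (𝓢.famW f) (t, 0) x :=
  ⟨hf.conserved_mem x t ht _ (by simpa using hδ), fun k =>
    (hf.smoothFam hδ ht x).mulVec 𝓢.M (Sum.inl k)⟩

theorem smoothFam_famY (hf : 𝓢.IsRegularSolution T δ f) (hδ : 0 < δ) (ht : t ∈ Ioo 0 T)
    (x : Space d) : SmoothFam (𝓢.famY f) (t, 0) x := fun k =>
  (hf.smoothFam hδ ht x).mulVec 𝓢.M (Sum.inr k)

theorem smoothFam_relax (hf : 𝓢.IsRegularSolution T δ f) (hδ : 0 < δ) (ht : t ∈ Ioo 0 T)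
    (x : Space d) : SmoothFam (fun (e : ℝ × ℝ) y => 𝓢.relax (f y e.1 (e.2 ^ 2))) (t, 0) x := by
  rw [relax_fam]
  exact (smoothFam_relaxed (hf.admFam hδ ht x) (hf.smoothFam_famY hδ ht x)).mulVec 𝓢.M⁻¹

/-- The error of one time step is smooth and vanishes on the grid, hence has every order, off the
grid as well. -/
theorem isO_step (hf : 𝓢.IsRegularSolution T δ f) (hδ : 0 < δ) (ht : t ∈ Ioo 0 T)
    (x : Space d) (j : Idx p r) (m : ℕ) :
    IsO m (fun z => f z.2 (z.1.1 + z.1.2 ^ 2) (z.1.2 ^ 2) j -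
      𝓢.relax (f (z.2 - z.1.2 ^ 2 • 𝓢.v j) z.1.1 (z.1.2 ^ 2)) j) ((t, 0), x) := by
  refine 𝓢.isO_of_grid ht.1 ?_ ?_ m
  · refine SmoothAt.sub ?_ ?_
    · exact SmoothAt.comp_of_eq (g := fun z : (ℝ × ℝ) × Space d => f z.2 z.1.1 (z.1.2 ^ 2) j)
        (f := fun z : (ℝ × ℝ) × Space d => ((z.1.1 + z.1.2 ^ 2, z.1.2), z.2)) _
        (hf.smoothFam hδ ht x j) (.of_contDiff (by fun_prop) _) (by simp)
    · exact SmoothAt.comp_of_eq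
        (g := fun z : (ℝ × ℝ) × Space d => 𝓢.relax (f z.2 z.1.1 (z.1.2 ^ 2)) j)
        (f := fun z : (ℝ × ℝ) × Space d => (z.1, z.2 - z.1.2 ^ 2 • 𝓢.v j)) _
        (hf.smoothFam_relax hδ ht x j) (.of_contDiff (by fun_prop) _) (by simp)
  · have h1 : ∀ᶠ z : (ℝ × ℝ) × Space d in 𝓝 ((t, 0), x), 0 < z.1.1 :=
      (show ContinuousAt (fun z : (ℝ × ℝ) × Space d => z.1.1) ((t, 0), x) by fun_prop).eventually
        (lt_mem_nhds ht.1)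
    have h2 : ∀ᶠ z : (ℝ × ℝ) × Space d in 𝓝 ((t, 0), x), z.1.1 + z.1.2 ^ 2 < T :=
      (show ContinuousAt (fun z : (ℝ × ℝ) × Space d => z.1.1 + z.1.2 ^ 2) ((t, 0), x) by
        fun_prop).eventually (gt_mem_nhds (by simpa using ht.2))
    have h3 : ∀ᶠ z : (ℝ × ℝ) × Space d in 𝓝 ((t, 0), x), z.1.2 ^ 2 < δ :=
      (show ContinuousAt (fun z : (ℝ × ℝ) × Space d => z.1.2 ^ 2) ((t, 0), x) by
        fun_prop).eventually (gt_mem_nhds (by simpa using hδ))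
    filter_upwards [h1, h2, h3] with z h1 h2 h3 ⟨hη, ⟨k, hk⟩, hx⟩
    have h := hf.step (z.1.2 ^ 2) ⟨pow_pos hη 2, h3⟩ z.2 hx k (hk ▸ h1) (by
      rw [add_mul, one_mul, ← hk]; exact h2) j
    rw [add_mul, one_mul, ← hk] at h
    exact sub_eq_zero.2 h

/-- M applied to the one-step identity, with m(t + Δt) expanded in time and each f*_j(x - v j Δt) in
space, both with remainder of order 5. -/
theorem isO_defect (hf : 𝓢.IsRegularSolution T δ f) (hδ : 0 < δ) (ht : t ∈ Ioo 0 T)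
    (x : Space d) (k : Idx p r) :
    IsO 5 (𝓢.defect (moments (𝓢.famW f) (𝓢.famY f)) (𝓢.relaxed (𝓢.famW f) (𝓢.famY f)) k)
      ((t, 0), x) := by
  have hm := smoothFam_moments (hf.admFam hδ ht x) (hf.smoothFam_famY hδ ht x)
  have hs := hf.smoothFam_relax hδ ht x
  have hA := isO_taylor (hm k) ((1, 0), 0) 5
  have hB := fun j => isO_taylor (hs j) ((0, 0), -𝓢.v j) 5
  have hR := fun j => hf.isO_step hδ ht x j 5
  have h := ((IsO.sum (s := Finset.univ) fun j _ => (hR j).const_mul (𝓢.M k j)).sub hA).add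
    (IsO.sum (s := Finset.univ) fun j _ => (hB j).const_mul (𝓢.M k j))
  refine h.congr ?_
  have h1 := eventually_all.2 fun l : Fin 5 => tD_iterate_eq hm k l
  have h2 := eventually_all.2 fun l : Fin 5 => 𝓢.advection_iterate_eq hs l
  filter_upwards [h1, h2] with z h1 h2
  have h3 : 𝓢.defect (moments (𝓢.famW f) (𝓢.famY f)) (𝓢.relaxed (𝓢.famW f) (𝓢.famY f)) k z =
      (∑ l ∈ Finset.range 5, (z.1.2 ^ 2) ^ l / (l.factorial : ℝ) *
        ((fun g' : (ℝ × ℝ) × Space d → ℝ => fun z => fderiv ℝ g' z ((1, 0), 0))^[l]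
          fun z => moments (𝓢.famW f) (𝓢.famY f) z.1 z.2 k) z) -
      ∑ j, 𝓢.M k j * ∑ l ∈ Finset.range 5, (z.1.2 ^ 2) ^ l / (l.factorial : ℝ) *
        ((fun g' : (ℝ × ℝ) × Space d → ℝ => fun z => fderiv ℝ g' z ((0, 0), -𝓢.v j))^[l]
          fun z => 𝓢.relax (f z.2 z.1.1 (z.1.2 ^ 2)) j) z := by
    simp only [Finset.mul_sum]
    rw [Finset.sum_comm, ← Finset.sum_sub_distrib]
    refine Finset.sum_congr rfl fun l hl => ?_
    have e1 := h1 ⟨l, Finset.mem_range.1 hl⟩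
    have e2 := h2 ⟨l, Finset.mem_range.1 hl⟩ k
    simp only at e1 e2
    rw [relaxed_fam, e1, e2, mul_sub, Finset.mul_sum, Finset.mul_sum, one_pow]
    congr 1
    · ring
    · refine Finset.sum_congr rfl fun j _ => ?_
      -- One sign comes from exp(-Δt Λ), the other from differentiating along -v j.
      have : ((-1 : ℝ) ^ l) * (-1) ^ l = 1 := by rw [← mul_pow]; simp
      linear_combination (𝓢.M k j * ((z.1.2 ^ 2) ^ l / (l.factorial : ℝ)) *
        ((fun g' : (ℝ × ℝ) × Space d → ℝ => fun z => fderiv ℝ g' z ((0, 0), -𝓢.v j))^[l]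
          fun z => 𝓢.relax (f z.2 z.1.1 (z.1.2 ^ 2)) j) z) * this
  rw [h3]
  have h4 : moments (𝓢.famW f) (𝓢.famY f) (z + z.1.2 ^ 2 • ((1, 0), 0)).1
      (z + z.1.2 ^ 2 • ((1, 0), 0)).2 k =
      ∑ j, 𝓢.M k j * f z.2 (z.1.1 + z.1.2 ^ 2) (z.1.2 ^ 2) j := by
    simp [moments_fam, Matrix.mulVec, dotProduct]
  rw [h4]
  simp only [mul_sub, Finset.sum_sub_distrib]
  simp [sub_eq_add_neg, -Fintype.sum_sum_type]
  ring

end IsRegularSolution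

end Scheme

end LatticeBoltzmann

/-! ### The fourth-order expansions of regular solutions, and the theorem -/

namespace LatticeBoltzmann

namespace Scheme

variable {d p r : ℕ} {𝓢 : Scheme d p r} {T δ : ℝ} {f : Space d → ℝ → ℝ → Idx p r → ℝ}

namespace IsRegularSolution

variable {t : ℝ}

theorem approx_four (hf : 𝓢.IsRegularSolution T δ f) (hδ : 0 < δ) (ht : t ∈ Ioo 0 T)
    (x : Space d) :
    Approx 4 (tD (𝓢.famW f)) (ev (𝓢.famW f) fun j W => -𝓢.gammaSeq (j + 1) W) (t, 0) x ∧
      Approx 4 (𝓢.famY f) (ev (𝓢.famW f) (𝓢.serY 𝓢.psiSeq)) (t, 0) x :=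
  Scheme.approx_four (hf.admFam hδ ht x) (fun j => (𝓢.reg_gammaSeq (j + 1)).neg) 𝓢.reg_psiSeq
    𝓢.isTaylor_gammaSeq (hf.isO_defect hδ ht x) (hf.smoothFam_famY hδ ht x)

theorem isO_conserved (hf : 𝓢.IsRegularSolution T δ f) (hδ : 0 < δ) (ht : t ∈ Ioo 0 T)
    (x : Space d) (i : Fin p) :
    IsO 4 (fun z =>
      (deriv (fun t => 𝓢.conserved (f z.2 t (z.1.2 ^ 2))) z.1.1
        + 𝓢.Gamma1 (𝓢.famW f z.1) z.2 + z.1.2 ^ 2 • 𝓢.Gamma2 (𝓢.famW f z.1) z.2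
        + (z.1.2 ^ 2) ^ 2 • 𝓢.Gamma3 (𝓢.famW f z.1) z.2
        + (z.1.2 ^ 2) ^ 3 • 𝓢.Gamma4 (𝓢.famW f z.1) z.2) i) ((t, 0), x) := by
  refine ((hf.approx_four hδ ht x).1.isO i).congr ?_
  filter_upwards [(hf.admFam hδ ht x).eventually] with z hz
  have h1 : deriv (fun t => 𝓢.conserved (f z.2 t (z.1.2 ^ 2))) z.1.1 i =
      tD (𝓢.famW f) z.1 z.2 i := by
    have h := (hasDerivAt_pi.2 fun i => hz.2.hasDerivAt i).deriv
    exact congrFun h i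
  -- The truncated series has five terms; the last involves `gammaSeq 5`, which is zero.
  simp only [Pi.add_apply, Pi.smul_apply, h1, ev_apply, Finset.sum_range_succ, gammaSeq]
  simp
  ring

theorem isO_nonconserved (hf : 𝓢.IsRegularSolution T δ f) (hδ : 0 < δ) (ht : t ∈ Ioo 0 T)
    (x : Space d) (i : Fin r) :
    IsO 4 (fun z =>
      (𝓢.nonconserved (f z.2 z.1.1 (z.1.2 ^ 2)) - 𝓢.equil (𝓢.famW f z.1) z.2
        - 𝓢.actSinv (z.1.2 ^ 2 • 𝓢.Psi1 (𝓢.famW f z.1)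
          + (z.1.2 ^ 2) ^ 2 • 𝓢.Psi2 (𝓢.famW f z.1)
          + (z.1.2 ^ 2) ^ 3 • 𝓢.Psi3 (𝓢.famW f z.1)) z.2) i) ((t, 0), x) := by
  refine ((hf.approx_four hδ ht x).2.isO i).congr (Eventually.of_forall fun z => ?_)
  -- Likewise `psiSeq 4` is zero, so the series for Y ends with Ψ₃.
  simp only [Pi.sub_apply, ev_apply, Finset.sum_range_succ, serY, actSinv, psiSeq, famY,
    Pi.add_apply, Pi.smul_apply, Matrix.mulVec_add, Matrix.mulVec_smul]
  simp
  ring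

end IsRegularSolution

end Scheme

end LatticeBoltzmann

open LatticeBoltzmann in
theorem proposition3 {d p r : ℕ} (𝓢 : Scheme d p r) :
    -- the operators of the Taylor expansion exist, are unique, and are given by the formulas
    (∀ (Γ : ℕ → Operator d p (Fin p)) (Ψ : ℕ → Operator d p (Fin r)),
      𝓢.IsTaylor Γ Ψ ↔ 𝓢.IsExplicit Γ Ψ) ∧
    -- and so are those of the Chapman-Enskog expansion
    (∀ τ₀ : ℝ, 0 < τ₀ → ∀ (Γ : ℕ → Operator d p (Fin p)) (Ψ : ℕ → Operator d p (Fin r)),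
      𝓢.IsChapmanEnskog τ₀ Γ Ψ ↔ 𝓢.IsExplicit Γ Ψ) ∧
    -- both families of operators coincide
    (∀ τ₀ : ℝ, 0 < τ₀ → ∀ (Γ Γ' : ℕ → Operator d p (Fin p)) (Ψ Ψ' : ℕ → Operator d p (Fin r)),
      𝓢.IsChapmanEnskog τ₀ Γ Ψ → 𝓢.IsTaylor Γ' Ψ' →
      ∀ (W : VField d (Fin p)) (x : Space d), 𝓢.AdmissibleAt W x →
        (∀ j ∈ Finset.Icc 1 4, Γ j W x = Γ' j W x) ∧
        (∀ j ∈ Finset.Icc 1 3, Ψ j W x = Ψ' j W x)) ∧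
    -- the resulting expansions hold for the regular solutions of the scheme
    (∀ (T δ : ℝ), 0 < T → 0 < δ → ∀ f : Space d → ℝ → ℝ → Idx p r → ℝ,
      𝓢.IsRegularSolution T δ f →
      ∀ K : Set (Space d × ℝ), IsCompact K → K ⊆ univ ×ˢ Ioo 0 T →
        ((fun z : (Space d × ℝ) × ℝ =>
            let W : VField d (Fin p) := fun y => 𝓢.conserved (f y z.1.2 z.2)
            deriv (fun t => 𝓢.conserved (f z.1.1 t z.2)) z.1.2
              + 𝓢.Gamma1 W z.1.1 + z.2 • 𝓢.Gamma2 W z.1.1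
              + z.2 ^ 2 • 𝓢.Gamma3 W z.1.1 + z.2 ^ 3 • 𝓢.Gamma4 W z.1.1)
          =O[𝓟 K ×ˢ 𝓝[>] 0] fun z => z.2 ^ 4) ∧
        ((fun z : (Space d × ℝ) × ℝ =>
            let W : VField d (Fin p) := fun y => 𝓢.conserved (f y z.1.2 z.2)
            𝓢.nonconserved (f z.1.1 z.1.2 z.2) - 𝓢.equil W z.1.1
              - 𝓢.actSinv (z.2 • 𝓢.Psi1 W + z.2 ^ 2 • 𝓢.Psi2 W + z.2 ^ 3 • 𝓢.Psi3 W) z.1.1)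
          =O[𝓟 K ×ˢ 𝓝[>] 0] fun z => z.2 ^ 4)) := by
  refine ⟨𝓢.isTaylor_iff, fun τ hτ Γ Ψ => ?_, fun τ hτ Γ Γ' Ψ Ψ' h h' W x hW => ?_,
    fun T δ hT hδ f hf K hK hKT => ⟨?_, ?_⟩⟩
  · rw [𝓢.isChapmanEnskog_iff hτ, 𝓢.isTaylor_iff]
  · rw [𝓢.isChapmanEnskog_iff hτ, 𝓢.isTaylor_iff] at h
    obtain ⟨h1, h2, h3, h4, h5, h6, h7⟩ := h W x hW
    obtain ⟨k1, k2, k3, k4, k5, k6, k7⟩ := (𝓢.isTaylor_iff _ _).1 h' W x hW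
    constructor
    · intro j hj
      obtain ⟨hj1, hj2⟩ := Finset.mem_Icc.1 hj
      interval_cases j
      exacts [h1.trans k1.symm, h3.trans k3.symm, h5.trans k5.symm, h7.trans k7.symm]
    · intro j hj
      obtain ⟨hj1, hj2⟩ := Finset.mem_Icc.1 hj
      interval_cases j
      exacts [h2.trans k2.symm, h4.trans k4.symm, h6.trans k6.symm]
  · exact isBigO_of_isO (G := fun x t Δt =>
      deriv (fun t => 𝓢.conserved (f x t Δt)) t
        + 𝓢.Gamma1 (fun y => 𝓢.conserved (f y t Δt)) x
        + Δt • 𝓢.Gamma2 (fun y => 𝓢.conserved (f y t Δt)) x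
        + Δt ^ 2 • 𝓢.Gamma3 (fun y => 𝓢.conserved (f y t Δt)) x
        + Δt ^ 3 • 𝓢.Gamma4 (fun y => 𝓢.conserved (f y t Δt)) x) hK
      fun q hq i => hf.isO_conserved hδ (hKT hq).2 q.1 i
  · exact isBigO_of_isO (G := fun x t Δt =>
      𝓢.nonconserved (f x t Δt) - 𝓢.equil (fun y => 𝓢.conserved (f y t Δt)) x
        - 𝓢.actSinv (Δt • 𝓢.Psi1 (fun y => 𝓢.conserved (f y t Δt))
          + Δt ^ 2 • 𝓢.Psi2 (fun y => 𝓢.conserved (f y t Δt))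
          + Δt ^ 3 • 𝓢.Psi3 (fun y => 𝓢.conserved (f y t Δt))) x) hK
      fun q hq i => hf.isO_nonconserved hδ (hKT hq).2 q.1 i
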